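/- All varieties and formal schemes are over $\mathbf C$. An action of $\mathbf C^\times$ on a variety or formal scheme means an algebraic one; a function $f$ has weight $d$ if $f(s\cdot x)=s^d f(x)$. A Poisson structure has degree $-k$ if the bracket of functions of weights $i,j$ has weight $i+j-k$. For $Z$ closed in an affine open subset $U$ of a variety $X$, $\hat X_Z$ is the formal spectrum of the completion of $\mathcal O(U)$ at the ideal of $Z$ (independent of $U$); $\hat\times$ is the completed product of formal schemes (formal spectrum of the completed tensor product). A symplectic leaf of a Poisson variety is a locally closed subvariety $Y$ whose tangent space at every point $y\in Y$ is the space of values at $y$ of Hamiltonian vector fields. A formal Poisson germ is $S=\operatorname{Spf}A$ with $A$ a complete Noetherian local $\mathbf C$-algebra with residue field $\mathbf C$ and a Poisson bracket (bivector $\pi_S$). Let $X$ be a variety with a $\mathbf C^\times$-action and a Poisson structure of degree $-k$ ($k\in\mathbf Z$), $Y\subseteq X$ a $\mathbf C^\times$-stable symplectic leaf, and $y\in Y$ a point with trivial stabilizer in $\mathbf C^\times$, whose orbit is closed in some affine open subset of $X$. Let $S$ be a formal Poisson germ which is the slice of a decomposition of $X$ along $\mathbf C^\times\cdot y$; that is,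 for the trivial action on $S$ there is a $\mathbf C^\times$-equivariant (not necessarily Poisson) isomorphism of formal schemes $$\hat X_{\mathbf C^\times\cdot y}\cong\hat Y_{\mathbf C^\times\cdot y}\,\hat\times\,S$$ taking the Poisson bivector of the left-hand side to $\pi_Y+t^{-k}\partial_u\wedge\xi+t^{-k}\pi_S$. Here $\hat Y_{\mathbf C^\times\cdot y}=\operatorname{Spf}\mathbf C[t,t^{-1}][\![u,z_1,\dots,z_{2m}]\!]$ in coordinates with $t$ of weight $1$ and $u,z_i$ of weight $0$, in which its Poisson bivector is $$\pi_Y=t^{1-k}\partial_u\wedge\partial_t+\sum_{i=1}^m\partial_{z'_{2i-1}}\wedge\partial_{z_{2i}},\qquad z'_{2i-1}=t^kz_{2i-1}$$ (partial derivatives with respect to the coordinates $t,u,z'_{2i-1},z_{2i}$), and $\xi$ is a vector field on $S$ with $[\xi,\pi_S]=k\pi_S$, i.e. $\xi\{f,g\}-\{\xi f,g\}-\{f,\xi g\}=k\{f,g\}$. Suppose that $S$ admits a $\mathbf C^\times$-action for which $\pi_S$ has degree $-k$, and that all Poisson vector fields on $S$ (derivations of $\mathcal O(S)$ that are also derivations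 of the bracket) are Hamiltonian (of the form $\{f,-\}$). Then: 1. There is a $\mathbf C^\times$-equivariant Poisson isomorphism of formal schemes $$\hat X_{\mathbf C^\times\cdot y}\cong\bigl(\hat Y_{\mathbf C^\times\cdot y}\,\hat\times\,S,\ \pi_Y+\pi_S\bigr),$$ where $\mathbf C^\times$ acts diagonally, through the given action on $S$. 2. $S$ is Poisson isomorphic to every slice in an ordinary Darboux–Weinstein decomposition at $y$: if $S'$ is a formal Poisson germ and there is a Poisson isomorphism of formal schemes $\hat X_y\cong(\hat Y_y\,\hat\times\,S',\ \pi_Y+\pi_{S'})$, then $S\cong S'$ as formal Poisson schemes. -/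

import Mathlib

open CategoryTheory AlgebraicGeometry
open scoped TensorProduct

universe u v

section Truncation

variable {A : Type u} [CommRing A] (J : Ideal A)

/-- A representative in `A` of the truncation modulo `J ^ n` of an element of the completion. -/
noncomputable def truncRep (n : ℕ) (x : AdicCompletion J A) : A :=
  Function.surjInv Ideal.Quotient.mk_surjective (AdicCompletion.evalₐ J n x)

lemma mk_truncRep (n : ℕ) (x : AdicCompletion J A) :
    Ideal.Quotient.mk (J ^ n) (truncRep J n x) = AdicCompletion.evalₐ J n x :=
  Function.surjInv_eq _ _

lemma factor_evalₐ {m n : ℕ} (h : m ≤ n) (x : AdicCompletion J A) :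
    Ideal.Quotient.factor (Ideal.pow_le_pow_right h) (AdicCompletion.evalₐ J n x)
      = AdicCompletion.evalₐ J m x := by
  induction x using AdicCompletion.induction_on with
  | h f =>
    rw [AdicCompletion.evalₐ_mk, AdicCompletion.evalₐ_mk, Ideal.Quotient.factor_mk]
    exact AdicCompletion.Ideal.mk_eq_mk J h f

lemma mk_truncRep_of_le {m n : ℕ} (h : m ≤ n) (x : AdicCompletion J A) :
    Ideal.Quotient.mk (J ^ m) (truncRep J n x) = AdicCompletion.evalₐ J m x := by
  rw [← factor_evalₐ J h, ← mk_truncRep J n x, Ideal.Quotient.factor_mk]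

end Truncation

/-- A bivector field on the (formal) affine scheme of a commutative `ℂ`-algebra `A`, given as
the skew-symmetric biderivation `(a, b) ↦ {a, b}`. -/
structure Bivector (A : Type u) [CommRing A] [Algebra ℂ A] where
  br : A →ₗ[ℂ] A →ₗ[ℂ] A
  skew : ∀ a b, br a b = -br b a
  leibniz : ∀ a b c, br a (b * c) = b * br a c + c * br a b

namespace Bivector

variable {A : Type u} [CommRing A] [Algebra ℂ A]

/-- A bivector field is Poisson if its bracket satisfies the Jacobi identity. -/
def IsPoisson (π : Bivector A) : Prop :=
  ∀ a b c, π.br a (π.br b c) = π.br (π.br a b) c + π.br b (π.br a c)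

lemma leibniz_left (π : Bivector A) (a b c : A) :
    π.br (a * b) c = a * π.br b c + b * π.br a c := by
  rw [π.skew, π.leibniz, π.skew c b, π.skew c a]; ring

lemma br_mem_of_mem_left (π : Bivector A) {K : Ideal A}
    (hK : ∀ a, ∀ h ∈ K, π.br a h ∈ K) {a : A} (ha : a ∈ K) (b : A) : π.br a b ∈ K := by
  rw [π.skew]; exact K.neg_mem (hK b a ha)

lemma mk_br_congr (π : Bivector A) {K : Ideal A} (hK : ∀ a, ∀ h ∈ K, π.br a h ∈ K)
    {a a' b b' : A} (ha : Ideal.Quotient.mk K a = Ideal.Quotient.mk K a')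
    (hb : Ideal.Quotient.mk K b = Ideal.Quotient.mk K b') :
    Ideal.Quotient.mk K (π.br a b) = Ideal.Quotient.mk K (π.br a' b') := by
  rw [Ideal.Quotient.eq] at *
  have h : π.br a b - π.br a' b' = π.br (a - a') b + π.br a' (b - b') := by
    simp only [map_sub, LinearMap.sub_apply]; ring
  rw [h]
  exact K.add_mem (π.br_mem_of_mem_left hK ha b) (hK _ _ hb)

/-- The bracket on `A ⧸ K`, computed on representatives. -/
noncomputable def quotientBr (π : Bivector A) (K : Ideal A) (x y : A ⧸ K) : A ⧸ K :=
  Ideal.Quotient.mk K (π.br (Function.surjInv Ideal.Quotient.mk_surjective x)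
    (Function.surjInv Ideal.Quotient.mk_surjective y))

lemma quotientBr_mk (π : Bivector A) {K : Ideal A} (hK : ∀ a, ∀ h ∈ K, π.br a h ∈ K) (a b : A) :
    π.quotientBr K (Ideal.Quotient.mk K a) (Ideal.Quotient.mk K b)
      = Ideal.Quotient.mk K (π.br a b) :=
  π.mk_br_congr hK (Function.surjInv_eq _ _) (Function.surjInv_eq _ _)

/-- The bivector field induced on the closed subscheme of an ideal stable under brackets. -/
noncomputable def quotient (π : Bivector A) (K : Ideal A)
    (hK : ∀ a, ∀ h ∈ K, π.br a h ∈ K) : Bivector (A ⧸ K) where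
  br := LinearMap.mk₂ ℂ (π.quotientBr K)
    (fun x x' y => by
      obtain ⟨a, rfl⟩ := Ideal.Quotient.mk_surjective x
      obtain ⟨a', rfl⟩ := Ideal.Quotient.mk_surjective x'
      obtain ⟨b, rfl⟩ := Ideal.Quotient.mk_surjective y
      rw [← map_add, π.quotientBr_mk hK, π.quotientBr_mk hK, π.quotientBr_mk hK, map_add,
        LinearMap.add_apply, map_add])
    (fun c x y => by
      obtain ⟨a, rfl⟩ := Ideal.Quotient.mk_surjective x
      obtain ⟨b, rfl⟩ := Ideal.Quotient.mk_surjective y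
      have h : ∀ z : A, c • Ideal.Quotient.mk K z = Ideal.Quotient.mk K (c • z) := fun _ => rfl
      simp only [h, π.quotientBr_mk hK, map_smul, LinearMap.smul_apply])
    (fun x y y' => by
      obtain ⟨a, rfl⟩ := Ideal.Quotient.mk_surjective x
      obtain ⟨b, rfl⟩ := Ideal.Quotient.mk_surjective y
      obtain ⟨b', rfl⟩ := Ideal.Quotient.mk_surjective y'
      rw [← map_add, π.quotientBr_mk hK, π.quotientBr_mk hK, π.quotientBr_mk hK, map_add, map_add])
    (fun c x y => by
      obtain ⟨a, rfl⟩ := Ideal.Quotient.mk_surjective x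
      obtain ⟨b, rfl⟩ := Ideal.Quotient.mk_surjective y
      have h : ∀ z : A, c • Ideal.Quotient.mk K z = Ideal.Quotient.mk K (c • z) := fun _ => rfl
      simp only [h, π.quotientBr_mk hK, map_smul])
  skew x y := by
    obtain ⟨a, rfl⟩ := Ideal.Quotient.mk_surjective x
    obtain ⟨b, rfl⟩ := Ideal.Quotient.mk_surjective y
    simp only [LinearMap.mk₂_apply, π.quotientBr_mk hK]
    rw [π.skew a b, map_neg]
  leibniz x y z := by
    obtain ⟨a, rfl⟩ := Ideal.Quotient.mk_surjective x
    obtain ⟨b, rfl⟩ := Ideal.Quotient.mk_surjective y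
    obtain ⟨c, rfl⟩ := Ideal.Quotient.mk_surjective z
    simp only [LinearMap.mk₂_apply, ← map_mul, ← map_add, π.quotientBr_mk hK, π.leibniz]

/-- The induced bracket on the quotient is the bracket of representatives. -/
lemma quotient_br_mk (π : Bivector A) (K : Ideal A) (hK : ∀ a, ∀ h ∈ K, π.br a h ∈ K) (a b : A) :
    (π.quotient K hK).br (Ideal.Quotient.mk K a) (Ideal.Quotient.mk K b)
      = Ideal.Quotient.mk K (π.br a b) :=
  π.quotientBr_mk hK a b

section Completion

variable (J : Ideal A)

lemma br_mem_pow (π : Bivector A) (n : ℕ) (a h : A) (hh : h ∈ J ^ (n + 1)) :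
    π.br a h ∈ J ^ n := by
  induction n generalizing h with
  | zero => simp
  | succ n ih =>
    rw [pow_succ] at hh
    induction hh using Submodule.mul_induction_on' with
    | mem_mul_mem x hx y hy =>
      rw [π.leibniz]
      refine Ideal.add_mem _ (Ideal.mul_mem_right _ _ hx) ?_
      rw [pow_succ, mul_comm y]
      exact Ideal.mul_mem_mul (ih x hx) hy
    | add x hx y hy h1 h2 => rw [map_add]; exact Ideal.add_mem _ h1 h2

lemma mk_pow_br_congr (π : Bivector A) (n : ℕ) {a a' b b' : A}
    (ha : Ideal.Quotient.mk (J ^ (n + 1)) a = Ideal.Quotient.mk (J ^ (n + 1)) a')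
    (hb : Ideal.Quotient.mk (J ^ (n + 1)) b = Ideal.Quotient.mk (J ^ (n + 1)) b') :
    Ideal.Quotient.mk (J ^ n) (π.br a b) = Ideal.Quotient.mk (J ^ n) (π.br a' b') := by
  rw [Ideal.Quotient.eq] at *
  have h : π.br a b - π.br a' b' = -π.br b (a - a') + π.br a' (b - b') := by
    rw [π.skew b]; simp only [map_sub, LinearMap.sub_apply]; ring
  rw [h]
  exact Ideal.add_mem _ ((J ^ n).neg_mem (π.br_mem_pow J n _ _ ha)) (π.br_mem_pow J n _ _ hb)

/-- The bracket on the `J`-adic completion, extended by continuity: modulo `J ^ n` it is the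
bracket of representatives modulo `J ^ (n + 1)`. -/
noncomputable def completionBr (π : Bivector A) (x y : AdicCompletion J A) :
    AdicCompletion J A :=
  AdicCompletion.mk J A (AdicCompletion.AdicCauchySequence.mk J A
    (fun n => π.br (truncRep J (n + 1) x) (truncRep J (n + 1) y)) (by
      intro n
      have : (J ^ n • ⊤ : Submodule A A) = J ^ n := by simp
      rw [this, SModEq.sub_mem]
      rw [← Ideal.Quotient.eq]
      exact π.mk_pow_br_congr J n
        (by rw [mk_truncRep, mk_truncRep_of_le J (Nat.le_succ _)])
        (by rw [mk_truncRep, mk_truncRep_of_le J (Nat.le_succ _)])))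

lemma evalₐ_completionBr (π : Bivector A) (n : ℕ) (x y : AdicCompletion J A) (a b : A)
    (ha : Ideal.Quotient.mk (J ^ (n + 1)) a = AdicCompletion.evalₐ J (n + 1) x)
    (hb : Ideal.Quotient.mk (J ^ (n + 1)) b = AdicCompletion.evalₐ J (n + 1) y) :
    AdicCompletion.evalₐ J n (π.completionBr J x y) = Ideal.Quotient.mk (J ^ n) (π.br a b) := by
  rw [completionBr, AdicCompletion.evalₐ_mk]
  exact π.mk_pow_br_congr J n (by rw [mk_truncRep, ha]) (by rw [mk_truncRep, hb])

lemma evalₐ_smul (n : ℕ) (c : ℂ) (x : AdicCompletion J A) :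
    AdicCompletion.evalₐ J n (c • x) = c • AdicCompletion.evalₐ J n x := by
  rw [Algebra.smul_def, map_mul, Algebra.smul_def, AdicCompletion.algebraMap_apply,
    AdicCompletion.evalₐ_of]
  rfl

/-- The bivector field induced on the `J`-adic completion. -/
noncomputable def completion (π : Bivector A) : Bivector (AdicCompletion J A) where
  br := LinearMap.mk₂ ℂ (π.completionBr J)
    (fun x x' y => AdicCompletion.ext_evalₐ fun n => by
      rw [map_add, π.evalₐ_completionBr J n _ _ (truncRep J (n + 1) x + truncRep J (n + 1) x')
          (truncRep J (n + 1) y) (by simp [mk_truncRep]) (mk_truncRep ..),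
        π.evalₐ_completionBr J n x y _ _ (mk_truncRep ..) (mk_truncRep ..),
        π.evalₐ_completionBr J n x' y _ _ (mk_truncRep ..) (mk_truncRep ..)]
      simp)
    (fun c x y => AdicCompletion.ext_evalₐ fun n => by
      have h (k : ℕ) (z : A) : Ideal.Quotient.mk (J ^ k) (c • z) = c • Ideal.Quotient.mk (J ^ k) z :=
        rfl
      rw [evalₐ_smul, π.evalₐ_completionBr J n _ _ (c • truncRep J (n + 1) x)
          (truncRep J (n + 1) y) (by rw [h, mk_truncRep, evalₐ_smul]) (mk_truncRep ..),
        π.evalₐ_completionBr J n x y _ _ (mk_truncRep ..) (mk_truncRep ..)]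
      rw [map_smul, LinearMap.smul_apply, h])
    (fun x y y' => AdicCompletion.ext_evalₐ fun n => by
      rw [map_add, π.evalₐ_completionBr J n _ _ (truncRep J (n + 1) x)
          (truncRep J (n + 1) y + truncRep J (n + 1) y') (mk_truncRep ..) (by simp [mk_truncRep]),
        π.evalₐ_completionBr J n x y _ _ (mk_truncRep ..) (mk_truncRep ..),
        π.evalₐ_completionBr J n x y' _ _ (mk_truncRep ..) (mk_truncRep ..)]
      simp)
    (fun c x y => AdicCompletion.ext_evalₐ fun n => by
      have h (k : ℕ) (z : A) : Ideal.Quotient.mk (J ^ k) (c • z) = c • Ideal.Quotient.mk (J ^ k) z :=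
        rfl
      rw [evalₐ_smul, π.evalₐ_completionBr J n _ _ (truncRep J (n + 1) x)
          (c • truncRep J (n + 1) y) (mk_truncRep ..) (by rw [h, mk_truncRep, evalₐ_smul]),
        π.evalₐ_completionBr J n x y _ _ (mk_truncRep ..) (mk_truncRep ..)]
      rw [map_smul, h])
  skew x y := AdicCompletion.ext_evalₐ fun n => by
    simp only [LinearMap.mk₂_apply, map_neg]
    rw [π.evalₐ_completionBr J n x y _ _ (mk_truncRep ..) (mk_truncRep ..),
      π.evalₐ_completionBr J n y x _ _ (mk_truncRep ..) (mk_truncRep ..), π.skew, map_neg]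
  leibniz x y z := AdicCompletion.ext_evalₐ fun n => by
    simp only [LinearMap.mk₂_apply, map_mul, map_add]
    rw [π.evalₐ_completionBr J n x (y * z) (truncRep J (n + 1) x)
        (truncRep J (n + 1) y * truncRep J (n + 1) z) (mk_truncRep ..)
        (by simp only [map_mul, mk_truncRep]),
      π.evalₐ_completionBr J n x y _ _ (mk_truncRep ..) (mk_truncRep ..),
      π.evalₐ_completionBr J n x z _ _ (mk_truncRep ..) (mk_truncRep ..), π.leibniz, map_add,
      map_mul, map_mul, mk_truncRep_of_le J (Nat.le_succ n), mk_truncRep_of_le J (Nat.le_succ n)]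

/-- On the image of `A`, the bracket on the completion is the bracket of `A`. -/
lemma completion_br_of (π : Bivector A) (a b : A) :
    (π.completion J).br (AdicCompletion.of J A a) (AdicCompletion.of J A b)
      = AdicCompletion.of J A (π.br a b) :=
  AdicCompletion.ext_evalₐ fun n => by
    rw [AdicCompletion.evalₐ_of]
    exact π.evalₐ_completionBr J n _ _ a b (by rw [AdicCompletion.evalₐ_of])
      (by rw [AdicCompletion.evalₐ_of])

end Completion

section Tensor

variable {B : Type v} [CommRing B] [Algebra ℂ B]

/-- The bracket of the sum `π₁ + π₂` on a product:
`{a ⊗ b, a' ⊗ b'} = {a, a'} ⊗ b b' + a a' ⊗ {b, b'}`. -/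
noncomputable def prodBr (π₁ : Bivector A) (π₂ : Bivector B) :
    A ⊗[ℂ] B →ₗ[ℂ] A ⊗[ℂ] B →ₗ[ℂ] A ⊗[ℂ] B :=
  TensorProduct.map₂ π₁.br (LinearMap.mul ℂ B) + TensorProduct.map₂ (LinearMap.mul ℂ A) π₂.br

lemma prodBr_tmul (π₁ : Bivector A) (π₂ : Bivector B) (a a' : A) (b b' : B) :
    prodBr π₁ π₂ (a ⊗ₜ b) (a' ⊗ₜ b')
      = π₁.br a a' ⊗ₜ (b * b') + (a * a') ⊗ₜ π₂.br b b' := by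
  simp [prodBr]

/-- The sum `π₁ + π₂` of two bivector fields, on the product of their affine schemes. -/
noncomputable def prod (π₁ : Bivector A) (π₂ : Bivector B) : Bivector (A ⊗[ℂ] B) where
  br := prodBr π₁ π₂
  skew x y := by
    induction x with
    | zero => simp
    | add x x' h h' => rw [map_add, map_add, LinearMap.add_apply, h, h', neg_add]
    | tmul a b =>
      induction y with
      | zero => simp
      | add y y' h h' => rw [map_add, map_add, LinearMap.add_apply, h, h', neg_add]
      | tmul a' b' =>
        rw [prodBr_tmul, prodBr_tmul, π₁.skew a a', π₂.skew b b', TensorProduct.neg_tmul,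
          TensorProduct.tmul_neg, mul_comm b, mul_comm a, neg_add]
  leibniz x y z := by
    induction x with
    | zero => simp
    | add x x' h h' =>
      rw [map_add, LinearMap.add_apply, LinearMap.add_apply, LinearMap.add_apply, h, h']; ring
    | tmul a b =>
      induction y with
      | zero => simp
      | add y y' h h' => rw [add_mul, map_add, map_add, h, h']; ring
      | tmul a' b' =>
        induction z with
        | zero => simp
        | add z z' h h' => rw [mul_add, map_add, map_add, h, h']; ring
        | tmul a'' b'' =>
          simp only [Algebra.TensorProduct.tmul_mul_tmul, prodBr_tmul, mul_add, π₁.leibniz,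
            π₂.leibniz, TensorProduct.add_tmul, TensorProduct.tmul_add]
          have e₁ : b' * (b * b'') = b * (b' * b'') := by ring
          have e₂ : b'' * (b * b') = b * (b' * b'') := by ring
          have e₃ : a' * (a * a'') = a * (a' * a'') := by ring
          have e₄ : a'' * (a * a') = a * (a' * a'') := by ring
          rw [e₁, e₂, e₃, e₄]
          abel

end Tensor

end Bivector

/-! ### Formal schemes attached to rings with ideals -/

/-- Functions on the completion, along the closed subscheme of `I`, of the closed subscheme of `K`
inside `Spec R`: the completion of `R ⧸ K` at the image of `I`. -/
abbrev FormalRing {R : Type u} [CommRing R] (K I : Ideal R) : Type u :=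
  AdicCompletion (I.map (Ideal.Quotient.mk K)) (R ⧸ K)

/-- The bivector field induced on `FormalRing K I` by one on `R` for which `K` is stable. -/
noncomputable abbrev Bivector.formal {R : Type u} [CommRing R] [Algebra ℂ R] (π : Bivector R)
    (K : Ideal R) (hK : ∀ a, ∀ h ∈ K, π.br a h ∈ K) (I : Ideal R) : Bivector (FormalRing K I) :=
  (π.quotient K hK).completion (I.map (Ideal.Quotient.mk K))

/-- The ideal of definition of the completion of `A` at `J`. -/
noncomputable abbrev idealOfDefinition {A : Type u} [CommRing A] (J : Ideal A) : Ideal (AdicCompletion J A) :=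
  J.map (algebraMap A (AdicCompletion J A))

section CompletedTensor

variable {O : Type u} [CommRing O] [Algebra ℂ O] {A : Type v} [CommRing A] [Algebra ℂ A]

/-- The ideal `𝔞 ⊗ 1 + 1 ⊗ 𝔪` of `O ⊗ A`. -/
noncomputable abbrev tensorIdeal (𝔞 : Ideal O) (𝔪 : Ideal A) : Ideal (O ⊗[ℂ] A) :=
  𝔞.map (Algebra.TensorProduct.includeLeft : O →ₐ[ℂ] O ⊗[ℂ] A) ⊔
    𝔪.map (Algebra.TensorProduct.includeRight : A →ₐ[ℂ] O ⊗[ℂ] A)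

/-- The completed tensor product of the adic rings `(O, 𝔞)` and `(A, 𝔪)`: the functions on the
completed product of the formal schemes `Spf O` and `Spf A`. -/
abbrev CompletedTensor (𝔞 : Ideal O) (𝔪 : Ideal A) : Type (max u v) :=
  AdicCompletion (tensorIdeal 𝔞 𝔪) (O ⊗[ℂ] A)

/-- Pullback of a function along the first projection of the completed product. -/
noncomputable def CompletedTensor.fst (𝔞 : Ideal O) (𝔪 : Ideal A) (a : O) :
    CompletedTensor 𝔞 𝔪 :=
  AdicCompletion.of (tensorIdeal 𝔞 𝔪) (O ⊗[ℂ] A) (a ⊗ₜ 1)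

/-- Pullback of a function along the second projection of the completed product. -/
noncomputable def CompletedTensor.snd (𝔞 : Ideal O) (𝔪 : Ideal A) (f : A) :
    CompletedTensor 𝔞 𝔪 :=
  AdicCompletion.of (tensorIdeal 𝔞 𝔪) (O ⊗[ℂ] A) (1 ⊗ₜ f)

/-- Functions of weight `d` on the completed product for the diagonal action, in terms of the
functions of given weight on the factors: modulo each power of the ideal of definition they are
linear combinations of products `a ⊗ f` with `a` of weight `i`, `f` of weight `j`, `i + j = d`. -/
def CompletedTensor.weight (𝔞 : Ideal O) (𝔪 : Ideal A) (W : ℤ → Set O) (W' : ℤ → Set A) (d : ℤ) :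
    Set (CompletedTensor 𝔞 𝔪) :=
  {x | ∀ n, ∃ y ∈ Submodule.span ℂ
      {z : O ⊗[ℂ] A | ∃ i j a f, i + j = d ∧ a ∈ W i ∧ f ∈ W' j ∧ z = a ⊗ₜ f},
    AdicCompletion.evalₐ (tensorIdeal 𝔞 𝔪) n x = Ideal.Quotient.mk _ y}

end CompletedTensor

/-- An algebra isomorphism between two adic completions is an isomorphism of formal schemes if it
is continuous in both directions. -/
def IsBicontinuous {A : Type u} [CommRing A] [Algebra ℂ A] {J : Ideal A}
    {B : Type v} [CommRing B] [Algebra ℂ B] {J' : Ideal B}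
    (Φ : AdicCompletion J A ≃ₐ[ℂ] AdicCompletion J' B) : Prop :=
  (∀ n, ∃ m, ∀ x, AdicCompletion.evalₐ J m x = 0 → AdicCompletion.evalₐ J' n (Φ x) = 0) ∧
  (∀ n, ∃ m, ∀ y, AdicCompletion.evalₐ J' m y = 0 → AdicCompletion.evalₐ J n (Φ.symm y) = 0)

/-- An algebra isomorphism carrying one bivector field to another one. -/
def IsPoissonIso {A : Type u} [CommRing A] [Algebra ℂ A] {B : Type v} [CommRing B] [Algebra ℂ B]
    (π : Bivector A) (π' : Bivector B) (Φ : A ≃ₐ[ℂ] B) : Prop :=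
  ∀ a b, Φ (π.br a b) = π'.br (Φ a) (Φ b)

/-! ### Formal Poisson schemes with one closed point -/

/-- A formal Poisson scheme `S = Spf A` with a single closed point: a complete Noetherian local
`ℂ`-algebra `A` with residue field `ℂ` and a Poisson bracket. -/
structure FormalPoissonGerm where
  carrier : Type u
  [commRing : CommRing carrier]
  [algebra : Algebra ℂ carrier]
  [isLocalRing : IsLocalRing carrier]
  [isNoetherianRing : IsNoetherianRing carrier]
  [isAdicComplete : IsAdicComplete (IsLocalRing.maximalIdeal carrier) carrier]
  residue_surjective :
    Function.Surjective (algebraMap ℂ (IsLocalRing.ResidueField carrier))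
  bivector : Bivector carrier
  isPoisson : bivector.IsPoisson

namespace FormalPoissonGerm

attribute [instance] commRing algebra isLocalRing isNoetherianRing isAdicComplete

variable (S : FormalPoissonGerm.{u})

/-- The ideal of the closed point. -/
abbrev maxIdeal : Ideal S.carrier := IsLocalRing.maximalIdeal S.carrier

/-- Every Poisson vector field, i.e. every derivation of the algebra which is also a derivation of
the bracket, is a Hamiltonian vector field `{f, -}`. -/
def PoissonFieldsHamiltonian : Prop :=
  ∀ D : Derivation ℂ S.carrier S.carrier,
    (∀ a b, D (S.bivector.br a b) = S.bivector.br (D a) b + S.bivector.br a (D b)) →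
    ∃ f, ∀ a, D a = S.bivector.br f a

/-- An action of the algebraic group `ℂˣ` on `S`, through pullback of functions. It is algebraic:
modulo every power of the maximal ideal, each function is a finite sum of weight vectors. -/
structure CxAction where
  toHom : ℂˣ →* (S.carrier ≃ₐ[ℂ] S.carrier)
  algebraic : ∀ (n : ℕ) (a : S.carrier), ∃ c : ℤ →₀ S.carrier,
    (∀ d s, toHom s (c d) - ((s ^ d : ℂˣ) : ℂ) • c d ∈ S.maxIdeal ^ n) ∧
    a - c.sum (fun _ x => x) ∈ S.maxIdeal ^ n

variable {S}

/-- The functions of weight `d`. -/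
def CxAction.weight (ρ : S.CxAction) (d : ℤ) : Set S.carrier :=
  {a | ∀ s : ℂˣ, ρ.toHom s a = ((s ^ d : ℂˣ) : ℂ) • a}

/-- The Poisson structure is homogeneous of degree `d`: brackets of functions of weights `i`, `j`
have weight `i + j + d`. -/
def CxAction.HomogeneousOfDegree (ρ : S.CxAction) (d : ℤ) : Prop :=
  ∀ (s : ℂˣ) (a b : S.carrier), ρ.toHom s (S.bivector.br a b)
    = ((s ^ d : ℂˣ) : ℂ) • S.bivector.br (ρ.toHom s a) (ρ.toHom s b)

variable (S) in
/-- The trivial action. -/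
def trivialAction : S.CxAction where
  toHom := 1
  algebraic n a := by
    refine ⟨Finsupp.single 0 a, fun d s => ?_, by simp⟩
    by_cases h : d = 0
    · subst h; simp
    · simp [Finsupp.single_eq_of_ne h]

end FormalPoissonGerm

/-! ### Decompositions -/

section Decomposition

variable {A : Type u} [CommRing A] [Algebra ℂ A] {J : Ideal A}

open LaurentPolynomial

/-- The algebra `ℂ[t, t⁻¹]⟦u, z_1, …, z_{2m}⟧` of functions on the completed product of `ℂˣ` with
the formal polydisc of dimension `2m + 1`. The variable `none` is `u`, `some (inl i)` is
`z_{2i+1}` and `some (inr i)` is `z_{2i+2}`, for `i = 0, …, m - 1`. -/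
abbrev StandardRing (m : ℕ) : Type := MvPowerSeries (Option (Fin m ⊕ Fin m)) ℂ[T;T⁻¹]

namespace StandardRing

variable (m : ℕ)

/-- The function `t ^ j`. -/
noncomputable def tpow (j : ℤ) : StandardRing m := MvPowerSeries.C (T j)

/-- The coordinate `u`. -/
noncomputable def u : StandardRing m := MvPowerSeries.X none

variable {m}

/-- The coordinates `z_{2i+1}`. -/
noncomputable def zodd (i : Fin m) : StandardRing m := MvPowerSeries.X (some (Sum.inl i))

/-- The coordinates `z_{2i+2}`. -/
noncomputable def zeven (i : Fin m) : StandardRing m := MvPowerSeries.X (some (Sum.inr i))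

/-- The rescaled coordinates `z'_{2i+1} = t ^ k z_{2i+1}`. -/
noncomputable def zodd' (k : ℤ) (i : Fin m) : StandardRing m := tpow m k * zodd i

end StandardRing

open StandardRing

/-- Standard coordinates `t, u, z_1, …, z_{2m}` on a formal `ℂˣ`-scheme with functions
`AdicCompletion J A`, functions of weight `d` forming the set `W d`, and bivector field `π`:
`t` has weight one, `u` and `z_i` have weight zero, and in the coordinates `t, u, z'_i, z_i`
`π = t^{1-k} ∂_u ∧ ∂_t + ∑ ∂_{z'_{2i+1}} ∧ ∂_{z_{2i+2}}`. -/
structure StandardCoordinates (π : Bivector (AdicCompletion J A))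
    (W : ℤ → Set (AdicCompletion J A)) (m : ℕ) (k : ℤ) where
  equiv : StandardRing m ≃ₐ[ℂ] AdicCompletion J A
  /-- The ideal of definition `(u, z_1, …, z_{2m})` corresponds to that of the completion. -/
  ideal_iff : ∀ f, MvPowerSeries.constantCoeff f = 0 ↔ AdicCompletion.evalₐ J 1 (equiv f) = 0
  weight_t : equiv (tpow m 1) ∈ W 1
  weight_u : equiv (u m) ∈ W 0
  weight_zodd : ∀ i, equiv (zodd i) ∈ W 0
  weight_zeven : ∀ i, equiv (zeven i) ∈ W 0
  br_u_t : π.br (equiv (u m)) (equiv (tpow m 1)) = equiv (tpow m (1 - k))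
  br_u_zodd : ∀ i, π.br (equiv (u m)) (equiv (zodd' k i)) = 0
  br_u_zeven : ∀ i, π.br (equiv (u m)) (equiv (zeven i)) = 0
  br_t_zodd : ∀ i, π.br (equiv (tpow m 1)) (equiv (zodd' k i)) = 0
  br_t_zeven : ∀ i, π.br (equiv (tpow m 1)) (equiv (zeven i)) = 0
  br_zodd_zodd : ∀ i j, π.br (equiv (zodd' k i)) (equiv (zodd' k j)) = 0
  br_zeven_zeven : ∀ i j, π.br (equiv (zeven i)) (equiv (zeven j)) = 0
  br_zodd_zeven : ∀ i j, π.br (equiv (zodd' k i)) (equiv (zeven j)) = if i = j then 1 else 0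

variable {AX : Type u} [CommRing AX] [Algebra ℂ AX] {JX : Ideal AX}
  {AY : Type u} [CommRing AY] [Algebra ℂ AY] {JY : Ideal AY}

/-- An equivariant decomposition of a formal `ℂˣ`-Poisson scheme `X̂` (functions
`AdicCompletion JX AX`, bivector field `πX`, weights `WX`) as the completed product of `Ŷ`
(functions `AdicCompletion JY AY`) and a slice `S` with trivial `ℂˣ`-action: an equivariant
isomorphism of formal schemes, not Poisson in general, taking `πX` to
`π_Y + t^{-k} ∂_u ∧ ξ + t^{-k} π_S` for standard coordinates on `Ŷ` and a vector field `ξ` on `S`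
with `[ξ, π_S] = k π_S`. -/
structure EquivariantDecomposition (πX : Bivector (AdicCompletion JX AX))
    (WX : ℤ → Set (AdicCompletion JX AX)) (πY : Bivector (AdicCompletion JY AY))
    (WY : ℤ → Set (AdicCompletion JY AY)) (k : ℤ) (S : FormalPoissonGerm.{v}) where
  m : ℕ
  coords : StandardCoordinates πY WY m k
  iso : AdicCompletion JX AX ≃ₐ[ℂ] CompletedTensor (idealOfDefinition JY) S.maxIdeal
  bicontinuous : IsBicontinuous iso
  equivariant : ∀ d x, x ∈ WX d ↔
    iso x ∈ CompletedTensor.weight (idealOfDefinition JY) S.maxIdeal WY S.trivialAction.weight d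
  ξ : Derivation ℂ S.carrier S.carrier
  ξ_bivector : ∀ f g, ξ (S.bivector.br f g) - S.bivector.br (ξ f) g - S.bivector.br f (ξ g)
    = (k : ℂ) • S.bivector.br f g
  /-- `{a, b} = {a, b}_Y` for functions `a, b` on `Ŷ`. -/
  br_fst_fst : ∀ a b, iso (πX.br
      (iso.symm (CompletedTensor.fst _ _ a)) (iso.symm (CompletedTensor.fst _ _ b)))
    = CompletedTensor.fst _ _ (πY.br a b)
  /-- `{u, f} = t^{-k} ξ(f)` for functions `f` on `S`. -/
  br_u_snd : ∀ f, iso (πX.br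
      (iso.symm (CompletedTensor.fst _ _ (coords.equiv (u m))))
      (iso.symm (CompletedTensor.snd _ _ f)))
    = CompletedTensor.fst _ _ (coords.equiv (tpow m (-k))) * CompletedTensor.snd _ _ (ξ f)
  br_t_snd : ∀ f, πX.br
      (iso.symm (CompletedTensor.fst _ _ (coords.equiv (tpow m 1))))
      (iso.symm (CompletedTensor.snd _ _ f)) = 0
  br_zodd_snd : ∀ i f, πX.br
      (iso.symm (CompletedTensor.fst _ _ (coords.equiv (zodd' k i))))
      (iso.symm (CompletedTensor.snd _ _ f)) = 0
  br_zeven_snd : ∀ i f, πX.br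
      (iso.symm (CompletedTensor.fst _ _ (coords.equiv (zeven i))))
      (iso.symm (CompletedTensor.snd _ _ f)) = 0
  /-- `{f, g} = t^{-k} {f, g}_S` for functions `f, g` on `S`. -/
  br_snd_snd : ∀ f g, iso (πX.br
      (iso.symm (CompletedTensor.snd _ _ f)) (iso.symm (CompletedTensor.snd _ _ g)))
    = CompletedTensor.fst _ _ (coords.equiv (tpow m (-k)))
      * CompletedTensor.snd _ _ (S.bivector.br f g)

end Decomposition

/-! ### Complex varieties with an action of `ℂˣ` -/

/-- A complex variety: a reduced separated scheme of finite type over `ℂ`. -/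
structure ComplexVariety where
  toScheme : Scheme.{0}
  str : toScheme ⟶ Spec (.of ℂ)
  [isReduced : IsReduced toScheme]
  [isSeparated : IsSeparated str]
  [locallyOfFiniteType : LocallyOfFiniteType str]
  [quasiCompact : QuasiCompact str]

attribute [instance] ComplexVariety.isReduced ComplexVariety.isSeparated
  ComplexVariety.locallyOfFiniteType ComplexVariety.quasiCompact

namespace ComplexVariety

variable (X : ComplexVariety)

noncomputable instance (U : X.toScheme.Opens) : Algebra ℂ Γ(X.toScheme, U) :=
  ((X.str.appLE ⊤ U le_top).hom.comp (Scheme.ΓSpecIso (.of ℂ)).inv.hom).toAlgebra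

/-- A complex point. -/
structure Point where
  hom : Spec (.of ℂ) ⟶ X.toScheme
  hom_str : hom ≫ X.str = 𝟙 _

variable {X}

/-- The singleton of a complex point, as a set of points of the scheme. -/
def Point.support (y : X.Point) : Set X.toScheme := Set.range y.hom

/-- The ideal of functions on an affine open `U` vanishing on `Z ∩ U`. -/
noncomputable def vanishingIdeal {U : X.toScheme.Opens} (hU : IsAffineOpen U)
    (Z : Set X.toScheme) : Ideal Γ(X.toScheme, U) :=
  PrimeSpectrum.vanishingIdeal (hU.fromSpec ⁻¹' Z)

end ComplexVariety

/-- The constant function `s` on a scheme over `ℂ`. -/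
noncomputable def constUnit {T : Scheme.{0}} (q : T ⟶ Spec (.of ℂ)) (s : ℂˣ) : Γ(T, ⊤)ˣ :=
  Units.map (q.appTop.hom.comp (Scheme.ΓSpecIso (.of ℂ)).inv.hom : ℂ →+* Γ(T, ⊤)) s

/-- The multiplicative group `ℂˣ`, as a scheme. -/
noncomputable abbrev cxScheme : Scheme.{0} := Spec (.of (LaurentPolynomial ℂ))

/-- The structure morphism of `ℂˣ`. -/
noncomputable def cxStr : cxScheme ⟶ Spec (.of ℂ) :=
  Spec.map (CommRingCat.ofHom (algebraMap ℂ (LaurentPolynomial ℂ)))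

/-- The variable of the ring of Laurent polynomials, as a unit. -/
noncomputable def laurentUnit : (LaurentPolynomial ℂ)ˣ where
  val := LaurentPolynomial.T 1
  inv := LaurentPolynomial.T (-1)
  val_inv := by rw [← LaurentPolynomial.T_add, add_neg_cancel, LaurentPolynomial.T_zero]
  inv_val := by rw [← LaurentPolynomial.T_add, neg_add_cancel, LaurentPolynomial.T_zero]

/-- The coordinate function on `ℂˣ`. -/
noncomputable def cxCoord : Γ(cxScheme, ⊤)ˣ :=
  Units.map ((Scheme.ΓSpecIso (.of (LaurentPolynomial ℂ))).inv.hom :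
    LaurentPolynomial ℂ →+* Γ(cxScheme, ⊤)) laurentUnit

/-- An action of the algebraic group `ℂˣ` on a complex variety, given on points with values in
arbitrary `ℂ`-schemes `T` (the `T`-points of `ℂˣ` being the invertible functions on `T`). -/
structure GmAction (X : ComplexVariety) where
  act : ∀ {T : Scheme.{0}}, Γ(T, ⊤)ˣ → (T ⟶ X.toScheme) → (T ⟶ X.toScheme)
  act_str : ∀ {T : Scheme.{0}} (g : Γ(T, ⊤)ˣ) (x : T ⟶ X.toScheme), act g x ≫ X.str = x ≫ X.str
  comp_act : ∀ {T T' : Scheme.{0}} (h : T' ⟶ T) (g : Γ(T, ⊤)ˣ) (x : T ⟶ X.toScheme),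
    h ≫ act g x = act (Units.map (h.appTop.hom : Γ(T, ⊤) →+* Γ(T', ⊤)) g) (h ≫ x)
  one_act : ∀ {T : Scheme.{0}} (x : T ⟶ X.toScheme), act 1 x = x
  mul_act : ∀ {T : Scheme.{0}} (g g' : Γ(T, ⊤)ˣ) (x : T ⟶ X.toScheme),
    act (g * g') x = act g (act g' x)

namespace GmAction

variable {X : ComplexVariety} (α : GmAction X)

/-- The action of `s ∈ ℂˣ` on `X`. -/
noncomputable def translate (s : ℂˣ) : X.toScheme ⟶ X.toScheme := α.act (constUnit X.str s) (𝟙 _)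

/-- A subset stable under the action. -/
def IsStable (Y : Set X.toScheme) : Prop := ∀ s, ∀ x ∈ Y, α.translate s x ∈ Y

/-- The stabilizer of the complex point `y` is trivial. -/
def TrivialStabilizer (y : X.Point) : Prop :=
  ∀ s : ℂˣ, α.act (constUnit (𝟙 _) s) y.hom = y.hom → s = 1

/-- The orbit `ℂˣ · y`: the image of the orbit map `ℂˣ ⟶ X`, `t ↦ t · y`. -/
noncomputable def orbit (y : X.Point) : Set X.toScheme :=
  Set.range (α.act cxCoord (cxStr ≫ y.hom))

/-- The `n`-th truncation of the completion, along the subscheme of `I`, of the closed subscheme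
of `K` in an affine open `U`, as a scheme over `X`. -/
noncomputable def truncation {U : X.toScheme.Opens} (hU : IsAffineOpen U)
    (K I : Ideal Γ(X.toScheme, U)) (n : ℕ) :
    Spec (.of ((Γ(X.toScheme, U) ⧸ K) ⧸ (I.map (Ideal.Quotient.mk K)) ^ n)) ⟶ X.toScheme :=
  Spec.map (CommRingCat.ofHom ((Ideal.Quotient.mk ((I.map (Ideal.Quotient.mk K)) ^ n)).comp
    (Ideal.Quotient.mk K))) ≫ hU.fromSpec

/-- The functions of weight `d` on the completion along `I` of the subscheme of `K`, where `I` and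
`K` cut out `ℂˣ`-stable subsets. Here `f` has weight `d` if `f(s · x) = s ^ d f(x)` for all `s`;
this is tested on the truncations `Z_n` of the completion: if `r` is a function on `U` restricting
to the class `f_n` of `f` on `Z_n`, then the pullback of `r` under `Z_n ⟶ X`, `x ↦ s · x`, is
`s ^ d f_n`. (This morphism lands in `U`, so its domain of definition below is all of `Z_n`.) -/
def weight {U : X.toScheme.Opens} (hU : IsAffineOpen U) (K I : Ideal Γ(X.toScheme, U)) (d : ℤ) :
    Set (FormalRing K I) :=
  {f | ∀ (n : ℕ) (s : ℂˣ) (r : Γ(X.toScheme, U)),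
    Ideal.Quotient.mk _ (Ideal.Quotient.mk K r) = AdicCompletion.evalₐ _ n f →
    (α.act (constUnit (truncation hU K I n ≫ X.str) s) (truncation hU K I n)).app U r =
      (Spec (.of _)).presheaf.map (homOfLE le_top).op
        ((Scheme.ΓSpecIso (.of _)).inv (((s ^ d : ℂˣ) : ℂ) • AdicCompletion.evalₐ _ n f))}

end GmAction

/-! ### Poisson varieties and symplectic leaves -/

/-- A Poisson structure on a complex variety: compatible Poisson brackets on all algebras of
sections. -/
structure PoissonStructure (X : ComplexVariety) where
  bivector : ∀ U : X.toScheme.Opens, Bivector Γ(X.toScheme, U)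
  restrict : ∀ (U V : X.toScheme.Opens) (h : V ≤ U) (a b : Γ(X.toScheme, U)),
    X.toScheme.presheaf.map (homOfLE h).op ((bivector U).br a b) =
      (bivector V).br (X.toScheme.presheaf.map (homOfLE h).op a)
        (X.toScheme.presheaf.map (homOfLE h).op b)
  isPoisson : ∀ U, (bivector U).IsPoisson

namespace PoissonStructure

variable {X : ComplexVariety} (π : PoissonStructure X)

/-- The Poisson structure is homogeneous of degree `d`: the bracket of functions of weights
`i`, `j` has weight `i + j + d`. -/
def HomogeneousOfDegree (α : GmAction X) (d : ℤ) : Prop :=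
  ∀ (s : ℂˣ) (U : X.toScheme.Opens) (a b : Γ(X.toScheme, U)),
    (α.translate s).app U ((π.bivector U).br a b) = ((s ^ d : ℂˣ) : ℂ) •
      (π.bivector (α.translate s ⁻¹ᵁ U)).br ((α.translate s).app U a) ((α.translate s).app U b)

/-- The point of `X` given by a complex point of an affine open. -/
noncomputable def affinePoint {V : X.toScheme.Opens} (hV : IsAffineOpen V)
    (χ : Γ(X.toScheme, V) →ₐ[ℂ] ℂ) : X.toScheme :=
  hV.fromSpec (⟨RingHom.ker (χ : Γ(X.toScheme, V) →+* ℂ), RingHom.ker_isPrime _⟩ : PrimeSpectrum Γ(X.toScheme, V))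

/-- A symplectic leaf: a locally closed subvariety `Y` such that, at each complex point `χ` of
`Y`, the tangent space of `Y` (the derivations at `χ` killing the functions vanishing on `Y`) is
the space of values `{f, -}(χ)` of Hamiltonian vector fields. -/
def IsSymplecticLeaf (Y : Set X.toScheme) : Prop :=
  IsLocallyClosed Y ∧
  ∀ (V : X.toScheme.Opens) (hV : IsAffineOpen V) (χ : Γ(X.toScheme, V) →ₐ[ℂ] ℂ),
    affinePoint hV χ ∈ Y → ∀ D : Γ(X.toScheme, V) →ₗ[ℂ] ℂ,
      ((∀ a b, D (a * b) = χ a * D b + χ b * D a) ∧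
        ∀ h ∈ ComplexVariety.vanishingIdeal hV Y, D h = 0) ↔
      ∃ f, ∀ a, D a = χ ((π.bivector V).br f a)

lemma finiteType_sections (X : ComplexVariety) {U : X.toScheme.Opens} (hU : IsAffineOpen U) :
    Algebra.FiniteType ℂ Γ(X.toScheme, U) := by
  have h : (X.str.appLE ⊤ U le_top).hom.FiniteType :=
    LocallyOfFiniteType.finiteType_appLE X.str (isAffineOpen_top _) hU le_top
  have h' : (Scheme.ΓSpecIso (.of ℂ)).inv.hom.FiniteType :=
    RingHom.FiniteType.of_surjective _
      (ConcreteCategory.bijective_of_isIso (Scheme.ΓSpecIso (.of ℂ)).inv).2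
  exact h.comp h'

/-- The ideal of a symplectic leaf is stable under brackets, so leaves are Poisson. -/
lemma IsSymplecticLeaf.br_mem {π : PoissonStructure X} {Y : Set X.toScheme}
    (hY : π.IsSymplecticLeaf Y) {U : X.toScheme.Opens} (hU : IsAffineOpen U)
    (a h : Γ(X.toScheme, U)) (hh : h ∈ ComplexVariety.vanishingIdeal hU Y) :
    (π.bivector U).br a h ∈ ComplexVariety.vanishingIdeal hU Y := by
  have : Algebra.FiniteType ℂ Γ(X.toScheme, U) := finiteType_sections X hU
  have : IsJacobsonRing Γ(X.toScheme, U) := isJacobsonRing_of_finiteType (A := ℂ)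
  set g := (π.bivector U).br a h with hg
  rw [ComplexVariety.vanishingIdeal, PrimeSpectrum.mem_vanishingIdeal]
  intro x hx
  by_contra hgx
  have hlc : IsLocallyClosed ((hU.fromSpec ⁻¹' Y : Set (PrimeSpectrum Γ(X.toScheme, U))) ∩
      PrimeSpectrum.basicOpen g) :=
    (hY.1.preimage hU.fromSpec.continuous).inter (PrimeSpectrum.basicOpen g).2.isLocallyClosed
  obtain ⟨z, ⟨hzY, hzg⟩, hz⟩ := nonempty_inter_closedPoints
    (Set.nonempty_of_mem (x := x) (by exact ⟨hx, hgx⟩)) hlc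
  have hmax : z.asIdeal.IsMaximal := (PrimeSpectrum.isClosed_singleton_iff_isMaximal z).1 hz
  let L := Γ(X.toScheme, U) ⧸ z.asIdeal
  let : Field L := Ideal.Quotient.field z.asIdeal
  have : Algebra.FiniteType ℂ L := inferInstance
  have : Module.Finite ℂ L := finite_of_finite_type_of_isJacobsonRing ℂ L
  have hbij : Function.Bijective (algebraMap ℂ L) :=
    IsAlgClosed.algebraMap_bijective_of_isIntegral
  let χ : Γ(X.toScheme, U) →ₐ[ℂ] ℂ :=
    ((AlgEquiv.ofBijective (Algebra.ofId ℂ L) hbij).symm : L →ₐ[ℂ] ℂ).comp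
      (Ideal.Quotient.mkₐ ℂ z.asIdeal)
  have hχ (b) : χ b = 0 ↔ b ∈ z.asIdeal := by
    simp [χ, L, Ideal.Quotient.eq_zero_iff_mem]
  have hpt : affinePoint hU χ = hU.fromSpec z := by
    unfold affinePoint
    congr 1
    exact PrimeSpectrum.ext (Ideal.ext hχ)
  have hD := (hY.2 U hU χ (by rw [hpt]; exact hzY)
    (χ.toLinearMap ∘ₗ (π.bivector U).br a)).2 ⟨a, fun _ => rfl⟩
  exact hzg ((hχ g).1 (hD.2 h hh))

/-- The ideal of `X` itself is stable under brackets. -/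
lemma br_mem_bot {U : X.toScheme.Opens} (a h : Γ(X.toScheme, U))
    (hh : h ∈ (⊥ : Ideal Γ(X.toScheme, U))) :
    (π.bivector U).br a h ∈ (⊥ : Ideal Γ(X.toScheme, U)) := by
  rw [Ideal.mem_bot] at *
  rw [hh, map_zero]

end PoissonStructure

/-! ### Completions of a Poisson variety and of a leaf along a closed subset of an affine open -/

section FormalNeighbourhoods

open ComplexVariety

variable {X : ComplexVariety} {U : X.toScheme.Opens} (hU : IsAffineOpen U)

/-- Functions on the completion `X̂_Z` of `X` along `Z`, a closed subset of the affine open `U`. -/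
abbrev FormalNbhd (Z : Set X.toScheme) : Type := FormalRing ⊥ (vanishingIdeal hU Z)

/-- Functions on the completion `Ŷ_Z` of the reduced subvariety `Y` along `Z ⊆ Y`, a closed subset
of the affine open `U`. -/
abbrev FormalNbhdIn (Y Z : Set X.toScheme) : Type :=
  FormalRing (vanishingIdeal hU Y) (vanishingIdeal hU Z)

/-- The ideal of definition of `Ŷ_Z`. -/
noncomputable abbrev nbhdIdeal (Y Z : Set X.toScheme) : Ideal (FormalNbhdIn hU Y Z) :=
  idealOfDefinition ((vanishingIdeal hU Z).map (Ideal.Quotient.mk (vanishingIdeal hU Y)))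

/-- Functions on the completed product of `Ŷ_Z` and `S`. -/
abbrev FormalProduct (Y Z : Set X.toScheme) (S : FormalPoissonGerm.{u}) : Type u :=
  CompletedTensor (nbhdIdeal hU Y Z) S.maxIdeal

/-- The bivector field of `X̂_Z`. -/
noncomputable abbrev PoissonStructure.hat (π : PoissonStructure X) (Z : Set X.toScheme) :
    Bivector (FormalNbhd hU Z) :=
  (π.bivector U).formal ⊥ π.br_mem_bot (vanishingIdeal hU Z)

/-- The bivector field of `Ŷ_Z`, for a symplectic leaf `Y`. -/
noncomputable abbrev PoissonStructure.IsSymplecticLeaf.hat {π : PoissonStructure X}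
    {Y : Set X.toScheme} (hY : π.IsSymplecticLeaf Y) (Z : Set X.toScheme) :
    Bivector (FormalNbhdIn hU Y Z) :=
  (π.bivector U).formal (vanishingIdeal hU Y) (hY.br_mem hU) (vanishingIdeal hU Z)

/-- The bivector field `π_Y + π_S` of the completed product of `Ŷ_Z` and `S`. -/
noncomputable abbrev PoissonStructure.IsSymplecticLeaf.hatProd {π : PoissonStructure X}
    {Y : Set X.toScheme} (hY : π.IsSymplecticLeaf Y) (Z : Set X.toScheme)
    (S : FormalPoissonGerm.{u}) : Bivector (FormalProduct hU Y Z S) :=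
  ((hY.hat hU Z).prod S.bivector).completion (tensorIdeal (nbhdIdeal hU Y Z) S.maxIdeal)

/-- The functions of weight `d` on `X̂_Z`, for `ℂˣ`-stable `Z`. -/
abbrev GmAction.hatWeight (α : GmAction X) (Z : Set X.toScheme) (d : ℤ) :
    Set (FormalNbhd hU Z) :=
  α.weight hU ⊥ (vanishingIdeal hU Z) d

/-- The functions of weight `d` on `Ŷ_Z`, for `ℂˣ`-stable `Y` and `Z`. -/
abbrev GmAction.hatWeightIn (α : GmAction X) (Y Z : Set X.toScheme) (d : ℤ) :
    Set (FormalNbhdIn hU Y Z) :=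
  α.weight hU (vanishingIdeal hU Y) (vanishingIdeal hU Z) d

end FormalNeighbourhoods

/-! ### Adic topology: limits, density and continuity with loss of order -/

section AdicBasics

variable {R : Type*} [CommRing R] {J : Ideal R}

/-! Both statements use one device. For a derivation `D` and an element `h` of an ideal of
definition, the series `∑ h ^ k D ^ k f / k!` converges and defines an algebra endomorphism
(`taylor`), the flow of `D` for the variable time `h`.

Equivariant statement. The Euler field `eu` of the action on `S` rescales the bracket by `-k` and
`ξ` rescales it by `k`, so `eu + ξ` is a Poisson field. By hypothesis it equals `{h, -}`, and `h`
may be taken in the maximal ideal (`exists_hamiltonian`). Let `Θ` be the substitution `u ↦ u - h` on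
`Ŷ`, with the other coordinates fixed, and `f ↦ t ^ d f` for `f` of weight `d` on `S`. In the
bracket of `X̂`, `{u - h, t ^ d f} = t ^ (d - k) (d f + ξ f - {h, f}) = 0`, and `{t ^ i f, t ^ j g}
= t ^ (i + j - k) {f, g}`. The latter is `Θ` of the bracket on `S`, since `{f, g}` has weight `i + j
- k`. So `Θ` carries `π_Y + π_S` to the bivector of `X̂` (`straightening_br`), and the factor `t ^
d` converts the diagonal action into the one which is trivial on `S` (`straightening_mem_weight`,
`twist_mem_weight`). The required isomorphism is the given decomposition followed by `Θ⁻¹`. Two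
points need care. The action on `S` is algebraic only modulo powers of the maximal ideal, so maps
prescribed on weight vectors are built as limits (`exists_weightMap`). And weights on `Ŷ`, defined
through the action on truncations, must be recognized as limits of `t ^ d` times polynomials in `u`
and `z_i` (`GmAction.weightsAreStandard`).

Uniqueness of the slice. Let `P` be the functions on the formal neighbourhood of `y`, a complete
local Poisson algebra. The Poisson decomposition just found, restricted to `y`, and an arbitrary one
at `y` each give `m + 1` conjugate pairs in `P` and a Poisson subalgebra commuting with them, namely
`S` and `S'` (`exists_isSlice`, `exists_isSlice_of_pointwise`). Dirac reduction by a pair removes it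
and leaves the slice unchanged. Up to Poisson isomorphism the reduction does not depend on the pair
(`exists_diracReduction_equiv`): for fixed `p` it is the commutant of `p` modulo `p`, whatever `q`
is; `p` and `q` may be exchanged; and any two pairs are linked through an `x` whose brackets with
`p` and `p'` are both units. Induction on the number of pairs ends with both `S` and `S'` identified
with the same algebra (`IsSlice.exists_poissonIso`). -/

lemma eq_zero_of_forall_mem_pow [IsHausdorff J R] {x : R} (h : ∀ n, x ∈ J ^ n) : x = 0 :=
  IsHausdorff.haus ‹_› x fun n => by
    rw [SModEq.zero]; simpa using h n

lemma eq_of_forall_sub_mem_pow [IsHausdorff J R] {x y : R} (h : ∀ n, x - y ∈ J ^ n) : x = y :=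
  sub_eq_zero.1 (eq_zero_of_forall_mem_pow h)

lemma isHausdorff_of_forall_mem_pow (h : ∀ x, (∀ n, x ∈ J ^ n) → x = 0) : IsHausdorff J R where
  haus' x hx := h x fun n => by simpa [SModEq.zero] using hx n

lemma sub_mem_pow_of_le {f : ℕ → R} (h : ∀ n, f (n + 1) - f n ∈ J ^ n) {m n : ℕ} (hmn : m ≤ n) :
    f n - f m ∈ J ^ m := by
  induction n, hmn using Nat.le_induction with
  | base => simp
  | succ n hmn ih =>
    have := (J ^ m).add_mem (Ideal.pow_le_pow_right hmn (h n)) ih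
    rwa [sub_add_sub_cancel] at this

lemma exists_adic_limit [IsPrecomplete J R] (f : ℕ → R) (h : ∀ n, f (n + 1) - f n ∈ J ^ n) :
    ∃ L, ∀ n, L - f n ∈ J ^ n := by
  obtain ⟨L, hL⟩ := IsPrecomplete.prec (I := J) (M := R) ‹_› (f := f) (fun {m n} hmn => by
    rw [SModEq.sub_mem]
    have := (J ^ m).neg_mem (sub_mem_pow_of_le h hmn)
    simpa using this)
  refine ⟨L, fun n => ?_⟩
  have := hL n
  rw [SModEq.sub_mem] at this
  have := (J ^ n).neg_mem (show f n - L ∈ J ^ n by simpa using this)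
  simpa using this

lemma isPrecomplete_of_exists_limit
    (h : ∀ f : ℕ → R, (∀ n, f (n + 1) - f n ∈ J ^ n) → ∃ L, ∀ n, L - f n ∈ J ^ n) :
    IsPrecomplete J R where
  prec' f hf := by
    obtain ⟨L, hL⟩ := h f fun n => by
      have := hf (Nat.le_succ n)
      rw [SModEq.sub_mem] at this
      have := (J ^ n).neg_mem (show f n - f (n + 1) ∈ J ^ n by simpa using this)
      simpa using this
    refine ⟨L, fun n => ?_⟩
    rw [SModEq.sub_mem]
    have := (J ^ n).neg_mem (hL n)
    simpa using this

/-- Every element is approximated by elements of `s` in the `J`-adic topology. -/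
def AdicDense (J : Ideal R) (s : Set R) : Prop := ∀ x n, ∃ y ∈ s, x - y ∈ J ^ n

lemma isUnit_one_add_of_mem [IsAdicComplete J R] {x : R} (hx : x ∈ J) : IsUnit (1 + x) := by
  have := (Ideal.mem_jacobson_bot.1 (IsAdicComplete.le_jacobson_bot J hx)) 1
  rwa [mul_one, add_comm] at this

end AdicBasics

section Maps

variable {R : Type*} [CommRing R] {J : Ideal R} {R' : Type*} [CommRing R'] {K : Ideal R'}

lemma map_mem_pow {F : Type*} [FunLike F R R'] [RingHomClass F R R'] (f : F)
    (hf : ∀ x ∈ J, f x ∈ K) {n : ℕ} {x : R} (hx : x ∈ J ^ n) : f x ∈ K ^ n := by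
  have h : J.map f ≤ K := Ideal.map_le_iff_le_comap.2 hf
  exact Ideal.pow_right_mono h n (by rw [← Ideal.map_pow]; exact Ideal.mem_map_of_mem f hx)

/-- Additive maps which agree on a dense subset and shift the filtrations by a bounded amount are
equal. -/
lemma eq_of_adicDense [IsHausdorff K R'] {F : Type*} [FunLike F R R'] [AddMonoidHomClass F R R']
    (f g : F) {s : Set R} (hs : AdicDense J s) (c : ℕ)
    (hf : ∀ n, ∀ x ∈ J ^ (n + c), f x ∈ K ^ n) (hg : ∀ n, ∀ x ∈ J ^ (n + c), g x ∈ K ^ n)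
    (h : ∀ x ∈ s, f x = g x) (x : R) : f x = g x := by
  refine eq_of_forall_sub_mem_pow (J := K) fun n => ?_
  obtain ⟨y, hy, hxy⟩ := hs x (n + c)
  have := (K ^ n).sub_mem (hf n _ hxy) (hg n _ hxy)
  rwa [map_sub, map_sub, h y hy, sub_sub_sub_cancel_right] at this

end Maps

section ApproxHom

variable {A : Type*} [CommRing A] [Algebra ℂ A] {R : Type*} [CommRing R] [Algebra ℂ R]
  {K : Ideal R}

/-- A coherent sequence of maps which are algebra homomorphisms to increasing precision converges
to an algebra homomorphism. -/
theorem exists_algHom_of_approx [IsAdicComplete K R] (F : ℕ → A → R)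
    (hF : ∀ n x, F (n + 1) x - F n x ∈ K ^ n)
    (hadd : ∀ n x y, F n (x + y) - (F n x + F n y) ∈ K ^ n)
    (hmul : ∀ n x y, F n (x * y) - F n x * F n y ∈ K ^ n)
    (hc : ∀ n c, F n (algebraMap ℂ A c) - algebraMap ℂ R c ∈ K ^ n) :
    ∃ φ : A →ₐ[ℂ] R, ∀ n x, φ x - F n x ∈ K ^ n := by
  choose L hL using fun x => exists_adic_limit (J := K) (fun n => F n x) (fun n => hF n x)
  have key : ∀ {x y : R}, (∀ n, x - y ∈ K ^ n) → x = y := fun h => eq_of_forall_sub_mem_pow h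
  have hLc (c) : L (algebraMap ℂ A c) = algebraMap ℂ R c := key fun n => by
    have := (K ^ n).add_mem (hL (algebraMap ℂ A c) n) (hc n c)
    rwa [sub_add_sub_cancel] at this
  refine ⟨{ toFun := L
            map_one' := by simpa using hLc 1
            map_zero' := by simpa using hLc 0
            map_add' := fun x y => key fun n => ?_
            map_mul' := fun x y => key fun n => ?_
            commutes' := hLc }, fun n x => hL x n⟩
  · have := (K ^ n).sub_mem ((K ^ n).add_mem (hL (x * y) n) (hmul n x y))
      ((K ^ n).add_mem (Ideal.mul_mem_left _ (L x) (hL y n))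
        (Ideal.mul_mem_left _ (F n y) (hL x n)))
    convert this using 1; ring
  · have := (K ^ n).sub_mem ((K ^ n).add_mem (hL (x + y) n) (hadd n x y))
      ((K ^ n).add_mem (hL x n) (hL y n))
    convert this using 1; ring

end ApproxHom

/-! ### The completion and its universal property -/

section CompletionBasics

variable {A : Type u} [CommRing A] {J : Ideal A}

/-- Finite generation of `J` keeps the kernel of the truncation from being larger than the power of
the extended ideal. It lets statements about truncations be read as membership in powers of an ideal
of the completion. -/
lemma evalₐ_eq_zero_iff (hJ : J.FG) (n : ℕ) (x : AdicCompletion J A) :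
    AdicCompletion.evalₐ J n x = 0 ↔ x ∈ idealOfDefinition J ^ n := by
  have h1 : x ∈ idealOfDefinition J ^ n ↔ x ∈ (J ^ n • ⊤ : Submodule A (AdicCompletion J A)) := by
    rw [Ideal.smul_top_eq_map, ← Ideal.map_pow]; rfl
  have h2 : (J ^ n • ⊤ : Ideal A) = J ^ n := by simp
  rw [h1, AdicCompletion.pow_smul_top_eq_ker_eval hJ, LinearMap.mem_ker,
    ← AdicCompletion.factor_evalₐ_eq_eval J x h2.ge]
  constructor
  · intro h; rw [h, map_zero]
  · intro h
    rw [← AdicCompletion.factor_eval_eq_evalₐ J x h2.le,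
      ← AdicCompletion.factor_evalₐ_eq_eval J x h2.ge, h, map_zero]

lemma isAdicComplete_idealOfDefinition (hJ : J.FG) :
    IsAdicComplete (idealOfDefinition J) (AdicCompletion J A) :=
  (IsAdicComplete.map_algebraMap_iff J (AdicCompletion J A)).2 (AdicCompletion.isAdicComplete hJ)

lemma of_mem_idealOfDefinition {a : A} (ha : a ∈ J) :
    AdicCompletion.of J A a ∈ idealOfDefinition J :=
  Ideal.mem_map_of_mem (algebraMap A (AdicCompletion J A)) ha

lemma sub_of_truncRep_mem (hJ : J.FG) (n : ℕ) (x : AdicCompletion J A) :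
    x - AdicCompletion.of J A (truncRep J n x) ∈ idealOfDefinition J ^ n := by
  rw [← evalₐ_eq_zero_iff hJ, map_sub, AdicCompletion.evalₐ_of, mk_truncRep, sub_self]

lemma adicDense_range_of (hJ : J.FG) :
    AdicDense (idealOfDefinition J) (Set.range (AdicCompletion.of J A)) :=
  fun x n => ⟨_, ⟨truncRep J n x, rfl⟩, sub_of_truncRep_mem hJ n x⟩

lemma map_idealOfDefinition_mem {R : Type v} [CommRing R] {K : Ideal R} {F : Type*} [FunLike F (AdicCompletion J A) R]
    [RingHomClass F (AdicCompletion J A) R] (G : F)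
    (hG : ∀ a ∈ J, G (AdicCompletion.of J A a) ∈ K) :
    ∀ x ∈ idealOfDefinition J, G x ∈ K := by
  change idealOfDefinition J ≤ Ideal.comap G K
  rw [Ideal.map_le_iff_le_comap]
  exact hG

variable [Algebra ℂ A]

/-- The map to the completion, as an algebra homomorphism. -/
noncomputable def AdicCompletion.ofAlgHom' (J : Ideal A) : A →ₐ[ℂ] AdicCompletion J A where
  toRingHom := algebraMap A (AdicCompletion J A)
  commutes' c := by
    change AdicCompletion.of J A _ = _
    rw [AdicCompletion.algebraMap_apply]; rfl

lemma AdicCompletion.ofAlgHom'_apply (J : Ideal A) (a : A) :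
    AdicCompletion.ofAlgHom' J a = AdicCompletion.of J A a := rfl

variable {R : Type v} [CommRing R] [Algebra ℂ R] {K : Ideal R}

/-- Universal property of the completion. -/
theorem exists_lift_completion [IsAdicComplete K R] (g : A →ₐ[ℂ] R) (hg : ∀ a ∈ J, g a ∈ K) :
    ∃ G : AdicCompletion J A →ₐ[ℂ] R, ∀ a, G (AdicCompletion.of J A a) = g a := by
  have key {n : ℕ} {a b : A}
      (h : Ideal.Quotient.mk (J ^ n) a = Ideal.Quotient.mk (J ^ n) b) : g a - g b ∈ K ^ n := by
    rw [← map_sub]; exact map_mem_pow g hg (Ideal.Quotient.eq.1 h)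
  obtain ⟨φ, hφ⟩ := exists_algHom_of_approx (K := K) (fun n x => g (truncRep J n x))
    (fun n x => key (by rw [mk_truncRep_of_le J (Nat.le_succ n), mk_truncRep]))
    (fun n x y => by rw [← map_add]; exact key (by simp [mk_truncRep]))
    (fun n x y => by rw [← map_mul]; exact key (by simp [mk_truncRep]))
    (fun n c => by
      rw [← g.commutes]
      exact key (by rw [mk_truncRep, AdicCompletion.algebraMap_apply, AdicCompletion.evalₐ_of]))
  refine ⟨φ, fun a => eq_of_forall_sub_mem_pow (J := K) fun n => ?_⟩
  have := (K ^ n).add_mem (hφ n (AdicCompletion.of J A a))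
    (key (b := a) (by rw [mk_truncRep, AdicCompletion.evalₐ_of]))
  rwa [sub_add_sub_cancel] at this

end CompletionBasics

/-! ### Topological generators and compatibility with brackets -/

section Generators

variable {R : Type*} [CommRing R] [Algebra ℂ R] {J : Ideal R}
  {R' : Type*} [CommRing R'] [Algebra ℂ R'] {K : Ideal R'}

/-- The set `G` generates a dense subalgebra, inverses of units being allowed. -/
def TopGenerates (J : Ideal R) (G : Set R) : Prop :=
  ∀ 𝒮 : Subalgebra ℂ R, G ⊆ 𝒮 → (∀ x ∈ 𝒮, ∀ y, x * y = 1 → y ∈ 𝒮) → AdicDense J (𝒮 : Set R)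

/-- The equalizer is a subalgebra containing the inverses of its units, hence dense, and continuity
does the rest. Inverses are allowed because `t` is a coordinate while `t⁻¹` is not. -/
lemma TopGenerates.algHom_ext {G : Set R} (hG : TopGenerates J G) [IsHausdorff K R']
    (f g : R →ₐ[ℂ] R') (hf : ∀ x ∈ J, f x ∈ K) (hg : ∀ x ∈ J, g x ∈ K)
    (h : ∀ x ∈ G, f x = g x) (x : R) : f x = g x := by
  refine eq_of_adicDense (J := J) (K := K) f g (hG (AlgHom.equalizer f g) h ?_) 0
    (fun n x hx => map_mem_pow f hf hx) (fun n x hx => map_mem_pow g hg hx) (fun x hx => hx) x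
  intro x hx y hxy
  rw [AlgHom.mem_equalizer] at *
  have h1 : f x * f y = 1 := by rw [← map_mul, hxy, map_one]
  have h2 : f x * g y = 1 := by rw [hx, ← map_mul, hxy, map_one]
  calc f y = f y * (f x * g y) := by rw [h2, mul_one]
    _ = (f x * f y) * g y := by ring
    _ = g y := by rw [h1, one_mul]

namespace Bivector

lemma br_self (π : Bivector R) (a : R) : π.br a a = 0 := by
  have h := π.skew a a
  have h2 : (2 : ℂ) • π.br a a = 0 := by
    rw [two_smul]; nth_rw 2 [h]; rw [add_neg_cancel]
  exact (smul_eq_zero_iff_right (two_ne_zero)).1 h2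

lemma br_one (π : Bivector R) (a : R) : π.br a 1 = 0 := by
  have h := π.leibniz a 1 1
  simpa using h

lemma br_algebraMap (π : Bivector R) (a : R) (c : ℂ) : π.br a (algebraMap ℂ R c) = 0 := by
  rw [Algebra.algebraMap_eq_smul_one, map_smul, br_one, smul_zero]

lemma algebraMap_br (π : Bivector R) (a : R) (c : ℂ) : π.br (algebraMap ℂ R c) a = 0 := by
  rw [π.skew, br_algebraMap, neg_zero]

/-- The Hamiltonian vector field `v {a, -}`. -/
noncomputable def ham (π : Bivector R) (v a : R) : Derivation ℂ R R :=
  Derivation.mk' (v • π.br a) fun x y => by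
    simp only [LinearMap.smul_apply, π.leibniz, smul_eq_mul]; ring

lemma ham_apply (π : Bivector R) (v a x : R) : π.ham v a x = v * π.br a x := rfl

/-- An algebra homomorphism is compatible with brackets with `x` if it is so on topological
generators. -/
lemma forall_map_br_of_topGenerates {G : Set R} (hG : TopGenerates J G) [IsHausdorff K R']
    (π : Bivector R) (π' : Bivector R') (f : R →ₐ[ℂ] R') (hf : ∀ x ∈ J, f x ∈ K) (x : R)
    (h : ∀ y ∈ G, f (π.br x y) = π'.br (f x) (f y)) (y : R) :
    f (π.br x y) = π'.br (f x) (f y) := by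
  let 𝒮 : Subalgebra ℂ R :=
    { carrier := {y | f (π.br x y) = π'.br (f x) (f y)}
      mul_mem' := fun {a b} ha hb => by
        change f (π.br x (a * b)) = π'.br (f x) (f (a * b))
        rw [π.leibniz, map_mul f a b, π'.leibniz, map_add, map_mul, map_mul, ha, hb]
      add_mem' := fun {a b} ha hb => by
        change f (π.br x (a + b)) = π'.br (f x) (f (a + b))
        rw [map_add, map_add, map_add, map_add, ha, hb]
      algebraMap_mem' := fun c => by
        change f (π.br x (algebraMap ℂ R c)) = π'.br (f x) (f (algebraMap ℂ R c))
        rw [br_algebraMap, f.commutes, br_algebraMap, map_zero] }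
  -- The shift is `1` since a bracket lowers the adic order by at most one.
  refine eq_of_adicDense (J := J) (K := K) ((f : R →ₗ[ℂ] R') ∘ₗ π.br x)
    (π'.br (f x) ∘ₗ (f : R →ₗ[ℂ] R')) (s := 𝒮) (hG 𝒮 h ?_) 1
    (fun n x hx => map_mem_pow f hf (π.br_mem_pow J n _ _ hx))
    (fun n x hx => π'.br_mem_pow K n _ _ (map_mem_pow f hf hx)) (fun x hx => hx) y
  intro a ha b hab
  change f (π.br x a) = π'.br (f x) (f a) at ha
  change f (π.br x b) = π'.br (f x) (f b)
  -- The Leibniz rule for `a b = 1` determines the bracket with `b` from the one with `a`, in source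
  -- and target alike.
  have h1 : a * π.br x b + b * π.br x a = 0 := by rw [← π.leibniz, hab, br_one]
  have h2 : f a * π'.br (f x) (f b) + f b * π'.br (f x) (f a) = 0 := by
    rw [← π'.leibniz, ← map_mul, hab, map_one, br_one]
  have h3 : f a * f b = 1 := by rw [← map_mul, hab, map_one]
  have h1' := congrArg f h1
  rw [map_add, map_mul, map_mul, ha, map_zero] at h1'
  linear_combination (f b) * h1' - f b * h2 - (f (π.br x b) - π'.br (f x) (f b)) * h3

/-- An algebra homomorphism is compatible with brackets if it is so on topological generators. -/
lemma map_br_of_topGenerates {G : Set R} (hG : TopGenerates J G) [IsHausdorff K R']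
    (π : Bivector R) (π' : Bivector R') (f : R →ₐ[ℂ] R') (hf : ∀ x ∈ J, f x ∈ K)
    (h : ∀ x ∈ G, ∀ y ∈ G, f (π.br x y) = π'.br (f x) (f y)) (x y : R) :
    f (π.br x y) = π'.br (f x) (f y) := by
  refine forall_map_br_of_topGenerates hG π π' f hf x (fun y hy => ?_) y
  rw [π.skew, π'.skew, map_neg, forall_map_br_of_topGenerates hG π π' f hf y (fun z hz => h y hy z hz)]

/-- The Jacobi identity passes to completions. -/
lemma IsPoisson.completion {A : Type u} [CommRing A] [Algebra ℂ A] {I : Ideal A} (hI : I.FG)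
    {π : Bivector A} (hπ : π.IsPoisson) : (π.completion I).IsPoisson := by
  have := isAdicComplete_idealOfDefinition hI
  intro x y z
  refine eq_of_forall_sub_mem_pow (J := idealOfDefinition I) fun n => ?_
  -- A nested bracket loses two orders, so precision `n + 2` in the arguments gives precision `n` in
  -- the identity.
  obtain ⟨_, ⟨a, rfl⟩, ha⟩ := adicDense_range_of hI x (n + 1 + 1)
  obtain ⟨_, ⟨b, rfl⟩, hb⟩ := adicDense_range_of hI y (n + 1 + 1)
  obtain ⟨_, ⟨c, rfl⟩, hc⟩ := adicDense_range_of hI z (n + 1 + 1)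
  set B := (π.completion I).br with hB
  set a' := AdicCompletion.of I A a
  set b' := AdicCompletion.of I A b
  set c' := AdicCompletion.of I A c
  have e0 : B a' (B b' c') = B (B a' b') c' + B b' (B a' c') := by
    simp only [hB, a', b', c', completion_br_of, hπ a b c, map_add]
  have two {m : ℕ} {p p' q q' : AdicCompletion I A} (hp : p - p' ∈ idealOfDefinition I ^ (m + 1))
      (hq : q - q' ∈ idealOfDefinition I ^ (m + 1)) : B p q - B p' q' ∈ idealOfDefinition I ^ m := by
    rw [← Ideal.Quotient.eq] at *
    exact (π.completion I).mk_pow_br_congr _ m hp hq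
  have low {p p' : AdicCompletion I A} (hp : p - p' ∈ idealOfDefinition I ^ (n + 1 + 1)) :
      p - p' ∈ idealOfDefinition I ^ (n + 1) := Ideal.pow_le_pow_right (Nat.le_succ _) hp
  have h1 := two (low ha) (two hb hc)
  have h2 := two (two ha hb) (low hc)
  have h3 := two (low hb) (two ha hc)
  have := Ideal.sub_mem _ h1 (Ideal.add_mem _ h2 h3)
  rw [e0] at this
  convert this using 1; ring

end Bivector

lemma topGenerates_range_of {A : Type u} [CommRing A] [Algebra ℂ A] {I : Ideal A} (hI : I.FG) :
    TopGenerates (idealOfDefinition I) (Set.range (AdicCompletion.of I A)) :=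
  fun 𝒮 h𝒮 _ x n => by
    obtain ⟨y, hy, hxy⟩ := adicDense_range_of hI x n
    exact ⟨y, h𝒮 hy, hxy⟩

end Generators

/-! ### Flows of derivations with variable time -/

section Taylor

open Finset

variable {R : Type*} [CommRing R] [Algebra ℂ R]

/-- The divided power `D ^ k / k!` of a derivation. -/
noncomputable def dividedPower (D : Derivation ℂ R R) (k : ℕ) (f : R) : R :=
  ((k.factorial : ℂ)⁻¹) • (D^[k]) f

lemma dividedPower_zero (D : Derivation ℂ R R) (f : R) : dividedPower D 0 f = f := by
  simp [dividedPower]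

lemma succ_smul_dividedPower (D : Derivation ℂ R R) (k : ℕ) (f : R) :
    ((k + 1 : ℕ) : ℂ) • dividedPower D (k + 1) f = D (dividedPower D k f) := by
  have h1 : ((k + 1 : ℕ) : ℂ) ≠ 0 := by exact_mod_cast Nat.succ_ne_zero k
  rw [dividedPower, dividedPower, D.map_smul, Function.iterate_succ_apply', Nat.factorial_succ,
    Nat.cast_mul, mul_inv, smul_smul, mul_inv_cancel_left₀ h1]

lemma dividedPower_add (D : Derivation ℂ R R) (k : ℕ) (f g : R) :
    dividedPower D k (f + g) = dividedPower D k f + dividedPower D k g := by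
  rw [dividedPower, iterate_map_add, smul_add]; rfl

lemma dividedPower_succ_of_apply_eq_zero (D : Derivation ℂ R R) (k : ℕ) {f : R} (h : D f = 0) :
    dividedPower D (k + 1) f = 0 := by
  rw [dividedPower, Function.iterate_succ_apply, h, iterate_map_zero, smul_zero]

lemma dividedPower_mul (D : Derivation ℂ R R) (k : ℕ) (f g : R) :
    dividedPower D k (f * g)
      = ∑ x ∈ antidiagonal k, dividedPower D x.1 f * dividedPower D x.2 g := by
  induction k with
  | zero => simp [dividedPower_zero]
  | succ k ih =>
    have h1 : ((k + 1 : ℕ) : ℂ) ≠ 0 := by exact_mod_cast Nat.succ_ne_zero k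
    refine (smul_right_injective R h1) ?_
    dsimp only
    rw [succ_smul_dividedPower, ih, map_sum, smul_sum]
    have e1 : ∑ x ∈ antidiagonal (k + 1), ((x.1 : ℕ) : ℂ) •
        (dividedPower D x.1 f * dividedPower D x.2 g)
        = ∑ x ∈ antidiagonal k, D (dividedPower D x.1 f) * dividedPower D x.2 g := by
      rw [Finset.Nat.sum_antidiagonal_succ]
      simp only [Nat.cast_zero, zero_smul, zero_add]
      refine sum_congr rfl fun x _ => ?_
      rw [← succ_smul_dividedPower, smul_mul_assoc]
    have e2 : ∑ x ∈ antidiagonal (k + 1), ((x.2 : ℕ) : ℂ) •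
        (dividedPower D x.1 f * dividedPower D x.2 g)
        = ∑ x ∈ antidiagonal k, dividedPower D x.1 f * D (dividedPower D x.2 g) := by
      rw [Finset.Nat.sum_antidiagonal_succ']
      simp only [Nat.cast_zero, zero_smul, zero_add]
      refine sum_congr rfl fun x _ => ?_
      rw [← succ_smul_dividedPower, mul_smul_comm]
    calc _ = ∑ x ∈ antidiagonal k, D (dividedPower D x.1 f) * dividedPower D x.2 g
          + ∑ x ∈ antidiagonal k, dividedPower D x.1 f * D (dividedPower D x.2 g) := by
          rw [← sum_add_distrib]
          refine sum_congr rfl fun x _ => ?_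
          rw [D.leibniz, smul_eq_mul, smul_eq_mul]; ring
      _ = _ := by
          rw [← e1, ← e2, ← sum_add_distrib]
          refine sum_congr rfl fun x hx => ?_
          rw [← add_smul, ← Nat.cast_add, mem_antidiagonal.1 hx]

/-- The truncated Taylor sum `∑_{k < n} h ^ k D ^ k f / k!`. -/
noncomputable def taylorSum (D : Derivation ℂ R R) (h : R) (n : ℕ) (f : R) : R :=
  ∑ k ∈ range n, h ^ k * dividedPower D k f

lemma taylorSum_of_apply_eq_zero (D : Derivation ℂ R R) (h : R) (n : ℕ) {f : R} (hf : D f = 0) :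
    taylorSum D h (n + 1) f = f := by
  rw [taylorSum, sum_range_succ']
  simp [dividedPower_succ_of_apply_eq_zero D _ hf, dividedPower_zero]

variable {J : Ideal R}

/-- By the Leibniz rule for divided powers, the truncated sum of a product differs from the product
of the truncated sums only in terms with a factor `h ^ (i + j)`, `i + j ≥ n`. -/
lemma taylorSum_mul_mem (D : Derivation ℂ R R) {h : R} (hh : h ∈ J) (n : ℕ) (f g : R) :
    taylorSum D h n (f * g) - taylorSum D h n f * taylorSum D h n g ∈ J ^ n := by
  have e1 : taylorSum D h n (f * g) = ∑ i ∈ range n, ∑ j ∈ range (n - i),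
      (h ^ i * dividedPower D i f) * (h ^ j * dividedPower D j g) := by
    rw [← sum_range_diag_flip, taylorSum]
    refine sum_congr rfl fun k _ => ?_
    rw [dividedPower_mul, mul_sum, ← Finset.Nat.sum_antidiagonal_eq_sum_range_succ
      (fun i j => (h ^ i * dividedPower D i f) * (h ^ j * dividedPower D j g))]
    refine sum_congr rfl fun x hx => ?_
    rw [← mem_antidiagonal.1 hx, pow_add]; ring
  have e2 : taylorSum D h n f * taylorSum D h n g = ∑ i ∈ range n, ∑ j ∈ range n,
      (h ^ i * dividedPower D i f) * (h ^ j * dividedPower D j g) := by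
    rw [taylorSum, taylorSum, sum_mul_sum]
  rw [e1, e2, ← sum_sub_distrib]
  refine Ideal.sum_mem _ fun i hi => ?_
  rw [← neg_mem_iff, neg_sub, ← sum_sdiff (range_subset_range.2 (Nat.sub_le n i)),
    add_sub_cancel_right]
  refine Ideal.sum_mem _ fun j hj => ?_
  rw [mem_sdiff, mem_range, mem_range] at hj
  have : h ^ (i + j) ∈ J ^ n := Ideal.pow_le_pow_right (by omega) (Ideal.pow_mem_pow hh (i + j))
  convert Ideal.mul_mem_right (dividedPower D i f * dividedPower D j g) _ this using 1
  rw [pow_add]; ring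

/-- The Taylor homomorphism `f ↦ ∑ h ^ k D ^ k f / k!`. -/
theorem exists_taylor [IsAdicComplete J R] (D : Derivation ℂ R R) {h : R} (hh : h ∈ J) :
    ∃ φ : R →ₐ[ℂ] R, ∀ n f, φ f - taylorSum D h n f ∈ J ^ n := by
  refine exists_algHom_of_approx (taylorSum D h) (fun n f => ?_) (fun n f g => ?_)
    (fun n f g => taylorSum_mul_mem D hh n f g) (fun n c => ?_)
  · rw [taylorSum, taylorSum, sum_range_succ, add_sub_cancel_left]
    exact Ideal.mul_mem_right _ _ (Ideal.pow_mem_pow hh n)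
  · simp [taylorSum, dividedPower_add, mul_add, sum_add_distrib]
  · cases n with
    | zero => simp
    | succ n => rw [taylorSum_of_apply_eq_zero D h n (D.map_algebraMap c), sub_self]; exact zero_mem _

/-- The Taylor homomorphism `f ↦ ∑ h ^ k D ^ k f / k!`. -/
noncomputable def taylor [IsAdicComplete J R] (D : Derivation ℂ R R) {h : R} (hh : h ∈ J) :
    R →ₐ[ℂ] R := (exists_taylor D hh).choose

lemma derivation_mem_pow (D : Derivation ℂ R R) {n : ℕ} {x : R} (hx : x ∈ J ^ (n + 1)) : D x ∈ J ^ n := by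
  induction n generalizing x with
  | zero => simp
  | succ n ih =>
    rw [pow_succ] at hx
    induction hx using Submodule.mul_induction_on' with
    | mem_mul_mem x hx y hy =>
      rw [D.leibniz, smul_eq_mul, smul_eq_mul, pow_succ]
      refine Ideal.add_mem _ ?_ ?_
      · rw [← pow_succ]; exact Ideal.mul_mem_right _ _ hx
      · rw [mul_comm y]; exact Ideal.mul_mem_mul (ih hx) hy
    | add x hx y hy h1 h2 => rw [map_add]; exact Ideal.add_mem _ h1 h2

variable [IsAdicComplete J R] (D : Derivation ℂ R R) {h : R} (hh : h ∈ J)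

lemma taylor_sub_mem (n : ℕ) (f : R) : taylor D hh f - taylorSum D h n f ∈ J ^ n :=
  (exists_taylor D hh).choose_spec n f

lemma taylor_of_apply_eq_zero {f : R} (hf : D f = 0) : taylor D hh f = f :=
  eq_of_forall_sub_mem_pow (J := J) fun n => by
    have := taylor_sub_mem D hh (n + 1) f
    rw [taylorSum_of_apply_eq_zero D h n hf] at this
    exact Ideal.pow_le_pow_right (Nat.le_succ n) this

lemma taylor_of_apply_eq_one {f : R} (hf : D f = 1) : taylor D hh f = f + h :=
  eq_of_forall_sub_mem_pow (J := J) fun n => by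
    have := taylor_sub_mem D hh (n + 2) f
    have e : taylorSum D h (n + 2) f = f + h := by
      rw [taylorSum, sum_range_succ', sum_range_succ', sum_eq_zero]
      · simp [dividedPower, hf, add_comm]
      · intro k _
        have : D^[k + 1 + 1] f = 0 := by
          rw [Function.iterate_succ_apply, Function.iterate_succ_apply, hf, D.map_one_eq_zero,
            iterate_map_zero]
        rw [dividedPower, this, smul_zero, mul_zero]
    rw [e] at this
    exact Ideal.pow_le_pow_right (by omega) this

/-- All terms after the first are multiples of `h`, and the cofactors form a convergent series
themselves. So the difference is an honest multiple of `h`, not merely a limit of multiples. -/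
lemma taylor_sub_mem_span (f : R) : taylor D hh f - f ∈ Ideal.span {h} := by
  obtain ⟨g, hg⟩ := exists_adic_limit (J := J)
    (fun n => ∑ k ∈ range n, h ^ k * dividedPower D (k + 1) f) (fun n => by
      rw [sum_range_succ, add_sub_cancel_left]
      exact Ideal.mul_mem_right _ _ (Ideal.pow_mem_pow hh n))
  have : taylor D hh f - f = h * g := eq_of_forall_sub_mem_pow (J := J) fun n => by
    have h1 := Ideal.pow_le_pow_right (Nat.le_succ n) (taylor_sub_mem D hh (n + 1) f)
    have h2 := Ideal.mul_mem_left _ h (hg n)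
    have e : taylorSum D h (n + 1) f
        = h * ∑ k ∈ range n, h ^ k * dividedPower D (k + 1) f + f := by
      rw [taylorSum, sum_range_succ', mul_sum]
      simp only [pow_zero, one_mul, dividedPower_zero, pow_succ]
      congr 1
      exact sum_congr rfl fun k _ => by ring
    rw [e] at h1
    have := Ideal.sub_mem _ h1 h2
    convert this using 1; ring
  rw [this]
  exact Ideal.mul_mem_right _ _ (Ideal.mem_span_singleton_self h)

/-- If `D h = -1`, the derivative of the series telescopes: after `n + 1` terms only `h ^ n D (D ^ n
f / n!)` is left, which tends to zero. As elements killed by `D` are fixed, the flow is then a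
projection onto the kernel of `D`. -/
lemma derivation_taylor (hD : D h = -1) (f : R) : D (taylor D hh f) = 0 := by
  have key (n : ℕ) : D (taylorSum D h (n + 1) f) = h ^ n * D (dividedPower D n f) := by
    induction n with
    | zero => simp [taylorSum]
    | succ n ih =>
      rw [taylorSum, sum_range_succ, map_add, ← taylorSum, ih, D.leibniz, D.leibniz_pow, hD,
        ← succ_smul_dividedPower]
      rw [nsmul_eq_mul, Algebra.smul_def, map_natCast]
      simp only [smul_eq_mul, Nat.add_sub_cancel]
      ring
  refine eq_zero_of_forall_mem_pow (J := J) fun n => ?_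
  have h1 := derivation_mem_pow (J := J) D (taylor_sub_mem D hh (n + 1) f)
  rw [map_sub, key] at h1
  have := Ideal.add_mem _ h1 (Ideal.mul_mem_right (D (dividedPower D n f)) _ (Ideal.pow_mem_pow hh n))
  rwa [sub_add_cancel] at this

lemma taylor_mem {x : R} (hx : x ∈ J) : taylor D hh x ∈ J := by
  have := Ideal.add_mem _ (Ideal.span_le.2 (by simpa using hh) (taylor_sub_mem_span D hh x)) hx
  rwa [sub_add_cancel] at this

end Taylor

/-! ### Quotients of complete rings -/

section QuotientComplete

variable {R : Type*} [CommRing R] {J : Ideal R}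

lemma mem_map_mk_pow_iff {K : Ideal R} {n : ℕ} {x : R} :
    Ideal.Quotient.mk K x ∈ (J.map (Ideal.Quotient.mk K)) ^ n ↔ ∃ y ∈ J ^ n, x - y ∈ K := by
  rw [← Ideal.map_pow, Ideal.mem_map_iff_of_surjective _ Ideal.Quotient.mk_surjective]
  refine exists_congr fun y => and_congr_right fun _ => ?_
  rw [eq_comm, Ideal.Quotient.eq]

/-- Arbitrary lifts of a Cauchy sequence need not be Cauchy, but its `n`-th increment lifts into `J
^ n`, and the sum of these lifts converges. -/
lemma isPrecomplete_quotient [IsPrecomplete J R] (K : Ideal R) :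
    IsPrecomplete (J.map (Ideal.Quotient.mk K)) (R ⧸ K) := by
  refine isPrecomplete_of_exists_limit fun f hf => ?_
  choose g hg using fun n => Ideal.Quotient.mk_surjective (f n)
  have h1 (n : ℕ) : ∃ y ∈ J ^ n, g (n + 1) - g n - y ∈ K := by
    rw [← mem_map_mk_pow_iff, map_sub, hg, hg]; exact hf n
  choose y hy hyK using h1
  obtain ⟨L, hL⟩ := exists_adic_limit (J := J) (fun n => g 0 + ∑ i ∈ Finset.range n, y i)
    (fun n => by
      rw [Finset.sum_range_succ, ← add_assoc, add_sub_cancel_left]; exact hy n)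
  have h2 (n : ℕ) : g n - (g 0 + ∑ i ∈ Finset.range n, y i) ∈ K := by
    induction n with
    | zero => simp
    | succ n ih =>
      rw [Finset.sum_range_succ]
      have := K.add_mem ih (hyK n)
      convert this using 1; ring
  refine ⟨Ideal.Quotient.mk K L, fun n => ?_⟩
  rw [← hg, ← map_sub, mem_map_mk_pow_iff]
  refine ⟨_, hL n, ?_⟩
  have := K.neg_mem (h2 n)
  convert this using 1; ring

lemma map_mk_maximalIdeal [IsLocalRing R] (K : Ideal R) [IsLocalRing (R ⧸ K)] :
    (IsLocalRing.maximalIdeal R).map (Ideal.Quotient.mk K) = IsLocalRing.maximalIdeal (R ⧸ K) := by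
  have hloc : IsLocalHom (Ideal.Quotient.mk K) :=
    .of_surjective _ Ideal.Quotient.mk_surjective
  ext x
  obtain ⟨y, rfl⟩ := Ideal.Quotient.mk_surjective x
  constructor
  · intro h
    exact ((IsLocalRing.local_hom_TFAE (Ideal.Quotient.mk K)).out 0 2 rfl rfl).1 hloc h
  · intro h
    refine Ideal.mem_map_of_mem _ ?_
    rw [IsLocalRing.mem_maximalIdeal, mem_nonunits_iff] at *
    exact fun hy => h (hy.map _)

end QuotientComplete

/-! ### Dirac reduction by a pair of constraints -/

namespace Bivector

variable {P : Type*} [CommRing P] [Algebra ℂ P]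

/-- The Dirac bracket with respect to the constraints `p`, `q`, where `v = {p, q}⁻¹`. -/
noncomputable def dirac (π : Bivector P) (p q v : P) : Bivector P where
  br := LinearMap.mk₂ ℂ
    (fun a b => π.br a b + v * (π.br a p * π.br q b - π.br a q * π.br p b))
    (fun a a' b => by simp only [map_add, LinearMap.add_apply]; ring)
    (fun c a b => by
      simp only [map_smul, LinearMap.smul_apply]; simp only [Algebra.smul_def]; ring)
    (fun a b b' => by simp only [map_add]; ring)
    (fun c a b => by simp only [map_smul]; simp only [Algebra.smul_def]; ring)
  skew a b := by
    simp only [LinearMap.mk₂_apply]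
    rw [π.skew b a, π.skew b p, π.skew b q, π.skew q a, π.skew p a]; ring
  leibniz a b c := by
    simp only [LinearMap.mk₂_apply, π.leibniz]; ring

variable (π : Bivector P) {p q v : P}

lemma dirac_apply (a b : P) : (π.dirac p q v).br a b
    = π.br a b + v * (π.br a p * π.br q b - π.br a q * π.br p b) := rfl

lemma dirac_fst (h : v * π.br p q = 1) (a : P) : (π.dirac p q v).br a p = 0 := by
  rw [dirac_apply, br_self, π.skew q p]
  linear_combination (-(π.br a p)) * h

lemma dirac_snd (h : v * π.br p q = 1) (a : P) : (π.dirac p q v).br a q = 0 := by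
  rw [dirac_apply, br_self]
  linear_combination (-(π.br a q)) * h

/-- Both constraints are Casimirs of the Dirac bracket, so it descends to the quotient by them. -/
lemma dirac_mem_span (h : v * π.br p q = 1) (a x : P) (hx : x ∈ Ideal.span {p, q}) :
    (π.dirac p q v).br a x ∈ Ideal.span {p, q} := by
  obtain ⟨b, c, rfl⟩ := Ideal.mem_span_pair.1 hx
  rw [map_add, leibniz, leibniz, π.dirac_fst h, π.dirac_snd h, mul_zero, mul_zero, zero_add,
    zero_add]
  exact Ideal.mem_span_pair.2 ⟨_, _, congrArg₂ (· + ·) (mul_comm _ p) (mul_comm _ q)⟩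

/-- The Dirac reduction: the Dirac bracket on `P / (p, q)`. -/
noncomputable def diracReduction (h : v * π.br p q = 1) : Bivector (P ⧸ Ideal.span {p, q}) :=
  (π.dirac p q v).quotient _ (π.dirac_mem_span h)

lemma diracReduction_mk (h : v * π.br p q = 1) (a b : P) :
    (π.diracReduction h).br (Ideal.Quotient.mk _ a) (Ideal.Quotient.mk _ b)
      = Ideal.Quotient.mk _ ((π.dirac p q v).br a b) :=
  quotient_br_mk _ _ _ a b

/-- The correction term has a factor `{a, p}` or `{p, b}` in each summand. Reduced brackets are
always computed in this way, on representatives commuting with `p`. -/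
lemma diracReduction_mk_of_commute (h : v * π.br p q = 1) {a b : P} (ha : π.br p a = 0)
    (hb : π.br p b = 0) :
    (π.diracReduction h).br (Ideal.Quotient.mk _ a) (Ideal.Quotient.mk _ b)
      = Ideal.Quotient.mk _ (π.br a b) := by
  rw [diracReduction_mk, dirac_apply, π.skew a p, ha, hb]; simp

/-- The commutant of `p` is a retract of the algebra, with kernel generated by `q`. -/
lemma exists_retraction {J : Ideal P} [IsAdicComplete J P] (h : v * π.br p q = 1) (hq : q ∈ J) :
    ∃ E : P →ₐ[ℂ] P, (∀ f, π.br p (E f) = 0) ∧ (∀ f, π.br p f = 0 → E f = f) ∧ E q = 0 ∧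
      (∀ f, E f - f ∈ Ideal.span {q}) ∧ ∀ f ∈ J, E f ∈ J := by
  have hq' : -q ∈ J := J.neg_mem hq
  have hD : π.ham v p q = 1 := h
  have hu (f : P) : π.ham v p f = 0 ↔ π.br p f = 0 := by
    rw [ham_apply]
    refine ⟨fun hf => ?_, fun hf => by rw [hf, mul_zero]⟩
    linear_combination (π.br p q) * hf - (π.br p f) * h
  -- The field `v {p, -}` takes the value `1` on `q`. Flowing for time `-q` restricts a function to
  -- `q = 0` and extends it to be constant along the field.
  refine ⟨taylor (π.ham v p) hq', fun f => (hu _).1 (derivation_taylor _ hq' ?_ f),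
    fun f hf => taylor_of_apply_eq_zero _ hq' ((hu f).2 hf), ?_, fun f => ?_,
    fun f hf => taylor_mem _ hq' hf⟩
  · rw [map_neg, hD]
  · rw [taylor_of_apply_eq_one _ hq' hD, add_neg_cancel]
  · have := taylor_sub_mem_span (π.ham v p) hq' f
    rwa [Ideal.span_singleton_neg] at this

variable {π}

lemma IsPoisson.br_commute (hπ : π.IsPoisson) {a b : P} (ha : π.br p a = 0) (hb : π.br p b = 0) :
    π.br p (π.br a b) = 0 := by
  rw [hπ, ha, hb]; simp

/-- The retraction onto the commutant of `p` alters a function only by a multiple of `q`, so every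
class modulo `p`, `q` meets that commutant. -/
lemma exists_commute_mk_eq {J : Ideal P} [IsAdicComplete J P] (h : v * π.br p q = 1) (hq : q ∈ J)
    (x : P ⧸ Ideal.span {p, q}) : ∃ a, π.br p a = 0 ∧ Ideal.Quotient.mk _ a = x := by
  obtain ⟨f, rfl⟩ := Ideal.Quotient.mk_surjective x
  obtain ⟨E, h1, -, -, h4, -⟩ := π.exists_retraction h hq
  refine ⟨E f, h1 f, Ideal.Quotient.eq.2 (Ideal.span_mono (by simp) (h4 f))⟩

/-- On representatives commuting with `p` the reduced bracket is that of `P`. Their brackets commute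
with `p` again, by the Jacobi identity, so the identity for the quotient is the image of the one in
`P`. -/
lemma IsPoisson.diracReduction (hπ : π.IsPoisson) {J : Ideal P} [IsAdicComplete J P]
    (h : v * π.br p q = 1) (hq : q ∈ J) : (π.diracReduction h).IsPoisson := by
  intro x y z
  obtain ⟨a, ha, rfl⟩ := exists_commute_mk_eq h hq x
  obtain ⟨b, hb, rfl⟩ := exists_commute_mk_eq h hq y
  obtain ⟨c, hc, rfl⟩ := exists_commute_mk_eq h hq z
  have hab := hπ.br_commute ha hb
  have hbc := hπ.br_commute hb hc
  have hac := hπ.br_commute ha hc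
  simp only [diracReduction_mk_of_commute, ha, hb, hc, hab, hbc, hac, hπ a b c, map_add]

/-- The Dirac reduction does not depend on the second constraint. -/
lemma exists_diracReduction_equiv_snd (hπ : π.IsPoisson) {J : Ideal P} [IsAdicComplete J P]
    {q' v' : P} (h : v * π.br p q = 1) (h' : v' * π.br p q' = 1) (hq : q ∈ J) (hq' : q' ∈ J) :
    ∃ θ : (P ⧸ Ideal.span {p, q}) ≃ₐ[ℂ] (P ⧸ Ideal.span {p, q'}),
      IsPoissonIso (π.diracReduction h) (π.diracReduction h') θ := by
  obtain ⟨E, h1, h2, h3, h4, -⟩ := π.exists_retraction h hq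
  obtain ⟨E', h1', h2', h3', h4', -⟩ := π.exists_retraction h' hq'
  have hp := π.br_self p
  -- Both quotients are the commutant of `p` modulo `p`. The retraction `E` kills `q` and fixes `p`,
  -- so it descends, and it is the identity on representatives in the commutant; likewise for `g`.
  let f : (P ⧸ Ideal.span {p, q}) →ₐ[ℂ] (P ⧸ Ideal.span {p, q'}) :=
    Ideal.Quotient.liftₐ _ ((Ideal.Quotient.mkₐ ℂ _).comp E) (fun a ha => by
      obtain ⟨b, c, rfl⟩ := Ideal.mem_span_pair.1 ha
      rw [AlgHom.comp_apply, map_add, map_mul, map_mul, h3, mul_zero, add_zero, h2 p hp]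
      exact Ideal.Quotient.eq_zero_iff_mem.2 (Ideal.mul_mem_left _ _ (Ideal.subset_span (by simp))))
  let g : (P ⧸ Ideal.span {p, q'}) →ₐ[ℂ] (P ⧸ Ideal.span {p, q}) :=
    Ideal.Quotient.liftₐ _ ((Ideal.Quotient.mkₐ ℂ _).comp E') (fun a ha => by
      obtain ⟨b, c, rfl⟩ := Ideal.mem_span_pair.1 ha
      rw [AlgHom.comp_apply, map_add, map_mul, map_mul, h3', mul_zero, add_zero, h2' p hp]
      exact Ideal.Quotient.eq_zero_iff_mem.2 (Ideal.mul_mem_left _ _ (Ideal.subset_span (by simp))))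
  have hf {a : P} (ha : π.br p a = 0) : f (Ideal.Quotient.mk _ a) = Ideal.Quotient.mk _ a := by
    change Ideal.Quotient.mk _ (E a) = _
    rw [h2 a ha]
  have hg {a : P} (ha : π.br p a = 0) : g (Ideal.Quotient.mk _ a) = Ideal.Quotient.mk _ a := by
    change Ideal.Quotient.mk _ (E' a) = _
    rw [h2' a ha]
  refine ⟨AlgEquiv.ofAlgHom f g ?_ ?_, ?_⟩
  · ext x
    obtain ⟨a, ha, rfl⟩ := exists_commute_mk_eq h' hq' x
    rw [AlgHom.comp_apply, hg ha, hf ha]; rfl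
  · ext x
    obtain ⟨a, ha, rfl⟩ := exists_commute_mk_eq h hq x
    rw [AlgHom.comp_apply, hf ha, hg ha]; rfl
  · intro x y
    obtain ⟨a, ha, rfl⟩ := exists_commute_mk_eq h hq x
    obtain ⟨b, hb, rfl⟩ := exists_commute_mk_eq h hq y
    simp only [AlgEquiv.ofAlgHom_apply]
    rw [diracReduction_mk_of_commute _ h ha hb, hf ha, hf hb, hf (hπ.br_commute ha hb),
      diracReduction_mk_of_commute _ h' ha hb]

/-- The correction term is unchanged when `p` and `q` are exchanged and `v` changes sign. -/
lemma diracReduction_swap (h : v * π.br p q = 1) (h' : -v * π.br q p = 1) :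
    ∃ θ : (P ⧸ Ideal.span {p, q}) ≃ₐ[ℂ] (P ⧸ Ideal.span {q, p}),
      IsPoissonIso (π.diracReduction h) (π.diracReduction h') θ := by
  refine ⟨Ideal.quotientEquivAlgOfEq ℂ (by rw [Set.pair_comm]), fun x y => ?_⟩
  obtain ⟨a, rfl⟩ := Ideal.Quotient.mk_surjective x
  obtain ⟨b, rfl⟩ := Ideal.Quotient.mk_surjective y
  rw [diracReduction_mk, Ideal.quotientEquivAlgOfEq_mk, Ideal.quotientEquivAlgOfEq_mk,
    Ideal.quotientEquivAlgOfEq_mk, diracReduction_mk, dirac_apply, dirac_apply]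
  congr 1; ring

end Bivector

lemma IsPoissonIso.trans {A B C : Type*} [CommRing A] [Algebra ℂ A] [CommRing B] [Algebra ℂ B]
    [CommRing C] [Algebra ℂ C] {π : Bivector A} {π' : Bivector B} {π'' : Bivector C}
    {e : A ≃ₐ[ℂ] B} {e' : B ≃ₐ[ℂ] C} (h : IsPoissonIso π π' e) (h' : IsPoissonIso π' π'' e') :
    IsPoissonIso π π'' (e.trans e') := fun a b => by
  simp only [AlgEquiv.trans_apply, h a b, h' _ _]

lemma IsPoissonIso.symm {A B : Type*} [CommRing A] [Algebra ℂ A] [CommRing B] [Algebra ℂ B]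
    {π : Bivector A} {π' : Bivector B} {e : A ≃ₐ[ℂ] B} (h : IsPoissonIso π π' e) :
    IsPoissonIso π' π e.symm := fun a b => by
  rw [AlgEquiv.symm_apply_eq, h]; simp

namespace Bivector

variable {P : Type*} [CommRing P] [Algebra ℂ P] {π : Bivector P}

/-- The Dirac reduction by one pair of constraints does not depend on the pair. -/
theorem exists_diracReduction_equiv [IsLocalRing P] [IsAdicComplete (IsLocalRing.maximalIdeal P) P]
    (hπ : π.IsPoisson) {p q v p' q' v' : P} (h : v * π.br p q = 1) (h' : v' * π.br p' q' = 1)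
    (hq : q ∈ IsLocalRing.maximalIdeal P) (hp : p ∈ IsLocalRing.maximalIdeal P)
    (hq' : q' ∈ IsLocalRing.maximalIdeal P) (hp' : p' ∈ IsLocalRing.maximalIdeal P) :
    ∃ θ : (P ⧸ Ideal.span {p, q}) ≃ₐ[ℂ] (P ⧸ Ideal.span {p', q'}),
      IsPoissonIso (π.diracReduction h) (π.diracReduction h') θ := by
  have hu : IsUnit (π.br p q) := .of_mul_eq_one_right _ h
  have hu' : IsUnit (π.br p' q') := .of_mul_eq_one_right _ h'
  -- One of `q'`, `q`, `q + q'` works: if `{p, q'}` and `{p', q}` are both non-units, adding them to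
  -- the units `{p, q}` and `{p', q'}` leaves units, the ring being local.
  obtain ⟨x, hx, hpx, hpx'⟩ : ∃ x ∈ IsLocalRing.maximalIdeal P,
      IsUnit (π.br p x) ∧ IsUnit (π.br p' x) := by
    by_cases h1 : IsUnit (π.br p q')
    · exact ⟨q', hq', h1, hu'⟩
    by_cases h2 : IsUnit (π.br p' q)
    · exact ⟨q, hq, hu, h2⟩
    refine ⟨q + q', Ideal.add_mem _ hq hq', ?_, ?_⟩ <;> rw [map_add]
    · by_contra h3
      have := Ideal.sub_mem (IsLocalRing.maximalIdeal P) h3 h1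
      rw [add_sub_cancel_right] at this
      exact this hu
    · by_contra h3
      have := Ideal.sub_mem (IsLocalRing.maximalIdeal P) h3 h2
      rw [add_sub_cancel_left] at this
      exact this hu'
  obtain ⟨w, hw⟩ := hpx.exists_left_inv
  obtain ⟨w', hw'⟩ := hpx'.exists_left_inv
  have hwx : -w * π.br x p = 1 := by rw [π.skew, neg_mul_neg, hw]
  have hwx' : -w' * π.br x p' = 1 := by rw [π.skew, neg_mul_neg, hw']
  -- One constraint is changed at a time: `(p, q)`, `(p, x)`, `(x, p)`, `(x, p')`, `(p', x)`, `(p',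
  -- q')`.
  obtain ⟨θ₁, h₁⟩ := exists_diracReduction_equiv_snd hπ h hw hq hx
  obtain ⟨θ₂, h₂⟩ := diracReduction_swap hw hwx
  obtain ⟨θ₃, h₃⟩ := exists_diracReduction_equiv_snd hπ hwx hwx' hp hp'
  obtain ⟨θ₄, h₄⟩ := diracReduction_swap hw' hwx'
  obtain ⟨θ₅, h₅⟩ := exists_diracReduction_equiv_snd hπ hw' h' hx hq'
  exact ⟨_, (((h₁.trans h₂).trans h₃).trans h₄.symm).trans h₅⟩

/-- `P` is not assumed Noetherian, so closedness of the ideal `(p, q)` needs an argument. The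
composite of the retraction killing `q` with the one killing `p` is continuous, annihilates this
ideal, and changes functions only by its elements. A function in the closure is therefore sent to
zero, and so lies in the ideal. -/
lemma isHausdorff_diracReduction {J : Ideal P} [IsAdicComplete J P] {p q v : P}
    (h : v * π.br p q = 1) (hp : p ∈ J) (hq : q ∈ J) :
    IsHausdorff (J.map (Ideal.Quotient.mk (Ideal.span {p, q}))) (P ⧸ Ideal.span {p, q}) := by
  have h' : -v * π.br q p = 1 := by rw [π.skew, neg_mul_neg, h]
  obtain ⟨E, h1, h2, h3, h4, h5⟩ := π.exists_retraction h hq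
  obtain ⟨E', h1', h2', h3', h4', h5'⟩ := π.exists_retraction h' hp
  refine isHausdorff_of_forall_mem_pow fun x hx => ?_
  obtain ⟨a, rfl⟩ := Ideal.Quotient.mk_surjective x
  have hE : E' (E a) = 0 := eq_zero_of_forall_mem_pow (J := J) fun n => by
    obtain ⟨y, hy, hay⟩ := mem_map_mk_pow_iff.1 (hx n)
    obtain ⟨b, c, hbc⟩ := Ideal.mem_span_pair.1 hay
    have e : E' (E a) = E' (E y) := by
      rw [← sub_eq_zero, ← map_sub, ← map_sub, ← hbc]
      simp only [map_add, map_mul, h3, h2 p (π.br_self p), h3', mul_zero, add_zero]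
    rw [e]
    exact map_mem_pow E' h5' (map_mem_pow E h5 hy)
  rw [Ideal.Quotient.eq_zero_iff_mem]
  have e1 := Ideal.span_mono (show {q} ⊆ ({p, q} : Set P) by simp) (h4 a)
  have e2 := Ideal.span_mono (show {p} ⊆ ({p, q} : Set P) by simp) (h4' (E a))
  rw [hE] at e2
  have := Submodule.neg_mem _ (Ideal.add_mem _ e1 e2)
  convert this using 1; ring

end Bivector

/-! ### Slices of a complete local Poisson algebra and their uniqueness -/

/-- Darboux coordinates `p`, `q` of a local Poisson algebra, together with a slice: a Poisson
subalgebra `s : S → P` commuting with `p`, `q`, and a retraction `r` killing `p` and `q`. -/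
structure IsSlice {P : Type*} [CommRing P] [Algebra ℂ P] [IsLocalRing P] (π : Bivector P)
    (S : FormalPoissonGerm.{u}) {n : ℕ} (p q : Fin n → P) (s : S.carrier →ₐ[ℂ] P)
    (r : P →ₐ[ℂ] S.carrier) : Prop where
  br_p_p : ∀ i j, π.br (p i) (p j) = 0
  br_q_q : ∀ i j, π.br (q i) (q j) = 0
  br_p_q : ∀ i j, π.br (p i) (q j) = if i = j then 1 else 0
  br_p_s : ∀ i f, π.br (p i) (s f) = 0
  br_q_s : ∀ i f, π.br (q i) (s f) = 0
  br_s_s : ∀ f g, π.br (s f) (s g) = s (S.bivector.br f g)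
  r_s : ∀ f, r (s f) = f
  r_p : ∀ i, r (p i) = 0
  r_q : ∀ i, r (q i) = 0
  residue : ∀ x, ∃ c : ℂ, x - algebraMap ℂ P c ∈ IsLocalRing.maximalIdeal P
  -- Generation of the maximal ideal, together with the retraction, replaces the assertion that `P`
  -- is a completed product. Both are easy to carry through quotients and restrictions.
  maximalIdeal_le : IsLocalRing.maximalIdeal P
    ≤ Ideal.span (Set.range p ∪ Set.range q) ⊔ S.maxIdeal.map s

namespace IsSlice

variable {P : Type*} [CommRing P] [Algebra ℂ P] [IsLocalRing P] {π : Bivector P}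
  {S : FormalPoissonGerm.{u}} {n : ℕ}

lemma mem_maximalIdeal_of_r_eq_zero {r : P →ₐ[ℂ] S.carrier} {x : P} (h : r x = 0) :
    x ∈ IsLocalRing.maximalIdeal P := by
  rw [IsLocalRing.mem_maximalIdeal, mem_nonunits_iff]
  intro hx
  have := hx.map r
  rw [h] at this
  exact not_isUnit_zero this

/-- Transport of a slice along a Poisson isomorphism. -/
lemma map {p q : Fin n → P} {s : S.carrier →ₐ[ℂ] P} {r : P →ₐ[ℂ] S.carrier}
    (h : IsSlice π S p q s r) {P' : Type*} [CommRing P'] [Algebra ℂ P'] [IsLocalRing P']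
    {π' : Bivector P'} (e : P ≃ₐ[ℂ] P') (he : IsPoissonIso π π' e) :
    IsSlice π' S (fun i => e (p i)) (fun i => e (q i)) ((e : P →ₐ[ℂ] P').comp s)
      (r.comp (e.symm : P' →ₐ[ℂ] P)) := by
  have hM (x : P) : e x ∈ IsLocalRing.maximalIdeal P' ↔ x ∈ IsLocalRing.maximalIdeal P := by
    rw [IsLocalRing.mem_maximalIdeal, IsLocalRing.mem_maximalIdeal, mem_nonunits_iff,
      mem_nonunits_iff, MulEquiv.isUnit_map]
  constructor
  · intro i j; rw [← he, h.br_p_p, map_zero]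
  · intro i j; rw [← he, h.br_q_q, map_zero]
  · intro i j; rw [← he, h.br_p_q]; split_ifs <;> simp
  · intro i f; change π'.br (e (p i)) (e (s f)) = 0; rw [← he, h.br_p_s, map_zero]
  · intro i f; change π'.br (e (q i)) (e (s f)) = 0; rw [← he, h.br_q_s, map_zero]
  · intro f g; change π'.br (e (s f)) (e (s g)) = e (s _); rw [← he, h.br_s_s]
  · intro f; simp [h.r_s]
  · intro i; simp [h.r_p]
  · intro i; simp [h.r_q]
  · intro x
    obtain ⟨c, hc⟩ := h.residue (e.symm x)
    refine ⟨c, ?_⟩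
    rw [← hM, map_sub, AlgEquiv.apply_symm_apply, e.commutes] at hc
    exact hc
  · intro x hx
    obtain ⟨y, rfl⟩ := e.surjective x
    have hy := Ideal.mem_map_of_mem (e : P →ₐ[ℂ] P') (h.maximalIdeal_le ((hM y).1 hx))
    rw [Ideal.map_sup, Ideal.map_span, Set.image_union, ← Set.range_comp, ← Set.range_comp] at hy
    have e1 : Ideal.map (e : P →ₐ[ℂ] P') (Ideal.map s S.maxIdeal)
        = Ideal.map ((e : P →ₐ[ℂ] P').comp s) S.maxIdeal :=
      Ideal.map_map (s : S.carrier →+* P) ((e : P →ₐ[ℂ] P') : P →+* P')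
    rw [e1] at hy
    exact hy

/-- Dirac reduction by the first pair of Darboux coordinates. -/
lemma reduce {p q : Fin (n + 1) → P} {s : S.carrier →ₐ[ℂ] P} {r : P →ₐ[ℂ] S.carrier}
    (h : IsSlice π S p q s r) (h1 : 1 * π.br (p 0) (q 0) = 1)
    [IsLocalRing (P ⧸ Ideal.span {p 0, q 0})] :
    IsSlice (π.diracReduction h1) S (fun i => Ideal.Quotient.mk _ (p i.succ))
      (fun i => Ideal.Quotient.mk _ (q i.succ)) ((Ideal.Quotient.mkₐ ℂ _).comp s)
      (Ideal.Quotient.liftₐ _ r fun a ha => by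
        obtain ⟨b, c, rfl⟩ := Ideal.mem_span_pair.1 ha
        simp [h.r_p, h.r_q]) := by
  -- Everything that remains commutes with `p 0`, so all reduced brackets below are images of the
  -- original ones.
  have hpp (i : Fin n) : π.br (p 0) (p i.succ) = 0 := h.br_p_p _ _
  have hpq (i : Fin n) : π.br (p 0) (q i.succ) = 0 := by
    rw [h.br_p_q, if_neg (Fin.succ_ne_zero i).symm]
  have hps (f) : π.br (p 0) (s f) = 0 := h.br_p_s _ _
  have hM := map_mk_maximalIdeal (Ideal.span {p 0, q 0})
  constructor
  · intro i j
    rw [Bivector.diracReduction_mk_of_commute _ h1 (hpp i) (hpp j), h.br_p_p, map_zero]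
  · intro i j
    rw [Bivector.diracReduction_mk_of_commute _ h1 (hpq i) (hpq j), h.br_q_q, map_zero]
  · intro i j
    rw [Bivector.diracReduction_mk_of_commute _ h1 (hpp i) (hpq j), h.br_p_q]
    simp only [Fin.succ_inj]
    split_ifs <;> simp
  · intro i f
    change (π.diracReduction h1).br _ (Ideal.Quotient.mk _ (s f)) = 0
    rw [Bivector.diracReduction_mk_of_commute _ h1 (hpp i) (hps f), h.br_p_s, map_zero]
  · intro i f
    change (π.diracReduction h1).br _ (Ideal.Quotient.mk _ (s f)) = 0
    rw [Bivector.diracReduction_mk_of_commute _ h1 (hpq i) (hps f), h.br_q_s, map_zero]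
  · intro f g
    change (π.diracReduction h1).br (Ideal.Quotient.mk _ (s f)) (Ideal.Quotient.mk _ (s g))
      = Ideal.Quotient.mk _ (s _)
    rw [Bivector.diracReduction_mk_of_commute _ h1 (hps f) (hps g), h.br_s_s]
  · exact h.r_s
  · exact fun i => h.r_p _
  · exact fun i => h.r_q _
  · intro x
    obtain ⟨y, rfl⟩ := Ideal.Quotient.mk_surjective x
    obtain ⟨c, hc⟩ := h.residue y
    exact ⟨c, hM ▸ Ideal.mem_map_of_mem (Ideal.Quotient.mk _) hc⟩
  · rw [← hM]
    refine (Ideal.map_mono h.maximalIdeal_le).trans ?_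
    rw [Ideal.map_sup, Ideal.map_span]
    refine sup_le ?_ ?_
    · rw [Ideal.span_le]
      rintro _ ⟨x, hx, rfl⟩
      obtain ⟨i, rfl⟩ | ⟨i, rfl⟩ := hx <;> refine Fin.cases ?_ (fun i => ?_) i
      · rw [Ideal.Quotient.eq_zero_iff_mem.2 (Ideal.subset_span (by simp))]; exact zero_mem _
      · exact Ideal.mem_sup_left (Ideal.subset_span (Or.inl ⟨i, rfl⟩))
      · rw [Ideal.Quotient.eq_zero_iff_mem.2 (Ideal.subset_span (by simp))]; exact zero_mem _
      · exact Ideal.mem_sup_left (Ideal.subset_span (Or.inr ⟨i, rfl⟩))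
    · refine le_trans (le_of_eq ?_) le_sup_right
      exact Ideal.map_map (s : S.carrier →+* P) (Ideal.Quotient.mk (Ideal.span {p 0, q 0}))

variable [IsAdicComplete (IsLocalRing.maximalIdeal P) P]

/-- In the absence of Darboux coordinates the slice is the whole germ. -/
lemma surjective {p q : Fin 0 → P} {s : S.carrier →ₐ[ℂ] P} {r : P →ₐ[ℂ] S.carrier}
    (h : IsSlice π S p q s r) : Function.Surjective s := by
  set M := IsLocalRing.maximalIdeal P
  have hs : ∀ f ∈ S.maxIdeal, s f ∈ M := fun f hf => by
    rw [IsLocalRing.mem_maximalIdeal, mem_nonunits_iff]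
    intro hx
    have := hx.map r
    rw [h.r_s] at this
    exact hf this
  have hM : M = S.maxIdeal.map s := by
    refine le_antisymm ?_ (Ideal.map_le_iff_le_comap.2 hs)
    have := h.maximalIdeal_le
    simpa using this
  -- Coefficients in `P` may be replaced by their residues in `ℂ` at the cost of one power of `M`;
  -- hence each graded piece of `P` comes from `S`.
  have step (n : ℕ) : ∀ x ∈ M ^ n, ∃ f ∈ S.maxIdeal ^ n, x - s f ∈ M ^ (n + 1) := by
    intro x hx
    rw [hM, ← Ideal.map_pow] at hx
    induction hx using Submodule.span_induction with
    | mem x hx =>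
      obtain ⟨f, hf, rfl⟩ := hx
      exact ⟨f, hf, by simp⟩
    | zero => exact ⟨0, zero_mem _, by simp⟩
    | add x y _ _ hx hy =>
      obtain ⟨f, hf, hxf⟩ := hx
      obtain ⟨g, hg, hyg⟩ := hy
      refine ⟨f + g, add_mem hf hg, ?_⟩
      have := Ideal.add_mem _ hxf hyg
      rw [map_add]
      convert this using 1; ring
    | smul a x _ hx =>
      obtain ⟨f, hf, hxf⟩ := hx
      obtain ⟨c, hc⟩ := h.residue a
      refine ⟨c • f, Submodule.smul_of_tower_mem _ c hf, ?_⟩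
      have h1 := Ideal.mul_mem_left _ a hxf
      have h2 : (a - algebraMap ℂ P c) * s f ∈ M ^ (n + 1) := by
        rw [pow_succ']
        exact Ideal.mul_mem_mul hc (map_mem_pow s hs hf)
      have := Ideal.add_mem _ h1 h2
      rw [map_smul, Algebra.smul_def c, smul_eq_mul]
      convert this using 1; ring
  intro x
  have approx (n : ℕ) : ∃ f : S.carrier, x - s f ∈ M ^ n := by
    induction n with
    | zero => exact ⟨0, by simp⟩
    | succ n ih =>
      obtain ⟨f, hf⟩ := ih
      obtain ⟨g, -, hg'⟩ := step n _ hf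
      exact ⟨f + g, by rw [map_add, ← sub_sub]; exact hg'⟩
  have hr : ∀ y ∈ M, r y ∈ S.maxIdeal := by
    suffices M ≤ Ideal.comap r S.maxIdeal from this
    rw [hM, Ideal.map_le_iff_le_comap]
    intro f hf
    change r (s f) ∈ S.maxIdeal
    rwa [h.r_s]
  -- Since `r` is continuous, the limit of the approximations is known beforehand to be `s (r x)`,
  -- and no limit has to be formed in `S`.
  refine ⟨r x, eq_of_forall_sub_mem_pow (J := M) fun n => ?_⟩
  obtain ⟨f, hf⟩ := approx n
  have h1 := map_mem_pow s hs (map_mem_pow r hr hf)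
  rw [map_sub r, h.r_s, map_sub] at h1
  have := Ideal.sub_mem _ h1 hf
  convert this using 1; ring

end IsSlice

/-- Any two slices of a complete local Poisson algebra with the same number of Darboux coordinates
are Poisson isomorphic. -/
theorem IsSlice.exists_poissonIso {S : FormalPoissonGerm.{u}} {S' : FormalPoissonGerm.{v}} {n : ℕ} :
    ∀ {P : Type*} [CommRing P] [Algebra ℂ P] [IsLocalRing P]
      [IsAdicComplete (IsLocalRing.maximalIdeal P) P] {π : Bivector P} (_ : π.IsPoisson)
      {p q p' q' : Fin n → P} {s : S.carrier →ₐ[ℂ] P} {r : P →ₐ[ℂ] S.carrier}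
      {s' : S'.carrier →ₐ[ℂ] P} {r' : P →ₐ[ℂ] S'.carrier} (_ : IsSlice π S p q s r)
      (_ : IsSlice π S' p' q' s' r'),
      ∃ θ : S.carrier ≃ₐ[ℂ] S'.carrier, IsPoissonIso S.bivector S'.bivector θ := by
  induction n with
  | zero =>
    intro P _ _ _ _ π hπ p q p' q' s r s' r' h h'
    -- With no coordinates left, `s` and `s'` are isomorphisms onto `P` inverse to the retractions,
    -- and `S`, `S'` are compared through `P`.
    have hs (x) : s (r x) = x := by
      obtain ⟨f, rfl⟩ := h.surjective x; rw [h.r_s]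
    have hs' (x) : s' (r' x) = x := by
      obtain ⟨f, rfl⟩ := h'.surjective x; rw [h'.r_s]
    refine ⟨AlgEquiv.ofAlgHom (r'.comp s) (r.comp s') ?_ ?_, fun f g => ?_⟩
    · ext f; simp [hs, h'.r_s]
    · ext f; simp [hs', h.r_s]
    · simp only [AlgEquiv.ofAlgHom_apply, AlgHom.comp_apply]
      rw [← h.br_s_s, ← h'.r_s (S'.bivector.br _ _), ← h'.br_s_s, hs', hs']
  | succ n ih =>
    intro P _ _ _ _ π hπ p q p' q' s r s' r' h h'
    have h1 : 1 * π.br (p 0) (q 0) = 1 := by rw [h.br_p_q]; simp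
    have h1' : 1 * π.br (p' 0) (q' 0) = 1 := by rw [h'.br_p_q]; simp
    have hp := mem_maximalIdeal_of_r_eq_zero (h.r_p 0)
    have hq := mem_maximalIdeal_of_r_eq_zero (h.r_q 0)
    have hp' := mem_maximalIdeal_of_r_eq_zero (h'.r_p 0)
    have hq' := mem_maximalIdeal_of_r_eq_zero (h'.r_q 0)
    have hloc {a b : P} (ha : a ∈ IsLocalRing.maximalIdeal P)
        (hb : b ∈ IsLocalRing.maximalIdeal P) : IsLocalRing (P ⧸ Ideal.span {a, b}) := by
      have hle : Ideal.span {a, b} ≤ IsLocalRing.maximalIdeal P :=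
        Ideal.span_le.2 (by rintro x (rfl | rfl) <;> assumption)
      have : Nontrivial (P ⧸ Ideal.span {a, b}) :=
        Ideal.Quotient.nontrivial_iff.2 (ne_top_of_le_ne_top (Ideal.IsPrime.ne_top inferInstance) hle)
      exact .of_surjective' (Ideal.Quotient.mk _) Ideal.Quotient.mk_surjective
    have := hloc hp hq
    have := hloc hp' hq'
    obtain ⟨θ, hθ⟩ := Bivector.exists_diracReduction_equiv hπ h1 h1' hq hp hq' hp'
    have hc : IsAdicComplete (IsLocalRing.maximalIdeal (P ⧸ Ideal.span {p 0, q 0}))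
        (P ⧸ Ideal.span {p 0, q 0}) := by
      rw [← map_mk_maximalIdeal]
      have := Bivector.isHausdorff_diracReduction h1 hp hq
      have := isPrecomplete_quotient (J := IsLocalRing.maximalIdeal P) (Ideal.span {p 0, q 0})
      constructor
    -- The second slice reduces to a slice in the quotient by its own pair; `θ` brings it to the
    -- quotient by `p 0`, `q 0`, where the two can be compared.
    exact ih (hπ.diracReduction h1 hq) (h.reduce h1) ((h'.reduce h1').map θ.symm hθ.symm)

/-! ### Weight decompositions of a formal germ with a `ℂˣ`-action -/

/-- Approximate eigenvectors with distinct eigenvalues `2 ^ d` are independent. -/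
lemma mem_of_sum_mem_of_eigen {V : Type*} [AddCommGroup V] [Module ℂ V] (N : Submodule ℂ V)
    (φ : V →ₗ[ℂ] V) (hφ : ∀ x ∈ N, φ x ∈ N) (t : Finset ℤ) (c : ℤ → V)
    (hc : ∀ d ∈ t, φ (c d) - (2 : ℂ) ^ d • c d ∈ N) (hs : ∑ d ∈ t, c d ∈ N) :
    ∀ d ∈ t, c d ∈ N := by
  induction t using Finset.induction_on generalizing c with
  | empty => simp
  | insert a t ha ih =>
    have hpow {d : ℤ} (hd : d ∈ t) : (2 : ℂ) ^ d - 2 ^ a ≠ 0 := by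
      rw [sub_ne_zero]
      intro h
      have h' : (2 : ℝ) ^ d = 2 ^ a := by simpa [norm_zpow] using congrArg norm h
      rw [zpow_right_inj₀ (by norm_num) (by norm_num)] at h'
      exact ha (h' ▸ hd)
    have ht : ∀ d ∈ t, c d ∈ N := by
      -- Applying `φ - 2 ^ a` to the sum removes the term of index `a`, up to `N`, and multiplies
      -- the others by the nonzero numbers `2 ^ d - 2 ^ a`.
      have := ih (fun d => ((2 : ℂ) ^ d - 2 ^ a) • c d) (fun d hd => by
          have := N.smul_mem ((2 : ℂ) ^ d - 2 ^ a) (hc d (Finset.mem_insert_of_mem hd))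
          rw [map_smul, smul_comm, ← smul_sub]
          exact this) (by
        have h1 := N.sub_mem (hφ _ hs) (N.smul_mem ((2 : ℂ) ^ a) hs)
        have h2 := N.sum_mem hc
        have h3 := N.sub_mem h1 h2
        have e : φ (∑ d ∈ insert a t, c d) - (2 : ℂ) ^ a • ∑ d ∈ insert a t, c d
            - ∑ d ∈ insert a t, (φ (c d) - (2 : ℂ) ^ d • c d)
            = ∑ d ∈ t, ((2 : ℂ) ^ d - 2 ^ a) • c d := by
          rw [map_sum, Finset.smul_sum, ← Finset.sum_sub_distrib, ← Finset.sum_sub_distrib,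
            Finset.sum_insert ha]
          have (d : ℤ) : φ (c d) - (2 : ℂ) ^ a • c d - (φ (c d) - (2 : ℂ) ^ d • c d)
              = ((2 : ℂ) ^ d - 2 ^ a) • c d := by rw [sub_smul]; abel
          simp only [this]; simp
        rwa [e] at h3)
      intro d hd
      exact (N.smul_mem_iff (hpow hd)).1 (this d hd)
    intro d hd
    rcases Finset.mem_insert.1 hd with rfl | hd
    · rw [Finset.sum_insert ha] at hs
      exact (N.add_mem_iff_left (N.sum_mem ht)).1 hs
    · exact ht d hd

namespace FormalPoissonGerm

variable {S : FormalPoissonGerm.{u}}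

namespace CxAction

variable (ρ : S.CxAction)

lemma toHom_mem_pow (z : ℂˣ) {n : ℕ} {f : S.carrier} (hf : f ∈ S.maxIdeal ^ n) :
    ρ.toHom z f ∈ S.maxIdeal ^ n :=
  map_mem_pow (ρ.toHom z) (fun x hx => by
    rw [IsLocalRing.mem_maximalIdeal, mem_nonunits_iff] at *
    rwa [MulEquiv.isUnit_map]) hf

/-- Families of elements which have the prescribed weights modulo the `n`-th power of the maximal
ideal. -/
def families (n : ℕ) : Submodule ℂ (ℤ →₀ S.carrier) where
  carrier := {c | ∀ (d : ℤ) (z : ℂˣ), ρ.toHom z (c d) - ((z ^ d : ℂˣ) : ℂ) • c d ∈ S.maxIdeal ^ n}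
  zero_mem' d z := by simp
  add_mem' {a b} ha hb d z := by
    have := Ideal.add_mem _ (ha d z) (hb d z)
    rw [Finsupp.add_apply, map_add, smul_add]
    convert this using 1; ring
  smul_mem' r a ha d z := by
    have := Submodule.smul_of_tower_mem (S.maxIdeal ^ n) r (ha d z)
    rw [Finsupp.smul_apply, map_smul, smul_comm _ r, ← smul_sub]
    exact this

lemma families_mono {m n : ℕ} (h : m ≤ n) : ρ.families n ≤ ρ.families m :=
  fun _ hc d z => Ideal.pow_le_pow_right h (hc d z)

/-- The sum of a family. -/
noncomputable def total : (ℤ →₀ S.carrier) →ₗ[ℂ] S.carrier := Finsupp.lsum ℂ fun _ => LinearMap.id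

/-- The single element `2` of `ℂˣ` separates all weights. This is uniqueness of approximate weight
decompositions: a family whose sum is small has small members. -/
lemma mem_of_total_mem {n : ℕ} {c : ℤ →₀ S.carrier} (hc : c ∈ ρ.families n)
    (h : total c ∈ S.maxIdeal ^ n) (d : ℤ) : c d ∈ S.maxIdeal ^ n := by
  by_cases hd : d ∈ c.support
  · refine mem_of_sum_mem_of_eigen ((S.maxIdeal ^ n).restrictScalars ℂ)
      (ρ.toHom (Units.mk0 2 two_ne_zero)).toLinearMap
      (fun x hx => ρ.toHom_mem_pow _ hx) c.support c (fun d _ => ?_) h d hd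
    simpa using hc d (Units.mk0 2 two_ne_zero)
  · rw [Finsupp.notMem_support_iff.1 hd]; exact zero_mem _

lemma exists_family (n : ℕ) (f : S.carrier) :
    ∃ c ∈ ρ.families n, f - total c ∈ S.maxIdeal ^ n := by
  obtain ⟨c, h1, h2⟩ := ρ.algebraic n f
  exact ⟨c, h1, h2⟩

variable {R : Type v} [CommRing R] [Algebra ℂ R] {K : Ideal R}

/-- The sum of the images of a family under `s`, with coefficients `a`. -/
noncomputable def combine (s : S.carrier →ₐ[ℂ] R) (a : ℤ → R) : (ℤ →₀ S.carrier) →ₗ[ℂ] R :=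
  Finsupp.lsum ℂ fun d => LinearMap.mulLeft ℂ (a d) ∘ₗ s.toLinearMap

lemma combine_apply (s : S.carrier →ₐ[ℂ] R) (a : ℤ → R) (c : ℤ →₀ S.carrier) :
    combine s a c = ∑ d ∈ c.support, a d * s (c d) := rfl

lemma combine_single (s : S.carrier →ₐ[ℂ] R) (a : ℤ → R) (d : ℤ) (f : S.carrier) :
    combine s a (Finsupp.single d f) = a d * s f := by
  simp [combine]

lemma total_single (d : ℤ) (f : S.carrier) : total (Finsupp.single d f) = f := by
  simp [total]

lemma combine_mem {s : S.carrier →ₐ[ℂ] R} (hs : ∀ f ∈ S.maxIdeal, s f ∈ K) (a : ℤ → R) {n : ℕ}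
    {c : ℤ →₀ S.carrier} (hc : c ∈ ρ.families n) (h : total c ∈ S.maxIdeal ^ n) :
    combine s a c ∈ K ^ n := by
  rw [combine_apply]
  exact Ideal.sum_mem _ fun d _ => Ideal.mul_mem_left _ _
    (map_mem_pow s hs (ρ.mem_of_total_mem hc h d))

/-- The linear map multiplying weight vectors of weight `d` by `a d`. -/
theorem exists_weightMap [IsAdicComplete K R] {s : S.carrier →ₐ[ℂ] R}
    (hs : ∀ f ∈ S.maxIdeal, s f ∈ K) (a : ℤ → R) :
    ∃ L : S.carrier →ₗ[ℂ] R, ∀ n f, ∀ c ∈ ρ.families n, f - total c ∈ S.maxIdeal ^ n →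
      L f - combine s a c ∈ K ^ n := by
  choose c hc hct using ρ.exists_family
  -- Two families approximating the same function differ by one with small total, hence with small
  -- members. So the values do not depend on the chosen families, and those for successive `n` form
  -- a Cauchy sequence.
  have key {n : ℕ} {c₁ c₂ : ℤ →₀ S.carrier} (h₁ : c₁ ∈ ρ.families n) (h₂ : c₂ ∈ ρ.families n)
      {f : S.carrier} (ht₁ : f - total c₁ ∈ S.maxIdeal ^ n) (ht₂ : f - total c₂ ∈ S.maxIdeal ^ n) :
      combine s a c₁ - combine s a c₂ ∈ K ^ n := by
    rw [← map_sub]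
    refine ρ.combine_mem hs a (sub_mem h₁ h₂) ?_
    have := sub_mem ht₂ ht₁
    rwa [sub_sub_sub_cancel_left, ← map_sub] at this
  choose L hL using fun f => exists_adic_limit (J := K) (fun n => combine s a (c n f))
    (fun n => key (ρ.families_mono (Nat.le_succ n) (hc _ f)) (hc n f)
      (Ideal.pow_le_pow_right (Nat.le_succ n) (hct _ f)) (hct n f))
  have hL' (n : ℕ) (f : S.carrier) (c' : ℤ →₀ S.carrier) (hc' : c' ∈ ρ.families n)
      (h : f - total c' ∈ S.maxIdeal ^ n) : L f - combine s a c' ∈ K ^ n := by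
    have := add_mem (hL f n) (key (hc n f) hc' (hct n f) h)
    rwa [sub_add_sub_cancel] at this
  refine ⟨{ toFun := L
            map_add' := fun f g => eq_of_forall_sub_mem_pow (J := K) fun n => ?_
            map_smul' := fun r f => eq_of_forall_sub_mem_pow (J := K) fun n => ?_ }, hL'⟩
  · have h1 := hL' n (f + g) (c n f + c n g) (add_mem (hc n f) (hc n g)) (by
      have := add_mem (hct n f) (hct n g)
      rw [map_add]; convert this using 1; ring)
    have h2 := add_mem (hL f n) (hL g n)
    have := sub_mem h1 h2
    rw [map_add] at this
    convert this using 1; ring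
  · have h1 := hL' n (r • f) (r • c n f) (Submodule.smul_mem _ r (hc n f)) (by
      have := Submodule.smul_of_tower_mem _ r (hct n f)
      rwa [map_smul, ← smul_sub])
    have h2 := Submodule.smul_of_tower_mem _ r (hL f n)
    have := sub_mem h1 h2
    rw [map_smul, smul_sub, sub_sub_sub_cancel_right] at this
    exact this

lemma single_mem_families {d : ℤ} {f : S.carrier} (hf : f ∈ ρ.weight d) (n : ℕ) :
    Finsupp.single d f ∈ ρ.families n := by
  intro e z
  by_cases h : e = d
  · subst h; simp [hf z]
  · simp [Finsupp.single_eq_of_ne h]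

lemma weightMap_apply [IsHausdorff K R] {s : S.carrier →ₐ[ℂ] R} {a : ℤ → R}
    {L : S.carrier →ₗ[ℂ] R} (hL : ∀ n f, ∀ c ∈ ρ.families n, f - total c ∈ S.maxIdeal ^ n →
      L f - combine s a c ∈ K ^ n) {d : ℤ} {f : S.carrier} (hf : f ∈ ρ.weight d) :
    L f = a d * s f :=
  eq_of_forall_sub_mem_pow (J := K) fun n => by
    have := hL n f _ (ρ.single_mem_families hf n) (by rw [total_single, sub_self]; exact zero_mem _)
    rwa [combine_single] at this

/-- The zero family already approximates an element of the `n`-th power to order `n`. -/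
lemma weightMap_mem_pow {s : S.carrier →ₐ[ℂ] R} {a : ℤ → R}
    {L : S.carrier →ₗ[ℂ] R} (hL : ∀ n f, ∀ c ∈ ρ.families n, f - total c ∈ S.maxIdeal ^ n →
      L f - combine s a c ∈ K ^ n) {n : ℕ} {f : S.carrier} (hf : f ∈ S.maxIdeal ^ n) :
    L f ∈ K ^ n := by
  simpa using hL n f 0 (zero_mem _) (by simpa using hf)

/-- The weight components of an element. -/
lemma exists_components (n : ℕ) (f : S.carrier) : ∃ c : ℤ →₀ S.carrier,
    (∀ d, c d ∈ ρ.weight d) ∧ f - ∑ d ∈ c.support, c d ∈ S.maxIdeal ^ n := by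
  classical
  have hid : ∀ f ∈ S.maxIdeal, AlgHom.id ℂ S.carrier f ∈ S.maxIdeal := fun f hf => hf
  -- With the indicator of `d` as coefficients the weight map is the projection to weight `d`; it
  -- replaces approximate components by exact weight vectors.
  choose L hL using fun d : ℤ =>
    ρ.exists_weightMap hid (fun e => if e = d then (1 : S.carrier) else 0)
  have hcomb (d : ℤ) (c : ℤ →₀ S.carrier) :
      combine (AlgHom.id ℂ S.carrier) (fun e => if e = d then (1 : S.carrier) else 0) c = c d := by
    rw [combine_apply]
    simp only [AlgHom.id_apply, ite_mul, one_mul, zero_mul, Finset.sum_ite_eq']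
    split_ifs with h
    · rfl
    · exact (Finsupp.notMem_support_iff.1 h).symm
  have hLc {n : ℕ} {f : S.carrier} {c : ℤ →₀ S.carrier} (hc : c ∈ ρ.families n)
      (h : f - total c ∈ S.maxIdeal ^ n) (d : ℤ) : L d f - c d ∈ S.maxIdeal ^ n := by
    have := hL d n f c hc h
    rwa [hcomb] at this
  have hw (d : ℤ) (f : S.carrier) : L d f ∈ ρ.weight d := fun z =>
    eq_of_forall_sub_mem_pow (J := S.maxIdeal) fun n => by
      obtain ⟨c, hc, hct⟩ := ρ.exists_family n f
      have h1 := hLc hc hct d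
      have h2 := ρ.toHom_mem_pow z h1
      have h3 := Submodule.smul_of_tower_mem _ ((z ^ d : ℂˣ) : ℂ) h1
      have := sub_mem (add_mem h2 (hc d z)) h3
      rw [map_sub, smul_sub] at this
      convert this using 1; ring
  obtain ⟨c, hc, hct⟩ := ρ.exists_family n f
  refine ⟨Finsupp.onFinset c.support (fun d => if d ∈ c.support then L d f else 0)
    (fun d h => by by_contra hd; simp [hd] at h), fun d => ?_, ?_⟩
  · rw [Finsupp.onFinset_apply]
    split_ifs
    · exact hw d f
    · intro z; simp
  · have e : ∑ d ∈ (Finsupp.onFinset c.support (fun d => if d ∈ c.support then L d f else 0)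
        (fun d h => by by_contra hd; simp [hd] at h)).support,
        (Finsupp.onFinset c.support (fun d => if d ∈ c.support then L d f else 0)
        (fun d h => by by_contra hd; simp [hd] at h)) d = ∑ d ∈ c.support, L d f := by
      rw [Finset.sum_subset Finsupp.support_onFinset_subset
        (fun x _ hx => Finsupp.notMem_support_iff.1 hx)]
      refine Finset.sum_congr rfl fun d hd => ?_
      rw [Finsupp.onFinset_apply, if_pos hd]
    rw [e]
    have h1 : ∑ d ∈ c.support, (L d f - c d) ∈ S.maxIdeal ^ n :=
      Ideal.sum_mem _ fun d _ => hLc hc hct d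
    rw [Finset.sum_sub_distrib] at h1
    have := sub_mem hct h1
    have e2 : total c = ∑ d ∈ c.support, c d := rfl
    rw [e2] at this
    convert this using 1; ring

/-- The set of all weight vectors. -/
def weightVectors : Set S.carrier := ⋃ d, ρ.weight d

lemma adicDense_span_weightVectors :
    AdicDense S.maxIdeal (Submodule.span ℂ ρ.weightVectors : Set S.carrier) := fun f n => by
  obtain ⟨c, hc, h⟩ := ρ.exists_components n f
  exact ⟨_, Submodule.sum_mem _ fun d _ => Submodule.subset_span (Set.mem_iUnion.2 ⟨d, hc d⟩), h⟩

/-- Linear combinations of weight vectors are dense. The number `c` bounds the loss of adic order,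
which is positive as soon as derivations or brackets are involved. -/
lemma linearMap_ext [IsHausdorff K R] (f g : S.carrier →ₗ[ℂ] R) (c : ℕ)
    (hf : ∀ n, ∀ x ∈ S.maxIdeal ^ (n + c), f x ∈ K ^ n)
    (hg : ∀ n, ∀ x ∈ S.maxIdeal ^ (n + c), g x ∈ K ^ n)
    (h : ∀ d, ∀ x ∈ ρ.weight d, f x = g x) (x : S.carrier) : f x = g x :=
  eq_of_adicDense f g ρ.adicDense_span_weightVectors c hf hg
    (fun x hx => LinearMap.eqOn_span (s := ρ.weightVectors) (fun x hx => by
      obtain ⟨d, hd⟩ := Set.mem_iUnion.1 hx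
      exact h d x hd) hx) x

lemma mul_mem_weight {i j : ℤ} {f g : S.carrier} (hf : f ∈ ρ.weight i) (hg : g ∈ ρ.weight j) :
    f * g ∈ ρ.weight (i + j) := fun z => by
  rw [map_mul, hf z, hg z, smul_mul_smul_comm, zpow_add, Units.val_mul]

lemma one_mem_weight : (1 : S.carrier) ∈ ρ.weight 0 := fun z => by simp

lemma br_mem_weight {k : ℤ} (hρ : ρ.HomogeneousOfDegree (-k)) {i j : ℤ} {f g : S.carrier}
    (hf : f ∈ ρ.weight i) (hg : g ∈ ρ.weight j) : S.bivector.br f g ∈ ρ.weight (i + j - k) :=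
  fun z => by
    rw [hρ, hf z, hg z, map_smul, map_smul, LinearMap.smul_apply, smul_smul, smul_smul,
      ← Units.val_mul, ← Units.val_mul, ← zpow_add, ← zpow_add]
    congr 3; ring

/-- The homomorphism multiplying functions of weight `d` by `t ^ d`. -/
theorem exists_twist [IsAdicComplete K R] {s : S.carrier →ₐ[ℂ] R}
    (hs : ∀ f ∈ S.maxIdeal, s f ∈ K) (t : Rˣ) :
    ∃ σ : S.carrier →ₐ[ℂ] R, (∀ f ∈ S.maxIdeal, σ f ∈ K) ∧
      ∀ d, ∀ f ∈ ρ.weight d, σ f = ((t ^ d : Rˣ) : R) * s f := by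
  obtain ⟨L, hL⟩ := ρ.exists_weightMap hs (fun d => ((t ^ d : Rˣ) : R))
  have hw (d) (f) (hf : f ∈ ρ.weight d) : L f = ((t ^ d : Rˣ) : R) * s f := ρ.weightMap_apply hL hf
  have hLn (n) (f) (hf : f ∈ S.maxIdeal ^ n) : L f ∈ K ^ n := ρ.weightMap_mem_pow hL hf
  -- Tested on weight vectors in one argument after the other, where it amounts to `t ^ (i + j) = t
  -- ^ i t ^ j`.
  have hmul (f g : S.carrier) : L (f * g) = L f * L g := by
    refine ρ.linearMap_ext (K := K) (L ∘ₗ LinearMap.mulRight ℂ g) (LinearMap.mulRight ℂ (L g) ∘ₗ L) 0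
      (fun n x hx => hLn _ _ (Ideal.mul_mem_right _ _ hx))
      (fun n x hx => Ideal.mul_mem_right _ _ (hLn _ _ hx)) (fun i f hf => ?_) f
    refine ρ.linearMap_ext (K := K) (L ∘ₗ LinearMap.mulLeft ℂ f) (LinearMap.mulLeft ℂ (L f) ∘ₗ L) 0
      (fun n x hx => hLn _ _ (Ideal.mul_mem_left _ _ hx))
      (fun n x hx => Ideal.mul_mem_left _ _ (hLn _ _ hx)) (fun j g hg => ?_) g
    change L (f * g) = L f * L g
    rw [hw _ _ (ρ.mul_mem_weight hf hg), hw _ _ hf, hw _ _ hg, zpow_add, Units.val_mul, map_mul]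
    ring
  have h1 : L 1 = 1 := by rw [hw _ _ ρ.one_mem_weight]; simp
  refine ⟨AlgHom.ofLinearMap L h1 hmul, fun f hf => ?_, hw⟩
  simpa using hLn 1 f (by simpa using hf)

/-- The Euler vector field of the action. -/
theorem exists_euler : ∃ eu : Derivation ℂ S.carrier S.carrier,
    ∀ d, ∀ f ∈ ρ.weight d, eu f = (d : ℂ) • f := by
  have hid : ∀ f ∈ S.maxIdeal, AlgHom.id ℂ S.carrier f ∈ S.maxIdeal := fun f hf => hf
  obtain ⟨L, hL⟩ := ρ.exists_weightMap hid (fun d => algebraMap ℂ S.carrier d)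
  have hw (d) (f) (hf : f ∈ ρ.weight d) : L f = (d : ℂ) • f := by
    rw [ρ.weightMap_apply hL hf, Algebra.smul_def]; rfl
  have hLn (n) (f) (hf : f ∈ S.maxIdeal ^ n) : L f ∈ S.maxIdeal ^ n := ρ.weightMap_mem_pow hL hf
  have hmul (f g : S.carrier) : L (f * g) = f * L g + g * L f := by
    refine ρ.linearMap_ext (K := S.maxIdeal) (L ∘ₗ LinearMap.mulRight ℂ g)
      (LinearMap.mulRight ℂ (L g) + LinearMap.mulLeft ℂ g ∘ₗ L) 0
      (fun n x hx => hLn _ _ (Ideal.mul_mem_right _ _ hx))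
      (fun n x hx => Ideal.add_mem _ (Ideal.mul_mem_right _ _ hx)
        (Ideal.mul_mem_left _ _ (hLn _ _ hx))) (fun i f hf => ?_) f
    refine ρ.linearMap_ext (K := S.maxIdeal) (L ∘ₗ LinearMap.mulLeft ℂ f)
      (LinearMap.mulLeft ℂ f ∘ₗ L + LinearMap.mulRight ℂ (L f)) 0
      (fun n x hx => hLn _ _ (Ideal.mul_mem_left _ _ hx))
      (fun n x hx => Ideal.add_mem _ (Ideal.mul_mem_left _ _ (hLn _ _ hx))
        (Ideal.mul_mem_right _ _ hx)) (fun j g hg => ?_) g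
    change L (f * g) = f * L g + g * L f
    rw [hw _ _ (ρ.mul_mem_weight hf hg), hw _ _ hf, hw _ _ hg]
    simp only [Algebra.smul_def]
    push_cast [map_add]
    ring
  exact ⟨Derivation.mk' L hmul, hw⟩

/-- The Euler vector field rescales a homogeneous Poisson structure. -/
lemma euler_br {k : ℤ} (hρ : ρ.HomogeneousOfDegree (-k)) {eu : Derivation ℂ S.carrier S.carrier}
    (heu : ∀ d, ∀ f ∈ ρ.weight d, eu f = (d : ℂ) • f) (f g : S.carrier) :
    eu (S.bivector.br f g)
      = S.bivector.br (eu f) g + S.bivector.br f (eu g) - (k : ℂ) • S.bivector.br f g := by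
  set B := S.bivector with hB
  have hD {n : ℕ} {x : S.carrier} (hx : x ∈ S.maxIdeal ^ (n + 1)) : eu x ∈ S.maxIdeal ^ n :=
    derivation_mem_pow eu hx
  have low {n : ℕ} {x : S.carrier} (hx : x ∈ S.maxIdeal ^ (n + 1)) : x ∈ S.maxIdeal ^ n :=
    Ideal.pow_le_pow_right (Nat.le_succ n) hx
  have hBr {n : ℕ} (y : S.carrier) {x : S.carrier} (hx : x ∈ S.maxIdeal ^ (n + 1)) :
      B.br y x ∈ S.maxIdeal ^ n := B.br_mem_pow _ n y x hx
  have key (f : S.carrier) (h : ∀ j, ∀ g ∈ ρ.weight j,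
      eu (B.br f g) = B.br (eu f) g + B.br f (eu g) - (k : ℂ) • B.br f g) (g : S.carrier) :
      eu (B.br f g) = B.br (eu f) g + B.br f (eu g) - (k : ℂ) • B.br f g :=
    -- Two orders are lost, one by the bracket and one by the derivation.
    ρ.linearMap_ext (K := S.maxIdeal) (eu.toLinearMap ∘ₗ B.br f)
      (B.br (eu f) + B.br f ∘ₗ eu.toLinearMap - (k : ℂ) • B.br f) 2
      (fun n x hx => hD (hBr _ hx))
      (fun n x hx => sub_mem (add_mem (hBr _ (low hx)) (hBr _ (hD hx)))
        (Submodule.smul_of_tower_mem _ _ (hBr _ (low hx)))) h g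
  refine key f (fun j g hg => ?_) g
  -- By skew-symmetry the same extension step serves the other argument. For two weight vectors the
  -- claim says that the bracket has weight `i + j - k`.
  have h2 := key g (fun i f hf => ?_) f
  · rw [B.skew f g, B.skew (eu f), B.skew f, map_neg, h2, smul_neg]; ring
  · rw [heu _ _ (ρ.br_mem_weight hρ hg hf), heu _ _ hf, heu _ _ hg, map_smul, map_smul,
      LinearMap.smul_apply, ← add_smul, ← sub_smul]
    push_cast; rfl

end CxAction

/-- Every element is the sum of a constant and a function vanishing at the closed point. -/
lemma exists_sub_algebraMap_mem (S : FormalPoissonGerm.{u}) (f : S.carrier) :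
    ∃ c : ℂ, f - algebraMap ℂ S.carrier c ∈ S.maxIdeal := by
  obtain ⟨c, hc⟩ := S.residue_surjective (IsLocalRing.residue S.carrier f)
  refine ⟨c, ?_⟩
  rw [← Ideal.Quotient.eq]
  exact hc.symm

/-- The Euler vector field differs from `-ξ` by a Hamiltonian vector field. -/
theorem exists_hamiltonian {k : ℤ} {ρ : S.CxAction} (hρ : ρ.HomogeneousOfDegree (-k))
    (hS : S.PoissonFieldsHamiltonian) (ξ : Derivation ℂ S.carrier S.carrier)
    (hξ : ∀ f g, ξ (S.bivector.br f g) - S.bivector.br (ξ f) g - S.bivector.br f (ξ g)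
      = (k : ℂ) • S.bivector.br f g) :
    ∃ h ∈ S.maxIdeal, ∀ d, ∀ f ∈ ρ.weight d, (d : ℂ) • f + ξ f = S.bivector.br h f := by
  obtain ⟨eu, heu⟩ := ρ.exists_euler
  -- The rescalings of the bracket by `-k` and by `k` cancel.
  obtain ⟨h, hh⟩ := hS (eu + ξ) (fun a b => by
    have h1 := ρ.euler_br hρ heu a b
    have h2 := hξ a b
    simp only [Derivation.add_apply, map_add, LinearMap.add_apply]
    linear_combination h1 + h2)
  -- Subtracting a constant does not change the Hamiltonian field, and puts `h` in the maximal ideal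
  -- so that it can serve as the time of a flow.
  obtain ⟨c, hc⟩ := S.exists_sub_algebraMap_mem h
  refine ⟨_, hc, fun d f hf => ?_⟩
  rw [map_sub, LinearMap.sub_apply, Bivector.algebraMap_br, sub_zero, ← hh, ← heu d f hf]; rfl

end FormalPoissonGerm

/-- Power series in finitely many variables are the completion of the polynomials at the ideal of
the variables, and the first truncation there has kernel generated by that ideal. -/
lemma MvPowerSeries.mem_span_range_X {σ : Type*} [Finite σ] {R : Type*} [CommRing R]
    {f : MvPowerSeries σ R} (hf : MvPowerSeries.constantCoeff f = 0) :
    f ∈ Ideal.span (Set.range (MvPowerSeries.X : σ → MvPowerSeries σ R)) := by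
  set I := MvPolynomial.idealOfVars σ R
  set E := MvPowerSeries.toAdicCompletionAlgEquiv σ R
  have hval : AdicCompletion.evalₐ I 1 (E f) = 0 := by
    have h1 : AdicCompletion.evalₐ I 1 (E f)
        = Ideal.Quotient.mk (I ^ 1) (MvPowerSeries.truncTotal 1 f) := by
      rw [← AdicCompletion.factor_eval_eq_evalₐ I (E f) (by simp)]
      rfl
    rw [h1, Ideal.Quotient.eq_zero_iff_mem, MvPolynomial.mem_pow_idealOfVars_iff']
    intro x hx
    rw [MvPowerSeries.coeff_truncTotal _ hx]
    obtain rfl : x = 0 := (Finsupp.degree_eq_zero_iff x).1 (by omega)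
    simpa using hf
  rw [evalₐ_eq_zero_iff (MvPolynomial.idealOfVars_fg σ R), pow_one] at hval
  have h2 : idealOfDefinition I
      = (Ideal.span (Set.range (MvPowerSeries.X : σ → MvPowerSeries σ R))).map E := by
    rw [idealOfDefinition, Ideal.map_span, Ideal.map_span, ← Set.range_comp, ← Set.range_comp]
    congr 2
    ext1 i
    simp only [Function.comp_apply]
    rw [← MvPolynomial.coe_X]
    exact (MvPowerSeries.toAdicCompletion_coe _).symm
  rw [h2] at hval
  obtain ⟨g, hg, hgf⟩ := (Ideal.mem_map_of_equiv E _).1 hval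
  rwa [← E.injective hgf]

/-! ### Completed products -/

section Tensor

variable {O : Type u} [CommRing O] [Algebra ℂ O] {A : Type v} [CommRing A] [Algebra ℂ A]
  (𝔞 : Ideal O) (𝔪 : Ideal A)

namespace CompletedTensor

/-- Pullback along the first projection, as an algebra homomorphism. -/
noncomputable def fstHom : O →ₐ[ℂ] CompletedTensor 𝔞 𝔪 :=
  (AdicCompletion.ofAlgHom' (tensorIdeal 𝔞 𝔪)).comp Algebra.TensorProduct.includeLeft

/-- Pullback along the second projection, as an algebra homomorphism. -/
noncomputable def sndHom : A →ₐ[ℂ] CompletedTensor 𝔞 𝔪 :=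
  (AdicCompletion.ofAlgHom' (tensorIdeal 𝔞 𝔪)).comp Algebra.TensorProduct.includeRight

lemma of_tmul (a : O) (f : A) : AdicCompletion.of (tensorIdeal 𝔞 𝔪) (O ⊗[ℂ] A) (a ⊗ₜ f)
    = fstHom 𝔞 𝔪 a * sndHom 𝔞 𝔪 f := by
  have : a ⊗ₜ[ℂ] f = (a ⊗ₜ 1) * (1 ⊗ₜ f) := by simp
  rw [this, ← AdicCompletion.ofAlgHom'_apply, map_mul]; rfl

/-- The ideal of definition of the completed product. -/
noncomputable abbrev ideal : Ideal (CompletedTensor 𝔞 𝔪) := idealOfDefinition (tensorIdeal 𝔞 𝔪)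

variable {𝔞 𝔪}

lemma fstHom_mem {a : O} (ha : a ∈ 𝔞) : fstHom 𝔞 𝔪 a ∈ ideal 𝔞 𝔪 :=
  of_mem_idealOfDefinition (Ideal.mem_sup_left (Ideal.mem_map_of_mem _ ha))

lemma sndHom_mem {f : A} (hf : f ∈ 𝔪) : sndHom 𝔞 𝔪 f ∈ ideal 𝔞 𝔪 :=
  of_mem_idealOfDefinition (Ideal.mem_sup_right (Ideal.mem_map_of_mem _ hf))

lemma tensorIdeal_fg (ha : 𝔞.FG) (hm : 𝔪.FG) : (tensorIdeal 𝔞 𝔪).FG :=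
  Submodule.FG.sup (ha.map _) (hm.map _)

lemma ideal_le {I : Ideal (CompletedTensor 𝔞 𝔪)} (h1 : ∀ a ∈ 𝔞, fstHom 𝔞 𝔪 a ∈ I)
    (h2 : ∀ f ∈ 𝔪, sndHom 𝔞 𝔪 f ∈ I) : ideal 𝔞 𝔪 ≤ I := by
  rw [ideal, idealOfDefinition, Ideal.map_le_iff_le_comap, sup_le_iff, Ideal.map_le_iff_le_comap,
    Ideal.map_le_iff_le_comap]
  exact ⟨h1, h2⟩

lemma isAdicComplete (ha : 𝔞.FG) (hm : 𝔪.FG) :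
    IsAdicComplete (ideal 𝔞 𝔪) (CompletedTensor 𝔞 𝔪) :=
  isAdicComplete_idealOfDefinition (tensorIdeal_fg ha hm)

/-- Universal property of the completed product. -/
theorem exists_lift {R : Type*} [CommRing R] [Algebra ℂ R] {K : Ideal R} [IsAdicComplete K R]
    (g₁ : O →ₐ[ℂ] R) (g₂ : A →ₐ[ℂ] R) (h₁ : ∀ a ∈ 𝔞, g₁ a ∈ K) (h₂ : ∀ f ∈ 𝔪, g₂ f ∈ K) :
    ∃ G : CompletedTensor 𝔞 𝔪 →ₐ[ℂ] R, (∀ a, G (fstHom 𝔞 𝔪 a) = g₁ a) ∧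
      (∀ f, G (sndHom 𝔞 𝔪 f) = g₂ f) ∧ ∀ x ∈ ideal 𝔞 𝔪, G x ∈ K := by
  have hg : ∀ x ∈ tensorIdeal 𝔞 𝔪, Algebra.TensorProduct.productMap g₁ g₂ x ∈ K := by
    have : tensorIdeal 𝔞 𝔪 ≤ Ideal.comap (Algebra.TensorProduct.productMap g₁ g₂) K := by
      rw [sup_le_iff, Ideal.map_le_iff_le_comap, Ideal.map_le_iff_le_comap]
      exact ⟨fun a ha => by simpa using h₁ a ha, fun a ha => by simpa using h₂ a ha⟩
    exact this
  obtain ⟨G, hG⟩ := exists_lift_completion (Algebra.TensorProduct.productMap g₁ g₂) hg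
  refine ⟨G, fun a => ?_, fun f => ?_, map_idealOfDefinition_mem G fun a ha => ?_⟩
  · exact (hG _).trans (by simp)
  · exact (hG _).trans (by simp)
  · rw [hG]; exact hg a ha

/-- A subalgebra containing both sets pulls back to dense subalgebras of the factors. Products of
approximations then approximate pure tensors, whose sums are dense. -/
lemma topGenerates (ha : 𝔞.FG) (hm : 𝔪.FG) {G₁ : Set O} {G₂ : Set A} (h₁ : TopGenerates 𝔞 G₁)
    (h₂ : TopGenerates 𝔪 G₂) :
    TopGenerates (ideal 𝔞 𝔪) (fstHom 𝔞 𝔪 '' G₁ ∪ sndHom 𝔞 𝔪 '' G₂) := by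
  intro 𝒮 h𝒮 hinv
  have hd₁ := h₁ (𝒮.comap (fstHom 𝔞 𝔪)) (fun x hx => h𝒮 (Or.inl ⟨x, hx, rfl⟩))
    (fun x hx y hxy => hinv _ hx _ (by rw [← map_mul, hxy, map_one]))
  have hd₂ := h₂ (𝒮.comap (sndHom 𝔞 𝔪)) (fun x hx => h𝒮 (Or.inr ⟨x, hx, rfl⟩))
    (fun x hx y hxy => hinv _ hx _ (by rw [← map_mul, hxy, map_one]))
  have key (n : ℕ) (x : O ⊗[ℂ] A) :
      ∃ y ∈ 𝒮, AdicCompletion.of (tensorIdeal 𝔞 𝔪) (O ⊗[ℂ] A) x - y ∈ ideal 𝔞 𝔪 ^ n := by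
    induction x with
    | zero => exact ⟨0, zero_mem _, by simp⟩
    | add x x' h h' =>
      obtain ⟨y, hy, hxy⟩ := h
      obtain ⟨y', hy', hxy'⟩ := h'
      refine ⟨y + y', add_mem hy hy', ?_⟩
      have := add_mem hxy hxy'
      rw [map_add]
      convert this using 1; ring
    | tmul a f =>
      obtain ⟨a', ha', haa⟩ := hd₁ a n
      obtain ⟨f', hf', hff⟩ := hd₂ f n
      refine ⟨_, mul_mem ha' hf', ?_⟩
      rw [of_tmul]
      have h1 := map_mem_pow (fstHom 𝔞 𝔪) (fun _ h => fstHom_mem h) haa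
      have h2 := map_mem_pow (sndHom 𝔞 𝔪) (fun _ h => sndHom_mem h) hff
      rw [map_sub] at h1 h2
      have := add_mem (Ideal.mul_mem_left _ (fstHom 𝔞 𝔪 a) h2)
        (Ideal.mul_mem_left _ (sndHom 𝔞 𝔪 f') h1)
      convert this using 1
      change _ - fstHom 𝔞 𝔪 a' * sndHom 𝔞 𝔪 f' = _
      ring
  intro x n
  obtain ⟨_, ⟨x', rfl⟩, hx⟩ := adicDense_range_of (tensorIdeal_fg ha hm) x n
  obtain ⟨y, hy, hxy⟩ := key n x'
  refine ⟨y, hy, ?_⟩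
  have := add_mem hx hxy
  rwa [sub_add_sub_cancel] at this

section Bracket

variable (π : Bivector O) (π' : Bivector A)

lemma br_fst_fst (a b : O) : ((π.prod π').completion (tensorIdeal 𝔞 𝔪)).br (fstHom 𝔞 𝔪 a)
    (fstHom 𝔞 𝔪 b) = fstHom 𝔞 𝔪 (π.br a b) := by
  refine (Bivector.completion_br_of _ _ _ _).trans ?_
  change AdicCompletion.of _ _ (Bivector.prodBr π π' (a ⊗ₜ 1) (b ⊗ₜ 1)) = _
  rw [Bivector.prodBr_tmul, Bivector.br_one, TensorProduct.tmul_zero, add_zero, mul_one]; rfl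

lemma br_snd_snd (f g : A) : ((π.prod π').completion (tensorIdeal 𝔞 𝔪)).br (sndHom 𝔞 𝔪 f)
    (sndHom 𝔞 𝔪 g) = sndHom 𝔞 𝔪 (π'.br f g) := by
  refine (Bivector.completion_br_of _ _ _ _).trans ?_
  change AdicCompletion.of _ _ (Bivector.prodBr π π' (1 ⊗ₜ f) (1 ⊗ₜ g)) = _
  rw [Bivector.prodBr_tmul, Bivector.br_one, TensorProduct.zero_tmul, zero_add, mul_one]; rfl

lemma br_fst_snd (a : O) (f : A) : ((π.prod π').completion (tensorIdeal 𝔞 𝔪)).br (fstHom 𝔞 𝔪 a)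
    (sndHom 𝔞 𝔪 f) = 0 := by
  refine (Bivector.completion_br_of _ _ _ _).trans ?_
  change AdicCompletion.of _ _ (Bivector.prodBr π π' (a ⊗ₜ 1) (1 ⊗ₜ f)) = _
  rw [Bivector.prodBr_tmul, Bivector.br_one, TensorProduct.zero_tmul, π'.skew, Bivector.br_one]
  simp

end Bracket

end CompletedTensor

end Tensor

/-! ### Standard coordinates on the completed leaf -/

section Coordinates

open LaurentPolynomial StandardRing

variable {A : Type u} [CommRing A] [Algebra ℂ A] {J : Ideal A}
  {π : Bivector (AdicCompletion J A)} {W : ℤ → Set (AdicCompletion J A)} {m : ℕ} {k : ℤ}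

lemma StandardRing.tpow_add (m : ℕ) (i j : ℤ) : tpow m (i + j) = tpow m i * tpow m j := by
  rw [tpow, T_add, map_mul]; rfl

lemma StandardRing.tpow_zero (m : ℕ) : tpow m 0 = 1 := by rw [tpow, T_zero, map_one]

namespace StandardCoordinates

variable (c : StandardCoordinates π W m k)

/-- The invertible function `t`. -/
noncomputable def t : (AdicCompletion J A)ˣ where
  val := c.equiv (tpow m 1)
  inv := c.equiv (tpow m (-1))
  val_inv := by rw [← map_mul, ← tpow_add]; simp [tpow_zero]
  inv_val := by rw [← map_mul, ← tpow_add]; simp [tpow_zero]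

lemma coe_t : ((c.t : (AdicCompletion J A)ˣ) : AdicCompletion J A) = c.equiv (tpow m 1) := rfl

lemma coe_t_zpow (j : ℤ) :
    ((c.t ^ j : (AdicCompletion J A)ˣ) : AdicCompletion J A) = c.equiv (tpow m j) := by
  induction j with
  | zero => simp [tpow_zero]
  | succ n ih => rw [zpow_add_one, Units.val_mul, ih, tpow_add, map_mul]; rfl
  | pred n ih => rw [zpow_sub_one, Units.val_mul, ih, sub_eq_add_neg, tpow_add, map_mul]; rfl

/-- The coordinates `u` and `z_i`. -/
noncomputable def x (i : Option (Fin m ⊕ Fin m)) : AdicCompletion J A :=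
  c.equiv (MvPowerSeries.X i)

/-- A power series without constant term is a combination of the variables. -/
lemma idealOfDefinition_eq (hJ : J.FG) : idealOfDefinition J = Ideal.span (Set.range c.x) := by
  ext a
  obtain ⟨f, rfl⟩ := c.equiv.surjective a
  have h1 : c.equiv f ∈ idealOfDefinition J ↔ MvPowerSeries.constantCoeff f = 0 := by
    rw [c.ideal_iff, evalₐ_eq_zero_iff hJ, pow_one]
  constructor
  · intro h
    have := Ideal.mem_map_of_mem c.equiv (MvPowerSeries.mem_span_range_X (h1.1 h))
    rwa [Ideal.map_span, ← Set.range_comp] at this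
  · intro h
    refine Ideal.span_le.2 ?_ h
    rintro _ ⟨i, rfl⟩
    have h2 := (c.ideal_iff _).1 (MvPowerSeries.constantCoeff_X (R := ℂ[T;T⁻¹]) i)
    rwa [evalₐ_eq_zero_iff hJ, pow_one] at h2

/-- Polynomials in the coordinates `u` and `z_i`. -/
noncomputable def polys : Subalgebra ℂ (AdicCompletion J A) := Algebra.adjoin ℂ (Set.range c.x)

/-- Polynomials in `t`, `t⁻¹`, `u` and `z_i`. -/
noncomputable def laurentPolys : Submodule ℂ (AdicCompletion J A) :=
  Submodule.span ℂ {y | ∃ (j : ℤ), ∃ b ∈ c.polys, y = ((c.t ^ j : (AdicCompletion J A)ˣ) : _) * b}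

/-- A function is its constant term, a Laurent polynomial in `t`, plus a combination of the
coordinates whose coefficients need one order of precision less. -/
lemma adicDense_laurentPolys (hJ : J.FG) :
    AdicDense (idealOfDefinition J) (c.laurentPolys : Set (AdicCompletion J A)) := by
  intro a n
  induction n generalizing a with
  | zero => exact ⟨0, zero_mem _, by simp⟩
  | succ n ih =>
    obtain ⟨f, rfl⟩ := c.equiv.surjective a
    set f₀ := MvPowerSeries.constantCoeff f
    have hC (p : ℂ[T;T⁻¹]) : c.equiv (MvPowerSeries.C p) ∈ c.laurentPolys := by
      induction p using LaurentPolynomial.induction_on' with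
      | add p q hp hq => rw [map_add, map_add]; exact add_mem hp hq
      | C_mul_T j r =>
        refine Submodule.subset_span ⟨j, algebraMap ℂ _ r, Subalgebra.algebraMap_mem _ r, ?_⟩
        have e : algebraMap ℂ (StandardRing m) r = MvPowerSeries.C (LaurentPolynomial.C r) := by
          rw [MvPowerSeries.algebraMap_apply, LaurentPolynomial.C_eq_algebraMap]
        rw [coe_t_zpow, map_mul, map_mul, mul_comm, ← c.equiv.commutes, e]
        rfl
    have h1 : c.equiv f - c.equiv (MvPowerSeries.C f₀) ∈ idealOfDefinition J := by
      rw [← map_sub, ← pow_one (idealOfDefinition J), ← evalₐ_eq_zero_iff hJ, ← c.ideal_iff]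
      simp [f₀]
    rw [c.idealOfDefinition_eq hJ, Ideal.mem_span_range_iff_exists_fun] at h1
    obtain ⟨g, hg⟩ := h1
    choose y hy hgy using fun i => ih (g i)
    refine ⟨c.equiv (MvPowerSeries.C f₀) + ∑ i, y i * c.x i, add_mem (hC _) (sum_mem fun i _ => ?_),
      ?_⟩
    · refine Submodule.span_induction (p := fun y _ => y * c.x i ∈ c.laurentPolys) ?_ (by simp) ?_ ?_
        (hy i)
      · rintro _ ⟨j, b, hb, rfl⟩
        exact Submodule.subset_span ⟨j, b * c.x i,
          mul_mem hb (Algebra.subset_adjoin ⟨i, rfl⟩), mul_assoc _ _ _⟩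
      · intro y y' _ _ h h'; rw [add_mul]; exact add_mem h h'
      · intro r y _ h; rw [smul_mul_assoc]; exact Submodule.smul_mem _ _ h
    · rw [← sub_sub, ← hg, ← Finset.sum_sub_distrib]
      refine Ideal.sum_mem _ fun i _ => ?_
      rw [← sub_mul, pow_succ]
      refine Ideal.mul_mem_mul (hgy i) ?_
      rw [c.idealOfDefinition_eq hJ]
      exact Ideal.subset_span ⟨i, rfl⟩

/-- The coordinates `t`, `u`, `z'_{2i+1}`, `z_{2i+2}`. -/
noncomputable def generators : Set (AdicCompletion J A) :=
  {c.equiv (tpow m 1), c.equiv (u m)} ∪ (Set.range (fun i => c.equiv (zodd' k i)) ∪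
    Set.range (fun i => c.equiv (zeven i)))

/-- The missing `t⁻¹` comes from closure under inverses, and then `z_{2i+1}` is recovered as `t ^
(-k) z'_{2i+1}`. -/
lemma topGenerates (hJ : J.FG) : TopGenerates (idealOfDefinition J) c.generators := by
  intro 𝒮 h𝒮 hinv
  have ht : c.equiv (tpow m 1) ∈ 𝒮 := h𝒮 (by simp [generators])
  have ht' : c.equiv (tpow m (-1)) ∈ 𝒮 := hinv _ ht _ c.t.val_inv
  have htj (j : ℤ) : c.equiv (tpow m j) ∈ 𝒮 := by
    induction j with
    | zero => rw [tpow_zero, map_one]; exact one_mem _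
    | succ n ih => rw [tpow_add, map_mul]; exact mul_mem ih ht
    | pred n ih => rw [sub_eq_add_neg, tpow_add, map_mul]; exact mul_mem ih ht'
  have hx : Set.range c.x ⊆ 𝒮 := by
    rintro _ ⟨i, rfl⟩
    match i with
    | none => exact h𝒮 (by simp [generators, u, x])
    | some (Sum.inl i) =>
      have : c.x (some (Sum.inl i)) = c.equiv (tpow m (-k)) * c.equiv (zodd' k i) := by
        rw [zodd', ← map_mul, ← mul_assoc, ← tpow_add, neg_add_cancel, tpow_zero, one_mul]; rfl
      rw [this]
      exact mul_mem (htj _) (h𝒮 (by simp [generators]))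
    | some (Sum.inr i) => exact h𝒮 (by simp [generators, zeven, x])
  have hB : c.polys ≤ 𝒮 := Algebra.adjoin_le hx
  intro a n
  obtain ⟨y, hy, hay⟩ := c.adicDense_laurentPolys hJ a n
  refine ⟨y, ?_, hay⟩
  have : c.laurentPolys ≤ Subalgebra.toSubmodule 𝒮 := by
    refine Submodule.span_le.2 ?_
    rintro _ ⟨j, b, hb, rfl⟩
    rw [coe_t_zpow]
    exact 𝒮.mul_mem (htj j) (hB hb)
  exact this hy

end StandardCoordinates

end Coordinates

namespace Bivector

section Transport

variable {A : Type*} [CommRing A] [Algebra ℂ A] {B : Type*} [CommRing B] [Algebra ℂ B]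

/-- Transport of a bivector field along an isomorphism. -/
noncomputable def transport (π : Bivector A) (e : A ≃ₐ[ℂ] B) : Bivector B where
  br := LinearMap.mk₂ ℂ (fun a b => e (π.br (e.symm a) (e.symm b)))
    (fun a a' b => by simp) (fun c a b => by simp) (fun a b b' => by simp) (fun c a b => by simp)
  skew a b := by simp only [LinearMap.mk₂_apply]; rw [π.skew, map_neg]
  leibniz a b c := by simp [π.leibniz]

lemma transport_apply (π : Bivector A) (e : A ≃ₐ[ℂ] B) (a b : B) :
    (π.transport e).br a b = e (π.br (e.symm a) (e.symm b)) := rfl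

lemma isPoissonIso_transport (π : Bivector A) (e : A ≃ₐ[ℂ] B) :
    IsPoissonIso π (π.transport e) e := fun a b => by simp [transport_apply]

/-- The Leibniz rule for `t t⁻¹ = 1` supplies the negative exponents. -/
lemma br_zpow (π : Bivector A) (a : A) (t : Aˣ) (d : ℤ) :
    π.br a ((t ^ d : Aˣ) : A) = (d : ℂ) • (((t ^ (d - 1) : Aˣ) : A) * π.br a t) := by
  have hinv : π.br a ((t⁻¹ : Aˣ) : A) = -((t⁻¹ : Aˣ) : A) * ((t⁻¹ : Aˣ) : A) * π.br a t := by
    have h : (t : A) * π.br a ((t⁻¹ : Aˣ) : A) + ((t⁻¹ : Aˣ) : A) * π.br a t = 0 := by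
      rw [← π.leibniz, Units.mul_inv, br_one]
    have h2 : ((t⁻¹ : Aˣ) : A) * (t : A) = 1 := Units.inv_mul t
    linear_combination ((t⁻¹ : Aˣ) : A) * h - π.br a ((t⁻¹ : Aˣ) : A) * h2
  induction d with
  | zero => simp [br_one]
  | succ n ih =>
    have e : ((t ^ (n : ℤ) : Aˣ) : A) = (t : A) * ((t ^ ((n : ℤ) - 1) : Aˣ) : A) := by
      rw [← Units.val_mul, ← zpow_one_add, add_sub_cancel]
    rw [zpow_add_one, Units.val_mul, π.leibniz, ih, add_sub_cancel_right]
    push_cast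
    rw [add_smul, one_smul, mul_smul_comm, ← mul_assoc, ← e]
    ring
  | pred n ih =>
    have e : ((t ^ (-(n : ℤ) - 1 - 1) : Aˣ) : A)
        = ((t⁻¹ : Aˣ) : A) * ((t ^ (-(n : ℤ) - 1) : Aˣ) : A) := by
      rw [← Units.val_mul, mul_comm, ← zpow_sub_one]
    have e' : ((t ^ (-(n : ℤ) - 1) : Aˣ) : A) = ((t ^ (-(n : ℤ)) : Aˣ) : A) * ((t⁻¹ : Aˣ) : A) := by
      rw [zpow_sub_one, Units.val_mul]
    rw [e, zpow_sub_one, Units.val_mul, π.leibniz, ih, hinv, e']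
    push_cast
    rw [sub_smul, one_smul, mul_smul_comm, ← Units.val_mul, ← mul_assoc, ← mul_assoc]
    simp only [Units.val_mul]
    ring_nf

end Transport

lemma algHom_zpow {A B F : Type*} [CommRing A] [CommRing B] [FunLike F A B] [RingHomClass F A B]
    (f : F) {t : Aˣ} {t' : Bˣ} (h : f t = t') (d : ℤ) :
    f ((t ^ d : Aˣ) : A) = ((t' ^ d : Bˣ) : B) := by
  have : Units.map (f : A →* B) t = t' := Units.ext h
  rw [← this, ← map_zpow]; rfl

end Bivector

section Coordinates

open LaurentPolynomial StandardRing

namespace StandardCoordinates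

variable {A : Type u} [CommRing A] [Algebra ℂ A] {J : Ideal A}
  {π : Bivector (AdicCompletion J A)} {W : ℤ → Set (AdicCompletion J A)} {m : ℕ} {k : ℤ}
  (c : StandardCoordinates π W m k)

/-- The vector field `∂_u`. -/
noncomputable def du : Derivation ℂ (AdicCompletion J A) (AdicCompletion J A) :=
  -- Since `{u, t} = t ^ (1 - k)`, the Hamiltonian field of `t` is `∂_u` up to a power of `t` and a
  -- sign. Being expressed by the bracket, `∂_u` extends to the product with `S` by the same
  -- formula.
  π.ham (-((c.t ^ (k - 1) : (AdicCompletion J A)ˣ) : AdicCompletion J A)) c.t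

lemma du_apply (a : AdicCompletion J A) :
    c.du a = ((c.t ^ (k - 1) : (AdicCompletion J A)ˣ) : AdicCompletion J A) * π.br a c.t := by
  rw [du, Bivector.ham_apply, π.skew]; ring

lemma br_t_eq (a : AdicCompletion J A) :
    π.br a c.t = ((c.t ^ (1 - k) : (AdicCompletion J A)ˣ) : AdicCompletion J A) * c.du a := by
  rw [du_apply, ← mul_assoc, ← Units.val_mul, ← zpow_add]; simp

lemma du_zpow (d : ℤ) : c.du ((c.t ^ d : (AdicCompletion J A)ˣ) : AdicCompletion J A) = 0 := by
  rw [du_apply, π.skew, Bivector.br_zpow, Bivector.br_self]; simp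

lemma du_u : c.du (c.equiv (u m)) = 1 := by
  rw [du_apply, coe_t, c.br_u_t, ← coe_t_zpow, ← Units.val_mul, ← zpow_add]; simp

lemma du_t : c.du (c.equiv (tpow m 1)) = 0 := by
  rw [← coe_t_zpow, du_zpow]

lemma du_zodd' (i : Fin m) : c.du (c.equiv (zodd' k i)) = 0 := by
  rw [du_apply, π.skew, coe_t, c.br_t_zodd]; simp

lemma du_zeven (i : Fin m) : c.du (c.equiv (zeven i)) = 0 := by
  rw [du_apply, π.skew, coe_t, c.br_t_zeven]; simp

lemma zodd_eq (i : Fin m) : c.equiv (zodd i)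
    = ((c.t ^ (-k) : (AdicCompletion J A)ˣ) : AdicCompletion J A) * c.equiv (zodd' k i) := by
  rw [coe_t_zpow, zodd', ← map_mul, ← mul_assoc, ← tpow_add, neg_add_cancel, tpow_zero, one_mul]

lemma du_zodd (i : Fin m) : c.du (c.equiv (zodd i)) = 0 := by
  rw [zodd_eq, Derivation.leibniz, du_zodd', du_zpow]; simp

lemma du_polys {b : AdicCompletion J A} (hb : b ∈ c.polys) : c.du b ∈ c.polys := by
  induction hb using Algebra.adjoin_induction with
  | mem x hx =>
    obtain ⟨i, rfl⟩ := hx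
    match i with
    | none => exact (c.du_u) ▸ one_mem _
    | some (Sum.inl i) => exact (c.du_zodd i) ▸ zero_mem _
    | some (Sum.inr i) => exact (c.du_zeven i) ▸ zero_mem _
  | algebraMap r => rw [Derivation.map_algebraMap]; exact zero_mem _
  | add x y _ _ hx hy => rw [map_add]; exact add_mem hx hy
  | mul x y hx hy hx' hy' =>
    rw [Derivation.leibniz]
    exact add_mem (mul_mem hx hy') (mul_mem hy hx')

/-- On the generators, `∂_u` takes the values `0` and `1`. -/
lemma du_generators {a : AdicCompletion J A} (ha : a ∈ c.generators) : c.du a = 0 ∨ c.du a = 1 := by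
  obtain (rfl | rfl) | (⟨i, rfl⟩ | ⟨i, rfl⟩) := ha
  · exact Or.inl c.du_t
  · exact Or.inr c.du_u
  · exact Or.inl (c.du_zodd' i)
  · exact Or.inl (c.du_zeven i)

/-- The coefficients of `π_Y` in these coordinates are constants and a power of `t`. They do not
involve `u`, so shifting `u` leaves them fixed. -/
lemma du_br_generators {a b : AdicCompletion J A} (ha : a ∈ c.generators) (hb : b ∈ c.generators) :
    c.du (π.br a b) = 0 := by
  have hz (i j : Fin m) : c.du (if i = j then (1 : AdicCompletion J A) else 0) = 0 := by
    split_ifs <;> simp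
  have symm {a b : AdicCompletion J A} (h : c.du (π.br a b) = 0) : c.du (π.br b a) = 0 := by
    rw [π.skew, map_neg, h, neg_zero]
  have hut : c.du (π.br (c.equiv (u m)) (c.equiv (tpow m 1))) = 0 := by
    rw [c.br_u_t, ← coe_t_zpow, du_zpow]
  obtain (rfl | rfl) | (⟨i, rfl⟩ | ⟨i, rfl⟩) := ha <;>
    obtain (rfl | rfl) | (⟨j, rfl⟩ | ⟨j, rfl⟩) := hb
  · rw [Bivector.br_self, map_zero]
  · exact symm hut
  · rw [c.br_t_zodd, map_zero]
  · rw [c.br_t_zeven, map_zero]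
  · exact hut
  · rw [Bivector.br_self, map_zero]
  · rw [c.br_u_zodd, map_zero]
  · rw [c.br_u_zeven, map_zero]
  · exact symm (by rw [c.br_t_zodd, map_zero])
  · exact symm (by rw [c.br_u_zodd, map_zero])
  · rw [c.br_zodd_zodd, map_zero]
  · rw [c.br_zodd_zeven, hz]
  · exact symm (by rw [c.br_t_zeven, map_zero])
  · exact symm (by rw [c.br_u_zeven, map_zero])
  · exact symm (by rw [c.br_zodd_zeven, hz])
  · rw [c.br_zeven_zeven, map_zero]

/-- The functions of weight `d` are the limits of products of `t ^ d` and polynomials in `u` and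
`z_i`. -/
def WeightsAreStandard : Prop :=
  ∀ d a, a ∈ W d ↔ ∀ n, ∃ b ∈ c.polys,
    a - ((c.t ^ d : (AdicCompletion J A)ˣ) : AdicCompletion J A) * b ∈ idealOfDefinition J ^ n

variable {c} (hc : c.WeightsAreStandard)
include hc

namespace WeightsAreStandard

lemma zpow_mul_mem {i : ℤ} {a : AdicCompletion J A} (ha : a ∈ W i) (j : ℤ) :
    ((c.t ^ j : (AdicCompletion J A)ˣ) : AdicCompletion J A) * a ∈ W (i + j) := by
  rw [hc] at *
  intro n
  obtain ⟨b, hb, hab⟩ := ha n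
  refine ⟨b, hb, ?_⟩
  rw [add_comm, zpow_add, Units.val_mul, mul_assoc, ← mul_sub]
  exact Ideal.mul_mem_left _ _ hab

lemma smul_mem {i : ℤ} {a : AdicCompletion J A} (ha : a ∈ W i) (r : ℂ) : r • a ∈ W i := by
  rw [hc] at *
  intro n
  obtain ⟨b, hb, hab⟩ := ha n
  refine ⟨r • b, Subalgebra.smul_mem _ hb r, ?_⟩
  rw [mul_smul_comm, ← smul_sub]
  exact Submodule.smul_of_tower_mem _ r hab

/-- `∂_u` has weight zero: it kills powers of `t` and preserves polynomials in `u` and `z_i`. -/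
lemma du_mem {i : ℤ} {a : AdicCompletion J A} (ha : a ∈ W i) : c.du a ∈ W i := by
  rw [hc] at *
  intro n
  obtain ⟨b, hb, hab⟩ := ha (n + 1)
  refine ⟨_, c.du_polys hb, ?_⟩
  have := derivation_mem_pow c.du hab
  rwa [map_sub, Derivation.leibniz, du_zpow, smul_zero, add_zero] at this

lemma dividedPower_mem {i : ℤ} {a : AdicCompletion J A} (ha : a ∈ W i) (n : ℕ) :
    dividedPower c.du n a ∈ W i := by
  refine smul_mem hc ?_ _
  induction n with
  | zero => exact ha
  | succ n ih => rw [Function.iterate_succ_apply']; exact du_mem hc ih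

end WeightsAreStandard

end StandardCoordinates

end Coordinates

/-! ### Weights as closures of linear spans -/

section AdicClosure

variable {R : Type*} [CommRing R] [Algebra ℂ R]

/-- The closure of a linear subspace in the adic topology. -/
def adicClosure (J : Ideal R) (N : Submodule ℂ R) : Submodule ℂ R where
  carrier := {x | ∀ n, ∃ y ∈ N, x - y ∈ J ^ n}
  zero_mem' n := ⟨0, zero_mem _, by simp⟩
  add_mem' {a b} ha hb n := by
    obtain ⟨y, hy, h⟩ := ha n
    obtain ⟨y', hy', h'⟩ := hb n
    refine ⟨y + y', add_mem hy hy', ?_⟩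
    rw [add_sub_add_comm]; exact add_mem h h'
  smul_mem' r a ha n := by
    obtain ⟨y, hy, h⟩ := ha n
    refine ⟨r • y, N.smul_mem r hy, ?_⟩
    rw [← smul_sub]; exact Submodule.smul_of_tower_mem _ r h

variable {J : Ideal R} {N : Submodule ℂ R}

lemma le_adicClosure : N ≤ adicClosure J N := fun x hx _ => ⟨x, hx, by simp⟩

lemma mem_adicClosure_of_approx {x : R} (h : ∀ n, ∃ y ∈ adicClosure J N, x - y ∈ J ^ n) :
    x ∈ adicClosure J N := fun n => by
  obtain ⟨y, hy, hxy⟩ := h n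
  obtain ⟨z, hz, hyz⟩ := hy n
  exact ⟨z, hz, by have := add_mem hxy hyz; rwa [sub_add_sub_cancel] at this⟩

lemma map_adicClosure {R' : Type*} [CommRing R'] [Algebra ℂ R'] {K : Ideal R'}
    {N' : Submodule ℂ R'} (f : R →ₐ[ℂ] R') (hf : ∀ x ∈ J, f x ∈ K)
    (h : ∀ x ∈ N, f x ∈ adicClosure K N') {x : R} (hx : x ∈ adicClosure J N) :
    f x ∈ adicClosure K N' :=
  mem_adicClosure_of_approx fun n => by
    obtain ⟨y, hy, hxy⟩ := hx n
    exact ⟨f y, h y hy, by rw [← map_sub]; exact map_mem_pow f hf hxy⟩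

end AdicClosure

namespace CompletedTensor

variable {O : Type u} [CommRing O] [Algebra ℂ O] {A : Type v} [CommRing A] [Algebra ℂ A]
  (𝔞 : Ideal O) (𝔪 : Ideal A) (W : ℤ → Set O) (W' : ℤ → Set A) (d : ℤ)

/-- Linear combinations of products of weight vectors of total weight `d`. -/
noncomputable def weightSpan : Submodule ℂ (CompletedTensor 𝔞 𝔪) :=
  Submodule.span ℂ {z | ∃ i j a f, i + j = d ∧ a ∈ W i ∧ f ∈ W' j ∧
    z = fstHom 𝔞 𝔪 a * sndHom 𝔞 𝔪 f}

variable {𝔞 𝔪 W W' d}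

/-- Agreement of truncations becomes congruence modulo powers of the ideal of definition, so that
continuous maps can be applied to weight vectors of the product. -/
lemma mem_weight_iff (hI : (tensorIdeal 𝔞 𝔪).FG) {x : CompletedTensor 𝔞 𝔪} :
    x ∈ weight 𝔞 𝔪 W W' d ↔ x ∈ adicClosure (ideal 𝔞 𝔪) (weightSpan 𝔞 𝔪 W W' d) := by
  have e : (Submodule.span ℂ {z : O ⊗[ℂ] A | ∃ i j a f, i + j = d ∧ a ∈ W i ∧ f ∈ W' j ∧
      z = a ⊗ₜ f}).map (AdicCompletion.ofAlgHom' (tensorIdeal 𝔞 𝔪)).toLinearMap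
      = weightSpan 𝔞 𝔪 W W' d := by
    rw [Submodule.map_span, weightSpan]
    congr 1
    ext z
    constructor
    · rintro ⟨_, ⟨i, j, a, f, h1, h2, h3, rfl⟩, rfl⟩
      exact ⟨i, j, a, f, h1, h2, h3, of_tmul ..⟩
    · rintro ⟨i, j, a, f, h1, h2, h3, rfl⟩
      exact ⟨_, ⟨i, j, a, f, h1, h2, h3, rfl⟩, of_tmul ..⟩
  refine forall_congr' fun n => ?_
  rw [← e]
  constructor
  · rintro ⟨y, hy, h⟩
    refine ⟨_, ⟨y, hy, rfl⟩, ?_⟩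
    rw [← evalₐ_eq_zero_iff hI, map_sub, h]
    exact sub_eq_zero.2 (AdicCompletion.evalₐ_of ..).symm
  · rintro ⟨_, ⟨y, hy, rfl⟩, h⟩
    refine ⟨y, hy, ?_⟩
    rw [← evalₐ_eq_zero_iff hI, map_sub, sub_eq_zero] at h
    exact h.trans (AdicCompletion.evalₐ_of ..)

lemma mul_mem_weightSpan {i j : ℤ} {a : O} {f : A} (h : i + j = d) (ha : a ∈ W i) (hf : f ∈ W' j) :
    fstHom 𝔞 𝔪 a * sndHom 𝔞 𝔪 f ∈ weightSpan 𝔞 𝔪 W W' d :=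
  Submodule.subset_span ⟨i, j, a, f, h, ha, hf, rfl⟩

end CompletedTensor

namespace FormalPoissonGerm

lemma CxAction.topGenerates_weightVectors {S : FormalPoissonGerm.{u}} (ρ : S.CxAction) :
    TopGenerates S.maxIdeal ρ.weightVectors := fun 𝒮 h𝒮 _ f n => by
  obtain ⟨y, hy, h⟩ := ρ.adicDense_span_weightVectors f n
  have : Submodule.span ℂ ρ.weightVectors ≤ Subalgebra.toSubmodule 𝒮 := Submodule.span_le.2 h𝒮
  exact ⟨y, this hy, h⟩

end FormalPoissonGerm

/-! ### Straightening an equivariant decomposition -/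

namespace EquivariantDecomposition

open CompletedTensor

variable {AX : Type u} [CommRing AX] [Algebra ℂ AX] {JX : Ideal AX}
  {AY : Type u} [CommRing AY] [Algebra ℂ AY] {JY : Ideal AY}
  {πX : Bivector (AdicCompletion JX AX)} {WX : ℤ → Set (AdicCompletion JX AX)}
  {πY : Bivector (AdicCompletion JY AY)} {WY : ℤ → Set (AdicCompletion JY AY)} {k : ℤ}
  {S : FormalPoissonGerm.{v}} (D : EquivariantDecomposition πX WX πY WY k S)

local notation "T" => CompletedTensor (idealOfDefinition JY) S.maxIdeal
local notation "JT" => CompletedTensor.ideal (idealOfDefinition JY) S.maxIdeal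
local notation "ι" => CompletedTensor.fstHom (idealOfDefinition JY) S.maxIdeal
local notation "κ" => CompletedTensor.sndHom (idealOfDefinition JY) S.maxIdeal

/-- The function `t` on the completed product. -/
noncomputable def t : Tˣ := Units.map (ι : AdicCompletion JY AY →* T) D.coords.t

lemma fstHom_t_zpow (d : ℤ) :
    ι ((D.coords.t ^ d : (AdicCompletion JY AY)ˣ) : AdicCompletion JY AY) = ((D.t ^ d : Tˣ) : T) :=
  Bivector.algHom_zpow ι rfl d

/-- The bivector field of `X̂` on the completed product. -/
noncomputable def bivector : Bivector T := πX.transport D.iso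

lemma bivector_fst_fst (a b : AdicCompletion JY AY) :
    D.bivector.br (ι a) (ι b) = ι (πY.br a b) := D.br_fst_fst a b

lemma bivector_snd_snd (f g : S.carrier) :
    D.bivector.br (κ f) (κ g) = ((D.t ^ (-k) : Tˣ) : T) * κ (S.bivector.br f g) := by
  rw [← fstHom_t_zpow, D.coords.coe_t_zpow]; exact D.br_snd_snd f g

/-- Only `u` pairs with functions on `S`, and `∂_u` is `1` on `u` and `0` on the other coordinates;
one formula covers all four cases. -/
lemma bivector_generators_snd {a : AdicCompletion JY AY} (ha : a ∈ D.coords.generators)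
    (f : S.carrier) : D.bivector.br (ι a) (κ f)
      = ι (D.coords.du a) * (((D.t ^ (-k) : Tˣ) : T) * κ (D.ξ f)) := by
  have hz {x : AdicCompletion JX AX} (hx : x = 0) : D.iso x = 0 := by rw [hx, map_zero]
  obtain (rfl | rfl) | (⟨i, rfl⟩ | ⟨i, rfl⟩) := ha
  · rw [D.coords.du_t, map_zero, zero_mul]; exact hz (D.br_t_snd f)
  · rw [D.coords.du_u, map_one, one_mul, ← fstHom_t_zpow, D.coords.coe_t_zpow]
    exact D.br_u_snd f
  · rw [D.coords.du_zodd', map_zero, zero_mul]; exact hz (D.br_zodd_snd i f)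
  · rw [D.coords.du_zeven, map_zero, zero_mul]; exact hz (D.br_zeven_snd i f)

lemma coe_t : (D.t : T) = ι D.coords.t := rfl

lemma bivector_t_snd (f : S.carrier) : D.bivector.br D.t (κ f) = 0 := by
  rw [coe_t, bivector_generators_snd]
  · rw [D.coords.coe_t, D.coords.du_t, map_zero, zero_mul]
  · exact Or.inl (Or.inl rfl)

lemma bivector_zpow_snd (d : ℤ) (f : S.carrier) :
    D.bivector.br ((D.t ^ d : Tˣ) : T) (κ f) = 0 := by
  rw [D.bivector.skew, Bivector.br_zpow, D.bivector.skew, bivector_t_snd]; simp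

lemma bivector_zpow_zpow (i j : ℤ) :
    D.bivector.br ((D.t ^ i : Tˣ) : T) ((D.t ^ j : Tˣ) : T) = 0 := by
  rw [Bivector.br_zpow, D.bivector.skew, Bivector.br_zpow, Bivector.br_self]; simp

/-- The vector field `∂_u` on the completed product. -/
noncomputable def du : Derivation ℂ T T :=
  D.bivector.ham (-((D.t ^ (k - 1) : Tˣ) : T)) D.t

lemma du_fst (a : AdicCompletion JY AY) : D.du (ι a) = ι (D.coords.du a) := by
  rw [du, Bivector.ham_apply, coe_t, bivector_fst_fst, ← fstHom_t_zpow, ← map_neg, ← map_mul]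
  rfl

lemma du_snd (f : S.carrier) : D.du (κ f) = 0 := by
  rw [du, Bivector.ham_apply, bivector_t_snd, mul_zero]

lemma du_zpow (d : ℤ) : D.du ((D.t ^ d : Tˣ) : T) = 0 := by
  rw [← fstHom_t_zpow, du_fst, D.coords.du_zpow, map_zero]

lemma iterate_du_fst (n : ℕ) (a : AdicCompletion JY AY) :
    (D.du)^[n] (ι a) = ι ((D.coords.du)^[n] a) := by
  induction n with
  | zero => rfl
  | succ n ih => rw [Function.iterate_succ_apply', ih, du_fst, Function.iterate_succ_apply']

lemma dividedPower_du_fst (n : ℕ) (a : AdicCompletion JY AY) :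
    dividedPower D.du n (ι a) = ι (dividedPower D.coords.du n a) := by
  rw [dividedPower, iterate_du_fst, dividedPower, map_smul]

variable [IsAdicComplete (CompletedTensor.ideal (idealOfDefinition JY) S.maxIdeal)
  (CompletedTensor (idealOfDefinition JY) S.maxIdeal)]

/-- The time-`h` flow of `∂_u`. -/
noncomputable def flow {h : T} (hh : h ∈ JT) : T →ₐ[ℂ] T := taylor D.du hh

lemma flow_snd {h : T} (hh : h ∈ JT) (f : S.carrier) : D.flow hh (κ f) = κ f :=
  taylor_of_apply_eq_zero _ _ (D.du_snd f)

lemma flow_zpow {h : T} (hh : h ∈ JT) (d : ℤ) :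
    D.flow hh ((D.t ^ d : Tˣ) : T) = ((D.t ^ d : Tˣ) : T) :=
  taylor_of_apply_eq_zero _ _ (D.du_zpow d)

/-- The Taylor series stops after the linear term because `∂_u` takes the values `0` and `1` on
coordinates. -/
lemma flow_generators {h : T} (hh : h ∈ JT) {a : AdicCompletion JY AY}
    (ha : a ∈ D.coords.generators) :
    D.flow hh (ι a) = ι a + ι (D.coords.du a) * h := by
  obtain h0 | h1 := D.coords.du_generators ha
  · rw [flow, taylor_of_apply_eq_zero _ _ (by rw [du_fst, h0, map_zero]), h0]; simp
  · rw [flow, taylor_of_apply_eq_one _ _ (by rw [du_fst, h1, map_one]), h1]; simp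

variable {D}

/-- The automorphism `u ↦ u - h`, `f ↦ t ^ d f` for functions `f` of weight `d` on `S`. -/
theorem exists_straightening (hJ : JY.FG) (ρ : S.CxAction) {h : S.carrier} (hh : κ h ∈ JT)
    (hh' : -κ h ∈ JT) :
    ∃ Θ : T ≃ₐ[ℂ] T, (∀ x ∈ JT, Θ x ∈ JT) ∧ (∀ x ∈ JT, Θ.symm x ∈ JT) ∧
      (∀ a, Θ (ι a) = D.flow hh' (ι a)) ∧
      (∀ d, ∀ f ∈ ρ.weight d, Θ (κ f) = ((D.t ^ d : Tˣ) : T) * κ f) ∧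
      ∃ Tw : T →ₐ[ℂ] T, (∀ x ∈ JT, Tw x ∈ JT) ∧ (∀ a, Tw (ι a) = ι a) ∧
        (∀ d, ∀ f ∈ ρ.weight d, Tw (κ f) = ((D.t ^ (-d) : Tˣ) : T) * κ f) ∧
        ∀ x, Θ.symm x = Tw (D.flow hh x) := by
  have hκ : ∀ f ∈ S.maxIdeal, κ f ∈ JT := fun f hf => sndHom_mem hf
  obtain ⟨σ, hσ, hσw⟩ := ρ.exists_twist hκ D.t
  obtain ⟨σ', hσ', hσw'⟩ := ρ.exists_twist hκ D.t⁻¹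
  replace hσw' (d : ℤ) (f) (hf : f ∈ ρ.weight d) : σ' f = ((D.t ^ (-d) : Tˣ) : T) * κ f := by
    rw [hσw' d f hf, inv_zpow, zpow_neg]
  obtain ⟨Θ, hΘf, hΘs, hΘ⟩ := exists_lift ((D.flow hh').comp ι) σ
    (fun a ha => taylor_mem _ _ (fstHom_mem ha)) hσ
  obtain ⟨Tw, hTwf, hTws, hTw⟩ := exists_lift ι σ' (fun a ha => fstHom_mem ha) hσ'
  have hΘt (d : ℤ) : Θ ((D.t ^ d : Tˣ) : T) = ((D.t ^ d : Tˣ) : T) := by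
    rw [← fstHom_t_zpow, hΘf, AlgHom.comp_apply, fstHom_t_zpow]; exact D.flow_zpow _ d
  have hTwt (d : ℤ) : Tw ((D.t ^ d : Tˣ) : T) = ((D.t ^ d : Tˣ) : T) := by
    rw [← fstHom_t_zpow, hTwf]
  have hcancel (d : ℤ) (x : T) : ((D.t ^ d : Tˣ) : T) * (((D.t ^ (-d) : Tˣ) : T) * x) = x := by
    rw [← mul_assoc, ← Units.val_mul, ← zpow_add]; simp
  have hcancel' (d : ℤ) (x : T) : ((D.t ^ (-d) : Tˣ) : T) * (((D.t ^ d : Tˣ) : T) * x) = x := by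
    rw [← mul_assoc, ← Units.val_mul, ← zpow_add]; simp
  -- `Θ` fixes powers of `t`, so it undoes the twist by `t ^ (-d)`. In particular `Θ (u + σ' h) = u
  -- - h + h`.
  have hΘσ' (f : S.carrier) : Θ (σ' f) = κ f := by
    refine ρ.topGenerates_weightVectors.algHom_ext (K := JT) (Θ.comp σ') κ
      (fun f hf => hΘ _ (hσ' f hf)) hκ (fun f hf => ?_) f
    obtain ⟨d, hd⟩ := Set.mem_iUnion.1 hf
    change Θ (σ' f) = κ f
    rw [hσw' d f hd, map_mul, hΘt, hΘs, hσw d f hd, hcancel']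
  -- The candidate inverse sends `u` to `u + σ' h`; `h` itself need not be a weight vector.
  set Θ' : T →ₐ[ℂ] T := Tw.comp (D.flow hh)
  have hΘ' : ∀ x ∈ JT, Θ' x ∈ JT := fun x hx => hTw _ (taylor_mem _ _ hx)
  have hgen : TopGenerates JT (ι '' D.coords.generators ∪ κ '' ρ.weightVectors) :=
    topGenerates (hJ.map _) (IsNoetherian.noetherian _) (D.coords.topGenerates hJ)
      ρ.topGenerates_weightVectors
  have hΘg {a} (ha : a ∈ D.coords.generators) : Θ (ι a) = ι a - ι (D.coords.du a) * κ h := by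
    rw [hΘf]; refine (D.flow_generators hh' ha).trans ?_; ring
  have hΘ'g {a} (ha : a ∈ D.coords.generators) :
      Θ' (ι a) = ι a + ι (D.coords.du a) * σ' h := by
    change Tw (D.flow hh (ι a)) = _
    rw [D.flow_generators hh ha, map_add, map_mul, hTwf, hTwf, hTws]
  have hΘ's (f) : Θ' (κ f) = σ' f := by
    change Tw (D.flow hh (κ f)) = _
    rw [flow_snd, hTws]
  have hΘ't (d : ℤ) : Θ' ((D.t ^ d : Tˣ) : T) = ((D.t ^ d : Tˣ) : T) := by
    change Tw (D.flow hh _) = _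
    rw [flow_zpow, hTwt]
  have hdu {a} (ha : a ∈ D.coords.generators) (f : T →ₐ[ℂ] T) :
      f (ι (D.coords.du a)) = ι (D.coords.du a) := by
    obtain h0 | h0 := D.coords.du_generators ha <;> simp [h0]
  have h1 (x : T) : Θ (Θ' x) = x := by
    refine hgen.algHom_ext (K := JT) (Θ.comp Θ') (AlgHom.id ℂ T) (fun x hx => hΘ _ (hΘ' _ hx))
      (fun x hx => hx) ?_ x
    rintro _ (⟨a, ha, rfl⟩ | ⟨f, hf, rfl⟩)
    · change Θ (Θ' (ι a)) = ι a
      rw [hΘ'g ha, map_add, map_mul, hΘσ', hdu ha, hΘg ha]; ring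
    · change Θ (Θ' (κ f)) = κ f
      rw [hΘ's, hΘσ']
  have h2 (x : T) : Θ' (Θ x) = x := by
    refine hgen.algHom_ext (K := JT) (Θ'.comp Θ) (AlgHom.id ℂ T) (fun x hx => hΘ' _ (hΘ _ hx))
      (fun x hx => hx) ?_ x
    rintro _ (⟨a, ha, rfl⟩ | ⟨f, hf, rfl⟩)
    · change Θ' (Θ (ι a)) = ι a
      rw [hΘg ha, map_sub, map_mul, hΘ's, hdu ha, hΘ'g ha]; ring
    · change Θ' (Θ (κ f)) = κ f
      obtain ⟨d, hd⟩ := Set.mem_iUnion.1 hf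
      rw [hΘs, hσw d f hd, map_mul, hΘ's, hΘ't, hσw' d f hd, hcancel]
  exact ⟨AlgEquiv.ofAlgHom Θ Θ' (AlgHom.ext h1) (AlgHom.ext h2), hΘ, hΘ', hΘf,
    fun d f hf => (hΘs f).trans (hσw d f hf), Tw, hTw, hTwf,
    fun d f hf => (hTws f).trans (hσw' d f hf), fun x => rfl⟩

/-- The straightening automorphism is Poisson. -/
theorem straightening_br (hJ : JY.FG) {ρ : S.CxAction} (hρ : ρ.HomogeneousOfDegree (-k))
    {h : S.carrier} (hξ : ∀ d, ∀ f ∈ ρ.weight d, (d : ℂ) • f + D.ξ f = S.bivector.br h f)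
    (hh' : -κ h ∈ JT) (Θ : T →ₐ[ℂ] T) (hΘ : ∀ x ∈ JT, Θ x ∈ JT)
    (hΘf : ∀ a, Θ (ι a) = D.flow hh' (ι a))
    (hΘs : ∀ d, ∀ f ∈ ρ.weight d, Θ (κ f) = ((D.t ^ d : Tˣ) : T) * κ f) (x y : T) :
    Θ (((πY.prod S.bivector).completion (tensorIdeal (idealOfDefinition JY) S.maxIdeal)).br x y)
      = D.bivector.br (Θ x) (Θ y) := by
  have hgen : TopGenerates JT (ι '' D.coords.generators ∪ κ '' ρ.weightVectors) :=
    topGenerates (hJ.map _) (IsNoetherian.noetherian _) (D.coords.topGenerates hJ)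
      ρ.topGenerates_weightVectors
  have hΘg {a} (ha : a ∈ D.coords.generators) : Θ (ι a) = ι a - ι (D.coords.du a) * κ h := by
    rw [hΘf, D.flow_generators hh' ha]; ring
  set B := D.bivector with hB
  -- This is `{u - h, t ^ d f} = t ^ (d - k) (d f + ξ f - {h, f}) = 0`; `e1` supplies the summand `d
  -- f`. For the other coordinates each term has the factor `∂_u a = 0`.
  have hmix {a} (ha : a ∈ D.coords.generators) {d : ℤ} {f} (hf : f ∈ ρ.weight d) :
      B.br (Θ (ι a)) (Θ (κ f)) = 0 := by
    have e1 : B.br (ι a) ((D.t ^ d : Tˣ) : T)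
        = (d : ℂ) • (((D.t ^ d : Tˣ) : T) * (((D.t ^ (-k) : Tˣ) : T) * ι (D.coords.du a))) := by
      rw [Bivector.br_zpow, coe_t, bivector_fst_fst, D.coords.br_t_eq, map_mul, fstHom_t_zpow,
        ← mul_assoc, ← mul_assoc, ← Units.val_mul, ← Units.val_mul, ← zpow_add, ← zpow_add,
        show d - 1 + (1 - k) = d + -k by ring]
    have e2 : B.br (κ h) ((D.t ^ d : Tˣ) : T) = 0 := by
      rw [B.skew, bivector_zpow_snd, neg_zero]
    have e3 : κ (S.bivector.br h f) = (d : ℂ) • κ f + κ (D.ξ f) := by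
      rw [← hξ d f hf, map_add, map_smul]
    have e4 : B.br (ι (D.coords.du a) * κ h) (((D.t ^ d : Tˣ) : T) * κ f)
        = ι (D.coords.du a) * B.br (κ h) (((D.t ^ d : Tˣ) : T) * κ f) := by
      obtain h0 | h0 := D.coords.du_generators ha <;> simp [h0]
    rw [hΘg ha, hΘs d f hf, map_sub, LinearMap.sub_apply, e4, B.leibniz, B.leibniz, e1, e2,
      bivector_generators_snd D ha, bivector_snd_snd, e3]
    simp only [Algebra.smul_def]
    ring
  refine Bivector.map_br_of_topGenerates hgen _ B Θ hΘ ?_ x y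
  rintro _ (⟨a, ha, rfl⟩ | ⟨f, hf, rfl⟩) _ (⟨b, hb, rfl⟩ | ⟨g, hg, rfl⟩)
  · rw [CompletedTensor.br_fst_fst, hΘf, flow, taylor_of_apply_eq_zero _ _
      (by rw [du_fst, D.coords.du_br_generators ha hb, map_zero]), hΘg ha, hΘg hb]
    have e1 : B.br (ι a) (ι b) = ι (πY.br a b) := D.bivector_fst_fst a b
    have e2 := bivector_generators_snd D ha h
    have e3 := bivector_generators_snd D hb h
    rw [D.bivector.skew] at e3
    -- The shift contributes brackets with `h`. They vanish when `∂_u` kills the other coordinate,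
    -- and cancel when both coordinates are `u`.
    obtain h0 | h0 := D.coords.du_generators ha <;> obtain h0' | h0' := D.coords.du_generators hb
    · simp [h0, h0', e1]
    · simp [h0, h0', e1] at e2 ⊢; rw [← hB] at e2; rw [e2]; simp
    · simp [h0, h0', e1] at e3 ⊢; rw [← hB] at e3; rw [e3]; simp
    · simp only [h0, h0', map_one, one_mul, map_sub, LinearMap.sub_apply, e1, Bivector.br_self]
        at e2 e3 ⊢
      rw [← hB] at e2 e3
      rw [e2]
      linear_combination -e3
  · obtain ⟨d, hd⟩ := Set.mem_iUnion.1 hg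
    rw [CompletedTensor.br_fst_snd, map_zero, hmix ha hd]
  · obtain ⟨d, hd⟩ := Set.mem_iUnion.1 hf
    rw [Bivector.skew, CompletedTensor.br_fst_snd, neg_zero, map_zero, B.skew, hmix hb hd, neg_zero]
  · obtain ⟨i, hi⟩ := Set.mem_iUnion.1 hf
    obtain ⟨j, hj⟩ := Set.mem_iUnion.1 hg
    rw [CompletedTensor.br_snd_snd, hΘs _ _ (ρ.br_mem_weight hρ hi hj), hΘs i f hi, hΘs j g hj, B.leibniz,
      B.leibniz_left, B.leibniz_left, bivector_zpow_zpow, bivector_zpow_snd, bivector_snd_snd,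
      B.skew (κ f), bivector_zpow_snd, sub_eq_add_neg, zpow_add, zpow_add, Units.val_mul,
      Units.val_mul]
    ring

/-- For `a` of weight `i` and `f` of weight `j`, the terms `h ^ l t ^ j (∂_u ^ l a) f` have weight
`i + j`: under the trivial action on `S` both `h` and `f` have weight zero, and the factor `t ^ j`
makes up for the weight lost by `f`. -/
lemma straightening_mem_weight (hW : D.coords.WeightsAreStandard) (ρ : S.CxAction)
    {h : S.carrier} (hh' : -κ h ∈ JT) (Θ : T →ₐ[ℂ] T) (hΘ : ∀ x ∈ JT, Θ x ∈ JT)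
    (hΘf : ∀ a, Θ (ι a) = D.flow hh' (ι a))
    (hΘs : ∀ d, ∀ f ∈ ρ.weight d, Θ (κ f) = ((D.t ^ d : Tˣ) : T) * κ f) {d : ℤ} {x : T}
    (hx : x ∈ adicClosure JT (weightSpan _ _ WY ρ.weight d)) :
    Θ x ∈ adicClosure JT (weightSpan _ _ WY S.trivialAction.weight d) := by
  refine map_adicClosure Θ hΘ (fun x hx => ?_) hx
  refine (Submodule.span_le (p := (adicClosure JT _).comap Θ.toLinearMap)).2 ?_ hx
  rintro _ ⟨i, j, a, f, hij, ha, hf, rfl⟩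
  change Θ (ι a * κ f) ∈ adicClosure JT _
  refine mem_adicClosure_of_approx fun n => ⟨taylorSum D.du (-κ h) n (ι a) *
    (((D.t ^ j : Tˣ) : T) * κ f), le_adicClosure ?_, ?_⟩
  · rw [taylorSum, Finset.sum_mul]
    refine Submodule.sum_mem _ fun l _ => ?_
    have e : (-κ h) ^ l * dividedPower D.du l (ι a) * (((D.t ^ j : Tˣ) : T) * κ f)
        = ι (((D.coords.t ^ j : (AdicCompletion JY AY)ˣ) : AdicCompletion JY AY) *
          dividedPower D.coords.du l a) * κ ((-h) ^ l * f) := by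
      rw [dividedPower_du_fst, map_mul, map_mul, map_pow, map_neg, fstHom_t_zpow]; ring
    rw [e]
    refine mul_mem_weightSpan (i := i + j) (j := 0) (by omega)
      (hW.zpow_mul_mem (hW.dividedPower_mem ha l) j) fun z => ?_
    simp [FormalPoissonGerm.trivialAction]
  · rw [map_mul, hΘf, hΘs j f hf, ← sub_mul]
    exact Ideal.mul_mem_right _ _ (taylor_sub_mem D.du hh' n _)

/-- For the trivial action nonzero functions on `S` have only weight zero, so the factor on `Ŷ`
carries the whole weight `d`. After the flow, the functions `h ^ l f` on `S` are split into
components for `ρ`; the twist multiplies that of weight `e` by `t ^ (-e)` and keeps the total at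
`d`. -/
lemma twist_mem_weight (hW : D.coords.WeightsAreStandard) (ρ : S.CxAction)
    {h : S.carrier} (hh : κ h ∈ JT) (Tw : T →ₐ[ℂ] T) (hTw : ∀ x ∈ JT, Tw x ∈ JT)
    (hTwf : ∀ a, Tw (ι a) = ι a)
    (hTws : ∀ d, ∀ f ∈ ρ.weight d, Tw (κ f) = ((D.t ^ (-d) : Tˣ) : T) * κ f) {d : ℤ} {x : T}
    (hx : x ∈ adicClosure JT (weightSpan _ _ WY S.trivialAction.weight d)) :
    Tw (D.flow hh x) ∈ adicClosure JT (weightSpan _ _ WY ρ.weight d) := by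
  have key {a : AdicCompletion JY AY} (ha : a ∈ WY d) (g : S.carrier) :
      ι a * Tw (κ g) ∈ adicClosure JT (weightSpan _ _ WY ρ.weight d) := by
    refine mem_adicClosure_of_approx fun n => ?_
    obtain ⟨c, hc, hg⟩ := ρ.exists_components n g
    refine ⟨ι a * Tw (κ (∑ e ∈ c.support, c e)), le_adicClosure ?_, ?_⟩
    · rw [map_sum, map_sum, Finset.mul_sum]
      refine Submodule.sum_mem _ fun e _ => ?_
      rw [hTws e _ (hc e), ← mul_assoc, mul_comm (ι a), ← fstHom_t_zpow, ← map_mul]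
      exact mul_mem_weightSpan (by omega) (hW.zpow_mul_mem ha (-e)) (hc e)
    · rw [← mul_sub, ← map_sub, ← map_sub]
      exact Ideal.mul_mem_left _ _ (map_mem_pow Tw hTw (map_mem_pow κ (fun _ h => sndHom_mem h) hg))
  refine map_adicClosure (Tw.comp (D.flow hh)) (fun x hx => hTw _ (taylor_mem _ _ hx))
    (fun x hx => ?_) hx
  refine (Submodule.span_le
    (p := (adicClosure JT _).comap (Tw.comp (D.flow hh)).toLinearMap)).2 ?_ hx
  rintro _ ⟨i, j, a, f, hij, ha, hf, rfl⟩
  change Tw (D.flow hh (ι a * κ f)) ∈ adicClosure JT _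
  by_cases hj : j = 0
  · obtain rfl : i = d := by omega
    refine mem_adicClosure_of_approx fun n => ⟨Tw (taylorSum D.du (κ h) n (ι a) * κ f), ?_, ?_⟩
    · rw [taylorSum, Finset.sum_mul, map_sum]
      refine Submodule.sum_mem _ fun l _ => ?_
      have e : κ h ^ l * dividedPower D.du l (ι a) * κ f
          = ι (dividedPower D.coords.du l a) * κ (h ^ l * f) := by
        rw [dividedPower_du_fst, map_mul, map_pow]; ring
      rw [e, map_mul, hTwf]
      exact key (hW.dividedPower_mem ha l) _
    · rw [← map_sub, map_mul, flow_snd, ← sub_mul]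
      exact map_mem_pow Tw hTw (Ideal.mul_mem_right _ _ (taylor_sub_mem D.du hh n _))
  · have hf0 : f = 0 := by
      have h2 := hf (Units.mk0 2 two_ne_zero)
      have h3 : ((2 : ℂ) ^ j - 1) • f = 0 := by
        rw [sub_smul, one_smul, sub_eq_zero]
        simpa [FormalPoissonGerm.trivialAction] using h2.symm
      refine (smul_eq_zero.1 h3).resolve_left (sub_ne_zero.2 fun h4 => hj ?_)
      have h5 : ((2 : ℝ) ^ j) = 1 := by
        rw [← Complex.norm_ofNat, ← norm_zpow, h4, norm_one]
      exact (zpow_eq_one_iff_right₀ (by norm_num) (by norm_num)).1 h5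
    rw [hf0, map_zero, mul_zero, map_zero, map_zero]
    exact zero_mem _

omit [IsAdicComplete (CompletedTensor.ideal (idealOfDefinition JY) S.maxIdeal)
  (CompletedTensor (idealOfDefinition JY) S.maxIdeal)] in
/-- If `S` has an action for which `π_S` has degree `-k`, and its Poisson vector fields are
Hamiltonian, then the decomposition can be made Poisson and equivariant for this action. -/
theorem exists_poissonIso (hJ : JY.FG) (hW : D.coords.WeightsAreStandard) {ρ : S.CxAction}
    (hρ : ρ.HomogeneousOfDegree (-k)) (hS : S.PoissonFieldsHamiltonian) :
    ∃ Φ : AdicCompletion JX AX ≃ₐ[ℂ] T, IsBicontinuous Φ ∧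
      (∀ d f, f ∈ WX d ↔ Φ f ∈ CompletedTensor.weight _ _ WY ρ.weight d) ∧
      IsPoissonIso πX ((πY.prod S.bivector).completion (tensorIdeal _ _)) Φ := by
  have hI : (tensorIdeal (idealOfDefinition JY) S.maxIdeal).FG :=
    tensorIdeal_fg (hJ.map _) (IsNoetherian.noetherian _)
  have := isAdicComplete_idealOfDefinition hI
  obtain ⟨h, hhm, hξ⟩ := FormalPoissonGerm.exists_hamiltonian hρ hS D.ξ D.ξ_bivector
  have hh : κ h ∈ JT := sndHom_mem hhm
  have hh' : -κ h ∈ JT := neg_mem hh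
  obtain ⟨Θ, hΘ, hΘ', hΘf, hΘs, Tw, hTw, hTwf, hTws, hsymm⟩ :=
    exists_straightening (D := D) hJ ρ hh hh'
  have hP := straightening_br hJ hρ hξ hh' (Θ : T →ₐ[ℂ] T) hΘ hΘf hΘs
  -- `Θ` takes `π_Y + π_S` to the bivector of `X̂`, so its inverse is the one to compose with.
  refine ⟨D.iso.trans Θ.symm, ⟨fun n => ?_, fun n => ?_⟩, fun d f => ?_, fun a b => ?_⟩
  · obtain ⟨m, hm⟩ := D.bicontinuous.1 n
    refine ⟨m, fun x hx => ?_⟩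
    have := hm x hx
    rw [evalₐ_eq_zero_iff hI] at this ⊢
    exact map_mem_pow Θ.symm hΘ' this
  · obtain ⟨m, hm⟩ := D.bicontinuous.2 n
    refine ⟨m, fun x hx => hm _ ?_⟩
    rw [evalₐ_eq_zero_iff hI] at hx ⊢
    exact map_mem_pow Θ hΘ hx
  · rw [D.equivariant, mem_weight_iff hI, mem_weight_iff hI]
    refine ⟨fun hf => ?_, fun hf => ?_⟩
    · change Θ.symm (D.iso f) ∈ _
      rw [hsymm]
      exact twist_mem_weight hW ρ hh Tw hTw hTwf hTws hf
    · have := straightening_mem_weight hW ρ hh' (Θ : T →ₐ[ℂ] T) hΘ hΘf hΘs hf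
      change Θ (Θ.symm (D.iso f)) ∈ _ at this
      rwa [AlgEquiv.apply_symm_apply] at this
  · refine Θ.injective ?_
    have := hP (Θ.symm (D.iso a)) (Θ.symm (D.iso b))
    refine Eq.trans ?_ this.symm
    change Θ (Θ.symm (D.iso (πX.br a b)))
      = D.bivector.br (Θ (Θ.symm (D.iso a))) (Θ (Θ.symm (D.iso b)))
    rw [AlgEquiv.apply_symm_apply, AlgEquiv.apply_symm_apply, AlgEquiv.apply_symm_apply]
    exact πX.isPoissonIso_transport D.iso a b

end EquivariantDecomposition

/-! ### Pullback of functions along points with values in rings -/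

section Pullback

variable {Y : Scheme.{0}} {U : Y.Opens} {B : Type} [CommRing B]

/-- Pullback of functions on an open subset along a morphism from an affine scheme. -/
noncomputable def pullback (x : Spec (.of B) ⟶ Y) (h : ⊤ ≤ x ⁻¹ᵁ U) : Γ(Y, U) →+* B :=
  (x.appLE U ⊤ h ≫ (Scheme.ΓSpecIso (.of B)).hom).hom

lemma pullback_apply (x : Spec (.of B) ⟶ Y) (h : ⊤ ≤ x ⁻¹ᵁ U) (r : Γ(Y, U)) :
    pullback x h r = (Scheme.ΓSpecIso (.of B)).hom (x.appLE U ⊤ h r) := rfl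

lemma pullback_specMap_fromSpec (hU : IsAffineOpen U) (φ : Γ(Y, U) →+* B)
    (h : ⊤ ≤ (Spec.map (CommRingCat.ofHom φ) ≫ hU.fromSpec) ⁻¹ᵁ U) :
    pullback (Spec.map (CommRingCat.ofHom φ) ≫ hU.fromSpec) h = φ := by
  have e : (Spec.map (CommRingCat.ofHom φ) ≫ hU.fromSpec).appLE U ⊤ h ≫
      (Scheme.ΓSpecIso (.of B)).hom = CommRingCat.ofHom φ := by
    have h1 : ⊤ ≤ hU.fromSpec ⁻¹ᵁ U := hU.fromSpec_preimage_self.ge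
    rw [← Scheme.Hom.appLE_comp_appLE _ _ U ⊤ ⊤ h1 le_top]
    have h2 : hU.fromSpec.appLE U ⊤ h1 = (Scheme.ΓSpecIso Γ(Y, U)).inv := by
      rw [Scheme.Hom.appLE, hU.fromSpec_app_self, Category.assoc, ← Functor.map_comp]
      exact (congrArg _ (CategoryTheory.Functor.map_id _ _)).trans (Category.comp_id _)
    have h3 : (Spec.map (CommRingCat.ofHom φ)).appLE ⊤ ⊤ le_top
        = (Spec.map (CommRingCat.ofHom φ)).appTop := by
      rw [Scheme.Hom.appTop, Scheme.Hom.app_eq_appLE]; rfl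
    rw [h2, h3, Category.assoc, Scheme.ΓSpecIso_naturality]
    exact Iso.inv_hom_id_assoc (Scheme.ΓSpecIso Γ(Y, U)) _
  exact congrArg CommRingCat.Hom.hom e

lemma specMap_pullback_fromSpec (hU : IsAffineOpen U) (x : Spec (.of B) ⟶ Y) (h : ⊤ ≤ x ⁻¹ᵁ U) :
    Spec.map (CommRingCat.ofHom (pullback x h)) ≫ hU.fromSpec = x := by
  have e : CommRingCat.ofHom (pullback x h) = x.appLE U ⊤ h ≫ (Scheme.ΓSpecIso (.of B)).hom := rfl
  rw [e, Spec.map_comp, Category.assoc, hU.SpecMap_appLE_fromSpec x (isAffineOpen_top _),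
    IsAffineOpen.fromSpec_top, Scheme.isoSpec_Spec_inv, ← Category.assoc, ← Spec.map_comp,
    Iso.inv_hom_id, Spec.map_id, Category.id_comp]

/-- Sections over the preimage of `U` are transferred to elements of `B`. The second morphism is
there because weights are defined by the action on `T`-points, while pullbacks are taken along a
composite with a translation. -/
lemma app_eq_iff_pullback_eq {x x' : Spec (.of B) ⟶ Y} (hx : x' = x) (h : ⊤ ≤ x ⁻¹ᵁ U)
    (r : Γ(Y, U)) (z : B) :
    x'.app U r = (Spec (.of B)).presheaf.map (homOfLE le_top).op ((Scheme.ΓSpecIso (.of B)).inv z)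
      ↔ pullback x h r = z := by
  subst hx
  have h1 : (Spec (.of B)).presheaf.map (homOfLE h).op (x'.app U r) = x'.appLE U ⊤ h r := rfl
  have hres {V W : (Spec (.of B)).Opens} (i : V ≤ W) (j : W ≤ V) (b) :
      (Spec (.of B)).presheaf.map (homOfLE i).op ((Spec (.of B)).presheaf.map (homOfLE j).op b)
        = b := by
    rw [← ConcreteCategory.comp_apply, ← Functor.map_comp]
    exact ConcreteCategory.congr_hom ((Spec (.of B)).presheaf.map_id _) b
  have hiso (b : B) : (Scheme.ΓSpecIso (.of B)).hom ((Scheme.ΓSpecIso (.of B)).inv b) = b :=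
    ConcreteCategory.congr_hom (Scheme.ΓSpecIso (.of B)).inv_hom_id b
  have hiso' (b) : (Scheme.ΓSpecIso (.of B)).inv ((Scheme.ΓSpecIso (.of B)).hom b) = b :=
    ConcreteCategory.congr_hom (Scheme.ΓSpecIso (.of B)).hom_inv_id b
  rw [pullback_apply, ← h1]
  constructor
  · intro e
    rw [e, hres, hiso]
  · rintro rfl
    rw [hiso', hres]

end Pullback

section PullbackVariety

variable {X : ComplexVariety} {U : X.toScheme.Opens} {B : Type} [CommRing B]

/-- On constants, the pullback depends only on the morphism to `Spec ℂ`. -/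
lemma pullback_algebraMap (x : Spec (.of B) ⟶ X.toScheme) (h : ⊤ ≤ x ⁻¹ᵁ U) (c : ℂ) :
    pullback x h (algebraMap ℂ Γ(X.toScheme, U) c)
      = (Scheme.ΓSpecIso (.of B)).hom ((x ≫ X.str).appTop ((Scheme.ΓSpecIso (.of ℂ)).inv c)) := by
  have e : X.str.appLE ⊤ U le_top ≫ x.appLE U ⊤ h = (x ≫ X.str).appTop := by
    refine (Scheme.Hom.appLE_comp_appLE _ _ _ _ _ _ _).trans ?_
    rw [Scheme.Hom.appTop, Scheme.Hom.app_eq_appLE]; rfl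
  rw [← e]
  rfl

lemma preimage_eq_top (x : Spec (.of B) ⟶ X.toScheme) (h : Set.range x ⊆ U) : ⊤ ≤ x ⁻¹ᵁ U :=
  fun p _ => h ⟨p, rfl⟩

end PullbackVariety

/-! ### The orbit and its infinitesimal neighbourhoods -/

namespace GmAction

variable {X : ComplexVariety} (α : GmAction X)

/-- A homomorphism from Laurent polynomials is an `R`-point of `ℂˣ`, and the orbit map is the action
of the universal such point; naturality of the action evaluates it. -/
lemma specMap_orbitMap (y : X.Point) {R : Type} [CommRing R] [Algebra ℂ R]
    (μ : LaurentPolynomial ℂ →ₐ[ℂ] R) :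
    Spec.map (CommRingCat.ofHom μ.toRingHom) ≫ α.act cxCoord (cxStr ≫ y.hom)
      = α.act (Units.map ((Scheme.ΓSpecIso (.of R)).inv.hom : R →* Γ(Spec (.of R), ⊤))
          (Units.map (μ : LaurentPolynomial ℂ →* R) laurentUnit))
        (Spec.map (CommRingCat.ofHom (algebraMap ℂ R)) ≫ y.hom) := by
  rw [α.comp_act]
  congr 1
  · ext
    have := Scheme.ΓSpecIso_inv_naturality (CommRingCat.ofHom μ.toRingHom)
    exact (ConcreteCategory.congr_hom this (LaurentPolynomial.T 1)).symm
  · rw [cxStr, ← Category.assoc, ← Spec.map_comp, ← CommRingCat.ofHom_comp]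
    congr 4
    exact μ.comp_algebraMap

/-- The algebra homomorphism from Laurent polynomials taking the variable to a unit. -/
noncomputable def _root_.laurentEval {R : Type} [CommRing R] [Algebra ℂ R] (w : Rˣ) :
    LaurentPolynomial ℂ →ₐ[ℂ] R where
  toRingHom := LaurentPolynomial.eval₂ (algebraMap ℂ R) w
  commutes' c := by
    rw [← LaurentPolynomial.C_eq_algebraMap]
    exact LaurentPolynomial.eval₂_C ..

lemma _root_.map_laurentEval_laurentUnit {R : Type} [CommRing R] [Algebra ℂ R] (w : Rˣ) :
    Units.map (laurentEval w : LaurentPolynomial ℂ →* R) laurentUnit = w := by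
  ext
  exact (LaurentPolynomial.eval₂_T (algebraMap ℂ R) w 1).trans (by rw [zpow_one])

/-- Specialize the orbit map at `t = 1`. -/
lemma support_subset_orbit (y : X.Point) : y.support ⊆ α.orbit y := by
  have h := α.specMap_orbitMap y (laurentEval (1 : ℂˣ))
  rw [map_laurentEval_laurentUnit, map_one, α.one_act] at h
  have e : CommRingCat.ofHom (algebraMap ℂ ℂ) = 𝟙 (CommRingCat.of ℂ) := rfl
  rw [e, Spec.map_id, Category.id_comp] at h
  rw [ComplexVariety.Point.support, ← h, Scheme.Hom.comp_base]
  rintro _ ⟨x, rfl⟩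
  exact ⟨_, rfl⟩

lemma _root_.map_constUnit {T T' : Scheme.{0}} (h : T' ⟶ T) (q : T ⟶ Spec (.of ℂ)) (s : ℂˣ) :
    Units.map (h.appTop.hom : Γ(T, ⊤) →+* Γ(T', ⊤)) (constUnit q s) = constUnit (h ≫ q) s := by
  ext
  simp only [constUnit, Scheme.Hom.comp_appTop]
  rfl

lemma comp_translate {T : Scheme.{0}} (x : T ⟶ X.toScheme) (s : ℂˣ) :
    x ≫ α.translate s = α.act (constUnit (x ≫ X.str) s) x := by
  rw [translate, α.comp_act, map_constUnit, Category.comp_id]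

/-- The relation `s (t y) = (s t) y` for the universal point says that translating the orbit map is
precomposing it with the substitution `t ↦ s t`. This treats all points of the scheme at once,
closed or not. -/
lemma translate_mem_orbit (y : X.Point) (s : ℂˣ) {x : X.toScheme} (hx : x ∈ α.orbit y) :
    α.translate s x ∈ α.orbit y := by
  obtain ⟨z, rfl⟩ := hx
  set w : (LaurentPolynomial ℂ)ˣ := Units.map (algebraMap ℂ (LaurentPolynomial ℂ) : ℂ →* _) s *
    laurentUnit
  have h := α.specMap_orbitMap y (laurentEval w)
  rw [map_laurentEval_laurentUnit] at h
  have e : α.act cxCoord (cxStr ≫ y.hom) ≫ α.translate s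
      = Spec.map (CommRingCat.ofHom (laurentEval w).toRingHom) ≫ α.act cxCoord (cxStr ≫ y.hom) := by
    rw [h, comp_translate, α.act_str, Category.assoc, y.hom_str, Category.comp_id, ← α.mul_act]
    congr 1
    rw [map_mul]
    congr 1
    ext
    have := Scheme.ΓSpecIso_inv_naturality (CommRingCat.ofHom (algebraMap ℂ (LaurentPolynomial ℂ)))
    exact (ConcreteCategory.congr_hom this (s : ℂ)).symm
  have e' := congrArg (fun f : cxScheme ⟶ X.toScheme => f z) e
  simp only [Scheme.Hom.comp_apply] at e'
  exact ⟨_, e'.symm⟩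

section Weight

variable {U : X.toScheme.Opens} (hU : IsAffineOpen U) (K I : Ideal Γ(X.toScheme, U))

/-- Weight vectors in terms of pullbacks along `x ↦ s · x`. -/
lemma mem_weight_iff (h : ∀ n s, ⊤ ≤ (truncation hU K I n ≫ α.translate s) ⁻¹ᵁ U) (d : ℤ)
    (f : FormalRing K I) :
    f ∈ α.weight hU K I d ↔ ∀ (n : ℕ) (s : ℂˣ) (r : Γ(X.toScheme, U)),
      Ideal.Quotient.mk _ (Ideal.Quotient.mk K r) = AdicCompletion.evalₐ _ n f →
      pullback (truncation hU K I n ≫ α.translate s) (h n s) r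
        = ((s ^ d : ℂˣ) : ℂ) • AdicCompletion.evalₐ _ n f := by
  have key (n s r) := app_eq_iff_pullback_eq (α.comp_translate (truncation hU K I n) s).symm
    (h n s) r (((s ^ d : ℂˣ) : ℂ) • AdicCompletion.evalₐ _ n f)
  exact ⟨fun hf n s r hr => (key n s r).1 (hf n s r hr),
    fun hf n s r hr => (key n s r).2 (hf n s r hr)⟩

/-- The pullback along `x ↦ s · x` on truncations, as an algebra homomorphism. -/
noncomputable def pullbackTranslate (h : ∀ n s, ⊤ ≤ (truncation hU K I n ≫ α.translate s) ⁻¹ᵁ U)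
    (h' : ∀ n, ⊤ ≤ truncation hU K I n ⁻¹ᵁ U) (n : ℕ) (s : ℂˣ) :
    Γ(X.toScheme, U) →ₐ[ℂ] (Γ(X.toScheme, U) ⧸ K) ⧸ (I.map (Ideal.Quotient.mk K)) ^ n where
  toRingHom := pullback (truncation hU K I n ≫ α.translate s) (h n s)
  commutes' c := by
    -- The action is over `Spec ℂ`, so constants pull back to themselves.
    have e : (truncation hU K I n ≫ α.translate s) ≫ X.str = truncation hU K I n ≫ X.str := by
      rw [comp_translate, α.act_str]
    have h1 := pullback_algebraMap (truncation hU K I n ≫ α.translate s) (h n s) c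
    rw [e, ← pullback_algebraMap (truncation hU K I n) (h' n) c] at h1
    refine h1.trans ?_
    have h2 := pullback_specMap_fromSpec hU
      ((Ideal.Quotient.mk ((I.map (Ideal.Quotient.mk K)) ^ n)).comp (Ideal.Quotient.mk K)) (h' n)
    exact congrArg (fun g : Γ(X.toScheme, U) →+* _ => g (algebraMap ℂ _ c)) h2

end Weight

section Orbit

open ComplexVariety

variable {U : X.toScheme.Opens} (hU : IsAffineOpen U) (K : Ideal Γ(X.toScheme, U)) {y : X.Point}

/-- The zero locus of the vanishing ideal is the closure, and the set is already closed in `U`. -/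
lemma fromSpec_mem_of_vanishingIdeal_le {Z : Set X.toScheme}
    (hZ : ∃ Z' : Set X.toScheme, IsClosed Z' ∧ Z = Z' ∩ U) (P : PrimeSpectrum Γ(X.toScheme, U))
    (h : vanishingIdeal hU Z ≤ P.asIdeal) : hU.fromSpec P ∈ Z := by
  obtain ⟨Z', hZ', hZ⟩ := hZ
  let C : Set (PrimeSpectrum Γ(X.toScheme, U)) := hU.fromSpec ⁻¹' Z
  have hclosed : IsClosed (hU.fromSpec ⁻¹' Z) := by
    have : hU.fromSpec ⁻¹' Z = hU.fromSpec ⁻¹' Z' := by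
      rw [hZ, Set.preimage_inter]
      refine Set.inter_eq_left.2 fun x _ => ?_
      have : hU.fromSpec x ∈ Set.range hU.fromSpec := ⟨x, rfl⟩
      rwa [hU.range_fromSpec] at this
    rw [this]
    exact hZ'.preimage hU.fromSpec.continuous
  have hmem : P ∈ closure C := by
    rw [← PrimeSpectrum.zeroLocus_vanishingIdeal_eq_closure, PrimeSpectrum.mem_zeroLocus]
    exact h
  have hC : closure C = C := IsClosed.closure_eq hclosed
  rw [hC] at hmem
  exact hmem

/-- Functions vanishing on `Z` are nilpotent on a truncation, hence belong to each of its primes. -/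
lemma range_truncation_subset {Z : Set X.toScheme}
    (hZ : ∃ Z' : Set X.toScheme, IsClosed Z' ∧ Z = Z' ∩ U) (n : ℕ) :
    Set.range (truncation hU K (vanishingIdeal hU Z) n) ⊆ Z := by
  rintro _ ⟨p, rfl⟩
  set φ := (Ideal.Quotient.mk (((vanishingIdeal hU Z).map (Ideal.Quotient.mk K)) ^ n)).comp
    (Ideal.Quotient.mk K)
  have e : truncation hU K (vanishingIdeal hU Z) n p
      = hU.fromSpec (Spec.map (CommRingCat.ofHom φ) p) := by
    rw [truncation, Scheme.Hom.comp_apply]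
  rw [e]
  refine fromSpec_mem_of_vanishingIdeal_le hU hZ _ fun i hi => ?_
  have h1 : φ i ^ n = 0 := by
    rw [← map_pow]
    refine Ideal.Quotient.eq_zero_iff_mem.2 ?_
    rw [map_pow]
    exact Ideal.pow_mem_pow (Ideal.mem_map_of_mem _ hi) n
  have h2 : φ i ∈ PrimeSpectrum.asIdeal p :=
    (PrimeSpectrum.isPrime p).mem_of_pow_mem n (h1 ▸ zero_mem _)
  exact h2

/-- Truncations are supported on the orbit, which is stable under translation and contained in `U`.
So functions on `U` can be pulled back along `x ↦ s · x`. -/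
lemma truncation_translate_le (hL : ∃ Z : Set X.toScheme, IsClosed Z ∧ α.orbit y = Z ∩ U)
    (n : ℕ) (s : ℂˣ) :
    ⊤ ≤ (truncation hU K (vanishingIdeal hU (α.orbit y)) n ≫ α.translate s) ⁻¹ᵁ U := by
  refine preimage_eq_top _ ?_
  rintro _ ⟨p, rfl⟩
  rw [Scheme.Hom.comp_apply]
  have := α.translate_mem_orbit y s (range_truncation_subset hU K hL n ⟨p, rfl⟩)
  obtain ⟨Z, -, hZ⟩ := hL
  exact (hZ.le this).2

lemma truncation_le (hL : ∃ Z : Set X.toScheme, IsClosed Z ∧ α.orbit y = Z ∩ U) (n : ℕ) :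
    ⊤ ≤ truncation hU K (vanishingIdeal hU (α.orbit y)) n ⁻¹ᵁ U := by
  refine preimage_eq_top _ ((range_truncation_subset hU K hL n).trans ?_)
  obtain ⟨Z, -, hZ⟩ := hL
  exact fun _ h => (hZ.le h).2

end Orbit

end GmAction

/-! ### Weight vectors in standard coordinates -/

namespace StandardCoordinates

variable {A : Type u} [CommRing A] [Algebra ℂ A] {J : Ideal A}
  {π : Bivector (AdicCompletion J A)} {W : ℤ → Set (AdicCompletion J A)} {m : ℕ} {k : ℤ}
  (c : StandardCoordinates π W m k)

lemma exists_finsupp_of_mem_laurentPolys {x : AdicCompletion J A} (hx : x ∈ c.laurentPolys) :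
    ∃ b : ℤ →₀ c.polys, x = ∑ j ∈ b.support,
      ((c.t ^ j : (AdicCompletion J A)ˣ) : AdicCompletion J A) * b j := by
  let L : (ℤ →₀ c.polys) →ₗ[ℂ] AdicCompletion J A := Finsupp.lsum ℂ fun j : ℤ =>
    LinearMap.mulLeft ℂ ((c.t ^ j : (AdicCompletion J A)ˣ) : AdicCompletion J A) ∘ₗ
      c.polys.val.toLinearMap
  have h : c.laurentPolys ≤ LinearMap.range L := by
    refine Submodule.span_le.2 ?_
    rintro _ ⟨j, b, hb, rfl⟩
    exact ⟨Finsupp.single j ⟨b, hb⟩, by simp [L]⟩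
  obtain ⟨b, rfl⟩ := h hx
  exact ⟨b, rfl⟩

/-- The description of weight vectors in coordinates, if weights are eigenvalues of algebra
endomorphisms of all truncations. -/
theorem weightsAreStandard_of_eigen (hJ : J.FG)
    (σ : ∀ n : ℕ, ℂˣ → (A ⧸ J ^ n) →ₐ[ℂ] (A ⧸ J ^ n))
    (hσ : ∀ d f, f ∈ W d ↔ ∀ n s, σ n s (AdicCompletion.evalₐ J n f)
      = ((s ^ d : ℂˣ) : ℂ) • AdicCompletion.evalₐ J n f) : c.WeightsAreStandard := by
  have hone : (1 : AdicCompletion J A) ∈ W 0 := by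
    rw [hσ]; intro n s; simp
  have hmul {i j : ℤ} {a b : AdicCompletion J A} (ha : a ∈ W i) (hb : b ∈ W j) :
      a * b ∈ W (i + j) := by
    rw [hσ] at *
    intro n s
    rw [map_mul, map_mul, ha, hb, smul_mul_smul_comm, zpow_add, Units.val_mul]
  have ht : ((c.t : (AdicCompletion J A)ˣ) : AdicCompletion J A) ∈ W 1 := c.weight_t
  have ht' : ((c.t⁻¹ : (AdicCompletion J A)ˣ) : AdicCompletion J A) ∈ W (-1) := by
    rw [hσ] at *
    intro n s
    have e : AdicCompletion.evalₐ J n ((c.t⁻¹ : (AdicCompletion J A)ˣ) : AdicCompletion J A) *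
        AdicCompletion.evalₐ J n (c.t : AdicCompletion J A) = 1 := by
      rw [← map_mul, Units.inv_mul, map_one]
    have e' := congrArg (σ n s) e
    rw [map_mul, ht, map_one] at e'
    set x := AdicCompletion.evalₐ J n ((c.t⁻¹ : (AdicCompletion J A)ˣ) : AdicCompletion J A)
    set w := AdicCompletion.evalₐ J n (c.t : AdicCompletion J A)
    have hs : ((s ^ (-1 : ℤ) : ℂˣ) : ℂ) * ((s ^ (1 : ℤ) : ℂˣ) : ℂ) = 1 := by
      rw [← Units.val_mul, ← zpow_add]; simp
    calc σ n s x = σ n s x * (((s ^ (1 : ℤ) : ℂˣ) : ℂ) • w) *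
          (((s ^ (-1 : ℤ) : ℂˣ) : ℂ) • x) := by
          rw [mul_assoc, smul_mul_smul_comm, mul_comm w, e, mul_comm _ ((s ^ (-1 : ℤ) : ℂˣ) : ℂ), hs,
            one_smul, mul_one]
      _ = _ := by rw [e', one_mul]
  have htz (j : ℤ) : ((c.t ^ j : (AdicCompletion J A)ˣ) : AdicCompletion J A) ∈ W j := by
    induction j with
    | zero => simpa using hone
    | succ n ih => rw [zpow_add_one, Units.val_mul]; exact hmul ih ht
    | pred n ih => rw [zpow_sub_one, Units.val_mul, sub_eq_add_neg]; exact hmul ih ht'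
  have hx (i) : c.x i ∈ W 0 := by
    match i with
    | none => exact c.weight_u
    | some (Sum.inl i) => exact c.weight_zodd i
    | some (Sum.inr i) => exact c.weight_zeven i
  have hpolys {b : AdicCompletion J A} (hb : b ∈ c.polys) : b ∈ W 0 := by
    induction hb using Algebra.adjoin_induction with
    | mem x h => obtain ⟨i, rfl⟩ := h; exact hx i
    | algebraMap r =>
      rw [hσ]; intro n s
      rw [Algebra.algebraMap_eq_smul_one, Bivector.evalₐ_smul]; simp
    | add x y _ _ h h' =>
      rw [hσ] at *; intro n s
      rw [map_add, map_add, h, h', smul_add]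
    | mul x y _ _ h h' => exact hmul h h'
  have hterm (j : ℤ) {b : AdicCompletion J A} (hb : b ∈ c.polys) :
      ((c.t ^ j : (AdicCompletion J A)ˣ) : AdicCompletion J A) * b ∈ W j := by
    simpa using hmul (htz j) (hpolys hb)
  intro d a
  constructor
  · intro ha n
    obtain ⟨x, hx, hax⟩ := c.adicDense_laurentPolys hJ a n
    obtain ⟨b, rfl⟩ := c.exists_finsupp_of_mem_laurentPolys hx
    refine ⟨b d, (b d).2, ?_⟩
    rw [← evalₐ_eq_zero_iff hJ] at hax ⊢
    set E := AdicCompletion.evalₐ J n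
    have h2 (j : ℤ) : ((Units.mk0 (2 : ℂ) two_ne_zero ^ j : ℂˣ) : ℂ) = 2 ^ j := by simp
    -- Modulo `J ^ n`, `a` is a sum of terms `t ^ j b_j`. Moving `a` into the place of weight `d`
    -- gives eigenvectors for distinct eigenvalues with sum zero. They all vanish, and the one of
    -- index `d` says `a = t ^ d b_d`.
    let e : ℤ → A ⧸ J ^ n := fun j =>
      (if j = d then E a else 0) - E (((c.t ^ j : (AdicCompletion J A)ˣ) : AdicCompletion J A) * b j)
    have key := mem_of_sum_mem_of_eigen (⊥ : Submodule ℂ (A ⧸ J ^ n))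
      (σ n (Units.mk0 2 two_ne_zero)).toLinearMap (fun x hx => by
        rw [Submodule.mem_bot] at *; rw [hx, map_zero]) (insert d b.support) e
      (fun j _ => by
        rw [Submodule.mem_bot, sub_eq_zero, ← h2]
        change σ n _ (_ - _) = _
        rw [map_sub, (hσ _ _).1 (hterm j (b j).2)]
        split_ifs with hj
        · subst hj
          rw [(hσ _ _).1 ha, ← smul_sub]
          simp [e, E]
        · simp [e, hj, E])
      (by
        rw [Submodule.mem_bot, Finset.sum_sub_distrib, Finset.sum_ite_eq', if_pos (by simp),
          ← map_sum, ← map_sub, ← hax]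
        congr 2
        refine (Finset.sum_subset (Finset.subset_insert _ _) fun j _ hj => ?_).symm
        rw [Finsupp.notMem_support_iff.1 hj]; simp)
      d (by simp)
    rw [Submodule.mem_bot] at key
    simpa [e] using key
  · intro h
    rw [hσ]
    intro n s
    obtain ⟨b, hb, hab⟩ := h n
    rw [← evalₐ_eq_zero_iff hJ, map_sub, sub_eq_zero] at hab
    rw [hab, (hσ _ _).1 (hterm d hb)]

/-- Variant with homomorphisms defined on an algebra surjecting to `A`. -/
theorem weightsAreStandard_of_lifts (hJ : J.FG) {R : Type*} [CommRing R] [Algebra ℂ R]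
    (p : R →ₐ[ℂ] A) (hp : Function.Surjective p) (σ : ∀ n : ℕ, ℂˣ → R →ₐ[ℂ] (A ⧸ J ^ n))
    (hσ : ∀ d f, f ∈ W d ↔ ∀ n s r, Ideal.Quotient.mk (J ^ n) (p r) = AdicCompletion.evalₐ J n f →
      σ n s r = ((s ^ d : ℂˣ) : ℂ) • AdicCompletion.evalₐ J n f) : c.WeightsAreStandard := by
  let P (n : ℕ) : R →ₐ[ℂ] A ⧸ J ^ n := (Ideal.Quotient.mkₐ ℂ (J ^ n)).comp p
  have hP (n) : Function.Surjective (P n) := Ideal.Quotient.mk_surjective.comp hp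
  -- The weight condition holds for every representative of a weight vector. Applied to `t` and to
  -- two representatives differing by `r`, it forces `σ` to kill `r`, so `σ` descends to the
  -- truncation.
  have hker (n s) : ∀ r ∈ RingHom.ker (P n), σ n s r = 0 := by
    intro r hr
    have ht := (hσ 1 _).1 c.weight_t n s
    obtain ⟨r₀, hr₀⟩ := hP n (AdicCompletion.evalₐ J n (c.equiv (StandardRing.tpow m 1)))
    have h1 := ht r₀ hr₀
    have h2 := ht (r₀ + r) (by
      change P n (r₀ + r) = _
      rw [map_add, hr₀, (RingHom.mem_ker).1 hr, add_zero])
    rwa [map_add, h1, add_eq_left] at h2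
  let τ (n s) : (A ⧸ J ^ n) →ₐ[ℂ] (A ⧸ J ^ n) :=
    (Ideal.Quotient.liftₐ (RingHom.ker (P n)) (σ n s) (hker n s)).comp
      ((Ideal.quotientKerAlgEquivOfSurjective (hP n)).symm : _ →ₐ[ℂ] _)
  have hτ (n s r) : τ n s (P n r) = σ n s r := by
    have : (Ideal.quotientKerAlgEquivOfSurjective (hP n)).symm (P n r)
        = Ideal.Quotient.mk _ r := by
      rw [AlgEquiv.symm_apply_eq]; rfl
    change Ideal.Quotient.liftₐ (RingHom.ker (P n)) (σ n s) (hker n s) ((Ideal.quotientKerAlgEquivOfSurjective (hP n)).symm _) = _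
    rw [this]; rfl
  refine c.weightsAreStandard_of_eigen hJ τ fun d f => ?_
  rw [hσ]
  refine forall_congr' fun n => forall_congr' fun s => ⟨fun h => ?_, fun h r hr => ?_⟩
  · obtain ⟨r, hr⟩ := hP n (AdicCompletion.evalₐ J n f)
    rw [← h r hr, ← hr, hτ]
  · rw [← h, ← hr]; exact (hτ n s r).symm

end StandardCoordinates

namespace GmAction

open ComplexVariety

variable {X : ComplexVariety} (α : GmAction X) {y : X.Point} {U : X.toScheme.Opens}

/-- Along an orbit closed in an affine open, the functions of weight `d` are the limits of products
of `t ^ d` and polynomials in the other coordinates. -/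
theorem weightsAreStandard (hU : IsAffineOpen U) (K : Ideal Γ(X.toScheme, U))
    (hL : ∃ Z : Set X.toScheme, IsClosed Z ∧ α.orbit y = Z ∩ U)
    (hJ : ((vanishingIdeal hU (α.orbit y)).map (Ideal.Quotient.mk K)).FG)
    {π : Bivector (FormalRing K (vanishingIdeal hU (α.orbit y)))} {m : ℕ} {k : ℤ}
    (c : StandardCoordinates π (α.weight hU K (vanishingIdeal hU (α.orbit y))) m k) :
    c.WeightsAreStandard :=
  c.weightsAreStandard_of_lifts hJ (Ideal.Quotient.mkₐ ℂ K) Ideal.Quotient.mk_surjective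
    (α.pullbackTranslate hU K _ (α.truncation_translate_le hU K hL) (α.truncation_le hU K hL))
    (fun d f => α.mem_weight_iff hU K _ (α.truncation_translate_le hU K hL) d f)

end GmAction

/-! ### Complex points of affine opens -/

namespace ComplexVariety

variable {X : ComplexVariety} {U : X.toScheme.Opens}

lemma isNoetherianRing_sections (hU : IsAffineOpen U) : IsNoetherianRing Γ(X.toScheme, U) :=
  have := PoissonStructure.finiteType_sections X hU
  Algebra.FiniteType.isNoetherianRing ℂ _

lemma map_mk_fg (hU : IsAffineOpen U) (K I : Ideal Γ(X.toScheme, U)) :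
    (I.map (Ideal.Quotient.mk K)).FG :=
  have := isNoetherianRing_sections hU
  Ideal.FG.map (IsNoetherian.noetherian I) _

lemma Point.range_subset {y : X.Point} (hU : y.support ⊆ U) : ⊤ ≤ y.hom ⁻¹ᵁ U :=
  preimage_eq_top _ hU

/-- Evaluation at a complex point of `U`. -/
noncomputable def Point.eval (y : X.Point) (hy : y.support ⊆ U) : Γ(X.toScheme, U) →ₐ[ℂ] ℂ where
  toRingHom := pullback y.hom (Point.range_subset hy)
  commutes' c := by
    refine (pullback_algebraMap y.hom (Point.range_subset hy) c).trans ?_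
    rw [y.hom_str, Scheme.Hom.id_appTop]
    exact ConcreteCategory.congr_hom (Scheme.ΓSpecIso (.of ℂ)).inv_hom_id c

/-- The point factors through the spectrum of the functions on `U` by evaluation, so its image there
is the kernel of evaluation. -/
lemma Point.eval_eq_zero_iff (hU : IsAffineOpen U) (y : X.Point) (hy : y.support ⊆ U)
    (f : Γ(X.toScheme, U)) : y.eval hy f = 0 ↔ f ∈ vanishingIdeal hU y.support := by
  set ψ := pullback y.hom (Point.range_subset hy)
  have e (q : Spec (.of ℂ)) : hU.fromSpec (Spec.map (CommRingCat.ofHom ψ) q) = y.hom q := by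
    rw [← Scheme.Hom.comp_apply, specMap_pullback_fromSpec]
  rw [vanishingIdeal, PrimeSpectrum.mem_vanishingIdeal]
  change ψ f = 0 ↔ _
  constructor
  · rintro hf x ⟨q, hq⟩
    have hx : x = Spec.map (CommRingCat.ofHom ψ) q :=
      hU.fromSpec.isOpenEmbedding.injective (hq.symm.trans (e q).symm)
    rw [hx]
    change ψ f ∈ PrimeSpectrum.asIdeal q
    rw [hf]
    exact zero_mem _
  · intro h
    let q : Spec (.of ℂ) := (⊥ : PrimeSpectrum ℂ)
    have := h (Spec.map (CommRingCat.ofHom ψ) q) ⟨q, (e q).symm⟩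
    exact this

lemma vanishingIdeal_anti (hU : IsAffineOpen U) {Z Z' : Set X.toScheme} (h : Z ⊆ Z') :
    vanishingIdeal hU Z' ≤ vanishingIdeal hU Z :=
  PrimeSpectrum.vanishingIdeal_anti_mono (Set.preimage_mono h)

end ComplexVariety

lemma Bivector.IsPoisson.quotient {A : Type u} [CommRing A] [Algebra ℂ A] {π : Bivector A}
    (hπ : π.IsPoisson) (K : Ideal A) (hK : ∀ a, ∀ h ∈ K, π.br a h ∈ K) :
    (π.quotient K hK).IsPoisson := fun x y z => by
  obtain ⟨a, rfl⟩ := Ideal.Quotient.mk_surjective x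
  obtain ⟨b, rfl⟩ := Ideal.Quotient.mk_surjective y
  obtain ⟨c, rfl⟩ := Ideal.Quotient.mk_surjective z
  simp only [Bivector.quotient_br_mk, ← map_add, hπ a b c]

/-! ### Complex points of formal schemes -/

section Characters

variable {R : Type*} [CommRing R] [Algebra ℂ R] {J : Ideal R}

/-- Complex points of a formal scheme lie on the subscheme of an ideal of definition. -/
lemma character_eq_zero_of_mem [IsAdicComplete J R] (χ : R →ₐ[ℂ] ℂ) {x : R} (hx : x ∈ J) :
    χ x = 0 := by
  by_contra h
  -- `1 - x / χ x` is a unit by completeness, yet `χ` kills it.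
  have h1 := isUnit_one_add_of_mem (J := J) (J.smul_of_tower_mem (-(χ x)⁻¹) hx)
  have h2 := h1.map χ
  rw [map_add, map_one, map_smul, smul_eq_mul, neg_mul, inv_mul_cancel₀ h, add_neg_cancel] at h2
  exact not_isUnit_zero h2

/-- A description of the functions vanishing at a complex point by topological generators. -/
lemma sub_character_mem [IsAdicComplete J R] (χ : R →ₐ[ℂ] ℂ) {G : Set R} (hG : TopGenerates J G)
    {I : Ideal R} (hJI : J ≤ I) (hI : ∀ x ∈ I, χ x = 0) (h : ∀ x ∈ G, ∃ c : ℂ, x - algebraMap ℂ R c ∈ I)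
    (x : R) : x - algebraMap ℂ R (χ x) ∈ I := by
  let 𝒮 : Subalgebra ℂ R :=
    { carrier := {x | x - algebraMap ℂ R (χ x) ∈ I}
      mul_mem' := fun {a b} ha hb => by
        replace ha : a - algebraMap ℂ R (χ a) ∈ I := ha
        replace hb : b - algebraMap ℂ R (χ b) ∈ I := hb
        have := add_mem (I.mul_mem_left a hb) (I.mul_mem_left (algebraMap ℂ R (χ b)) ha)
        change _ - _ ∈ I
        rw [map_mul, map_mul]
        convert this using 1; ring
      add_mem' := fun {a b} ha hb => by
        replace ha : a - algebraMap ℂ R (χ a) ∈ I := ha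
        replace hb : b - algebraMap ℂ R (χ b) ∈ I := hb
        have := add_mem ha hb
        change _ - _ ∈ I
        rw [map_add, map_add]
        convert this using 1; ring
      algebraMap_mem' := fun r => by
        change _ - _ ∈ I
        simp }
  have hc {x : R} {c : ℂ} (hx : x - algebraMap ℂ R c ∈ I) : c = χ x := by
    have := hI _ hx
    rw [map_sub, AlgHom.commutes, sub_eq_zero] at this
    exact this.symm
  -- Elements congruent to their value modulo `I` form a subalgebra closed under inverses. Precision
  -- `1` is enough since `J ≤ I`.
  obtain ⟨y, hy, hxy⟩ := hG 𝒮 (fun x hx => by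
      obtain ⟨c, hxc⟩ := h x hx
      change _ - _ ∈ I
      rwa [← hc hxc])
    (fun x hx y hxy => by
      have h1 : χ x * χ y = 1 := by rw [← map_mul, hxy, map_one]
      have h2 : algebraMap ℂ R (χ x) * algebraMap ℂ R (χ y) = 1 := by rw [← map_mul, h1, map_one]
      change y - _ ∈ I
      have : y - algebraMap ℂ R (χ y) = -(algebraMap ℂ R (χ y) * y) * (x - algebraMap ℂ R (χ x)) := by
        linear_combination (algebraMap ℂ R (χ y)) * hxy - y * h2
      rw [this]
      exact I.mul_mem_left _ hx) x 1
  rw [pow_one] at hxy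
  have h3 : χ x = χ y := by
    have := hI _ (hJI hxy)
    rwa [map_sub, sub_eq_zero] at this
  have := add_mem (hJI hxy) hy
  rw [h3]
  simpa using this

end Characters

/-! ### Darboux coordinates at a point of the leaf -/

namespace StandardCoordinates

open StandardRing

variable {A : Type u} [CommRing A] [Algebra ℂ A] {J : Ideal A}
  {π : Bivector (AdicCompletion J A)} {W : ℤ → Set (AdicCompletion J A)} {m : ℕ} {k : ℤ}
  (c : StandardCoordinates π W m k)

/-- The Darboux coordinates `t ^ (k - 1) u` and `z'_{2i+1}`. -/
noncomputable def momenta : Fin (m + 1) → AdicCompletion J A :=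
  Fin.cons (((c.t ^ (k - 1) : (AdicCompletion J A)ˣ) : AdicCompletion J A) * c.equiv (u m))
    fun i => c.equiv (zodd' k i)

/-- The Darboux coordinates `t - l` and `z_{2i+2}`. -/
noncomputable def positions (l : ℂ) : Fin (m + 1) → AdicCompletion J A :=
  Fin.cons ((c.t : AdicCompletion J A) - algebraMap ℂ _ l) fun i => c.equiv (zeven i)

lemma br_zpow_eq_zero {a : AdicCompletion J A} (h : π.br (c.equiv (tpow m 1)) a = 0) (d : ℤ) :
    π.br ((c.t ^ d : (AdicCompletion J A)ˣ) : AdicCompletion J A) a = 0 := by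
  rw [π.skew, Bivector.br_zpow, π.skew a, coe_t, h]; simp

lemma br_momenta_momenta (i j : Fin (m + 1)) : π.br (c.momenta i) (c.momenta j) = 0 := by
  have h0 (i : Fin m) : π.br (c.momenta 0) (c.momenta i.succ) = 0 := by
    simp only [momenta, Fin.cons_zero, Fin.cons_succ]
    rw [Bivector.leibniz_left, c.br_u_zodd, c.br_zpow_eq_zero (c.br_t_zodd i)]; simp
  induction i using Fin.cases with
  | zero =>
    induction j using Fin.cases with
    | zero => exact Bivector.br_self _ _
    | succ j => exact h0 j
  | succ i =>
    induction j using Fin.cases with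
    | zero => rw [π.skew, h0, neg_zero]
    | succ j => exact c.br_zodd_zodd i j

lemma br_positions_positions (l : ℂ) (i j : Fin (m + 1)) :
    π.br (c.positions l i) (c.positions l j) = 0 := by
  have h0 (i : Fin m) : π.br (c.positions l 0) (c.positions l i.succ) = 0 := by
    simp only [positions, Fin.cons_zero, Fin.cons_succ]
    rw [map_sub, LinearMap.sub_apply, Bivector.algebraMap_br, coe_t, c.br_t_zeven, sub_zero]
  induction i using Fin.cases with
  | zero =>
    induction j using Fin.cases with
    | zero => exact Bivector.br_self _ _
    | succ j => exact h0 j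
  | succ i =>
    induction j using Fin.cases with
    | zero => rw [π.skew, h0, neg_zero]
    | succ j => exact c.br_zeven_zeven i j

/-- The factor `t ^ (k - 1)` normalizes `{u, t} = t ^ (1 - k)` to `1`; the constant `l` does not
affect brackets. -/
lemma br_momenta_positions (l : ℂ) (i j : Fin (m + 1)) :
    π.br (c.momenta i) (c.positions l j) = if i = j then 1 else 0 := by
  induction i using Fin.cases with
  | zero =>
    induction j using Fin.cases with
    | zero =>
      simp only [positions, momenta, Fin.cons_zero, if_true]
      rw [map_sub, Bivector.br_algebraMap, sub_zero, Bivector.leibniz_left, c.br_t_eq, du_u,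
        mul_one, ← Units.val_mul, ← zpow_add, c.br_zpow_eq_zero (a := (c.t : AdicCompletion J A)) (Bivector.br_self _ _)]
      simp
    | succ j =>
      simp only [positions, momenta, Fin.cons_zero, Fin.cons_succ]
      rw [Bivector.leibniz_left, c.br_u_zeven, c.br_zpow_eq_zero (c.br_t_zeven j),
        if_neg (Fin.succ_ne_zero j).symm]
      simp
  | succ i =>
    induction j using Fin.cases with
    | zero =>
      simp only [positions, momenta, Fin.cons_zero, Fin.cons_succ]
      rw [map_sub, Bivector.br_algebraMap, π.skew, coe_t, c.br_t_zodd, if_neg (Fin.succ_ne_zero i)]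
      simp
    | succ j =>
      simp only [positions, momenta, Fin.cons_succ, Fin.succ_inj]
      exact c.br_zodd_zeven i j

/-- The ideal generated by the Darboux coordinates. -/
noncomputable def darbouxIdeal (l : ℂ) : Ideal (AdicCompletion J A) :=
  Ideal.span (Set.range c.momenta ∪ Set.range (c.positions l))

lemma momenta_mem (l : ℂ) (i) : c.momenta i ∈ c.darbouxIdeal l :=
  Ideal.subset_span (Or.inl ⟨i, rfl⟩)

lemma positions_mem (l : ℂ) (i) : c.positions l i ∈ c.darbouxIdeal l :=
  Ideal.subset_span (Or.inr ⟨i, rfl⟩)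

/-- The coordinates `u` and `z_{2i+1}` differ from the momenta by powers of the unit `t`. -/
lemma x_mem (l : ℂ) (i) : c.x i ∈ c.darbouxIdeal l := by
  match i with
  | none =>
    have h := Ideal.mul_mem_left _ ((c.t ^ (1 - k) : (AdicCompletion J A)ˣ) : AdicCompletion J A)
      (c.momenta_mem l 0)
    rw [momenta, Fin.cons_zero, ← mul_assoc, ← Units.val_mul, ← zpow_add] at h
    rw [sub_add_sub_cancel', sub_self, zpow_zero, Units.val_one, one_mul] at h
    exact h
  | some (Sum.inl i) =>
    have h := Ideal.mul_mem_left _ ((c.t ^ (-k) : (AdicCompletion J A)ˣ) : AdicCompletion J A)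
      (c.momenta_mem l i.succ)
    rw [momenta, Fin.cons_succ, ← zodd_eq] at h
    exact h
  | some (Sum.inr i) => exact c.positions_mem l i.succ

lemma idealOfDefinition_le (hJ : J.FG) (l : ℂ) : idealOfDefinition J ≤ c.darbouxIdeal l := by
  rw [c.idealOfDefinition_eq hJ, Ideal.span_le]
  rintro _ ⟨i, rfl⟩
  exact c.x_mem l i

lemma zodd'_mem_idealOfDefinition (hJ : J.FG) (i) : c.equiv (zodd' k i) ∈ idealOfDefinition J := by
  rw [c.idealOfDefinition_eq hJ, zodd', map_mul]
  exact Ideal.mul_mem_left _ _ (Ideal.subset_span ⟨some (Sum.inl i), rfl⟩)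

/-- The coordinates `u` and `z_i` vanish at any complex point, being in the ideal of definition; `t`
need not, which is why its value there is subtracted. -/
lemma character_darbouxIdeal (hJ : J.FG) (χ : AdicCompletion J A →ₐ[ℂ] ℂ) :
    ∀ x ∈ c.darbouxIdeal (χ c.t), χ x = 0 := by
  have := isAdicComplete_idealOfDefinition hJ
  have hx (i) : χ (c.x i) = 0 := by
    refine character_eq_zero_of_mem (J := idealOfDefinition J) χ ?_
    rw [c.idealOfDefinition_eq hJ]
    exact Ideal.subset_span ⟨i, rfl⟩
  change c.darbouxIdeal (χ c.t) ≤ RingHom.ker χ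
  refine Ideal.span_le.2 ?_
  rintro _ (⟨i, rfl⟩ | ⟨i, rfl⟩)
  · induction i using Fin.cases with
    | zero =>
      refine Ideal.mul_mem_left (RingHom.ker χ) _ ?_
      exact hx none
    | succ i =>
      exact character_eq_zero_of_mem (J := idealOfDefinition J) χ
        (c.zodd'_mem_idealOfDefinition hJ i)
  · induction i using Fin.cases with
    | zero => change χ (_ - _) = 0; simp
    | succ i => exact hx (some (Sum.inr i))

/-- Functions vanishing at a point lie in the ideal generated by the Darboux coordinates. -/
lemma mem_darbouxIdeal (hJ : J.FG) (χ : AdicCompletion J A →ₐ[ℂ] ℂ) {x : AdicCompletion J A}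
    (hx : χ x = 0) : x ∈ c.darbouxIdeal (χ c.t) := by
  have := isAdicComplete_idealOfDefinition hJ
  have h := sub_character_mem χ (c.topGenerates hJ) (c.idealOfDefinition_le hJ _)
    (c.character_darbouxIdeal hJ χ) (fun x hx => ?_) x
  · simpa [hx] using h
  · obtain (rfl | rfl) | (⟨i, rfl⟩ | ⟨i, rfl⟩) := hx
    · exact ⟨χ c.t, c.positions_mem _ 0⟩
    · exact ⟨0, by rw [map_zero, sub_zero]; exact c.x_mem _ none⟩
    · exact ⟨0, by rw [map_zero, sub_zero]; exact c.momenta_mem _ i.succ⟩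
    · exact ⟨0, by rw [map_zero, sub_zero]; exact c.positions_mem _ i.succ⟩

end StandardCoordinates

namespace CompletedTensor

variable {O : Type u} [CommRing O] [Algebra ℂ O] {𝔞 : Ideal O} [IsAdicComplete 𝔞 O]
  {S : FormalPoissonGerm.{v}}

/-- The ideal of a complex point of the completed product with a formal germ. -/
lemma mem_of_character_eq_zero (ha : 𝔞.FG) (χ : CompletedTensor 𝔞 S.maxIdeal →ₐ[ℂ] ℂ)
    {x : CompletedTensor 𝔞 S.maxIdeal} (hx : χ x = 0) :
    x ∈ (RingHom.ker (χ.comp (fstHom 𝔞 S.maxIdeal))).map (fstHom 𝔞 S.maxIdeal) ⊔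
      S.maxIdeal.map (sndHom 𝔞 S.maxIdeal) := by
  have hm : S.maxIdeal.FG := IsNoetherian.noetherian _
  have := isAdicComplete ha hm
  set I := (RingHom.ker (χ.comp (fstHom 𝔞 S.maxIdeal))).map (fstHom 𝔞 S.maxIdeal) ⊔
      S.maxIdeal.map (sndHom 𝔞 S.maxIdeal)
  have hfst {a : O} (h : χ (fstHom 𝔞 S.maxIdeal a) = 0) : fstHom 𝔞 S.maxIdeal a ∈ I :=
    Ideal.mem_sup_left (Ideal.mem_map_of_mem _ h)
  have hsnd {f : S.carrier} (h : f ∈ S.maxIdeal) : sndHom 𝔞 S.maxIdeal f ∈ I :=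
    Ideal.mem_sup_right (Ideal.mem_map_of_mem _ h)
  have hI : I ≤ RingHom.ker χ := by
    refine sup_le (Ideal.map_le_iff_le_comap.2 fun a h => h) (Ideal.map_le_iff_le_comap.2 ?_)
    intro f hf
    exact character_eq_zero_of_mem (J := ideal 𝔞 S.maxIdeal) χ (sndHom_mem hf)
  have hG : TopGenerates (ideal 𝔞 S.maxIdeal)
      (fstHom 𝔞 S.maxIdeal '' Set.univ ∪ sndHom 𝔞 S.maxIdeal '' Set.univ) :=
    topGenerates ha hm (fun 𝒮 h _ x n => ⟨x, h trivial, by simp⟩)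
      (fun 𝒮 h _ x n => ⟨x, h trivial, by simp⟩)
  have h := sub_character_mem χ hG (I := I)
    (ideal_le (fun a h => hfst (character_eq_zero_of_mem (J := 𝔞) (χ.comp (fstHom 𝔞 S.maxIdeal)) h))
      fun f hf => hsnd hf) hI ?_ x
  · simpa [hx] using h
  · rintro _ (⟨a, -, rfl⟩ | ⟨f, -, rfl⟩)
    · refine ⟨χ (fstHom 𝔞 S.maxIdeal a), ?_⟩
      rw [← (fstHom 𝔞 S.maxIdeal).commutes, ← map_sub]
      exact hfst (by rw [map_sub, map_sub]; simp)
    · obtain ⟨r, hr⟩ := S.exists_sub_algebraMap_mem f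
      refine ⟨r, ?_⟩
      rw [← (sndHom 𝔞 S.maxIdeal).commutes, ← map_sub]
      exact hsnd hr

end CompletedTensor

/-! ### The completed local ring at a complex point -/

section LocalCompletion

variable {A : Type u} [CommRing A] [Algebra ℂ A] {I : Ideal A} {χ : A →ₐ[ℂ] ℂ}

/-- Extension of a complex point to a formal neighbourhood. -/
lemma exists_character_completion (hχ : ∀ a ∈ I, χ a = 0) :
    ∃ χ' : AdicCompletion I A →ₐ[ℂ] ℂ, ∀ a, χ' (AdicCompletion.of I A a) = χ a :=
  -- `ℂ` is complete for the zero ideal, so a character killing `I` extends to the completion.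
  exists_lift_completion (K := (⊥ : Ideal ℂ)) χ hχ

variable (hI : I.FG) (hχ : ∀ a, χ a = 0 ↔ a ∈ I)
include hI hχ

lemma sub_character_mem_idealOfDefinition (χ' : AdicCompletion I A →ₐ[ℂ] ℂ)
    (x : AdicCompletion I A) :
    x - algebraMap ℂ _ (χ' x) ∈ idealOfDefinition I := by
  have := isAdicComplete_idealOfDefinition hI
  refine sub_character_mem χ' (topGenerates_range_of hI) le_rfl
    (fun x hx => character_eq_zero_of_mem χ' hx) ?_ x
  rintro _ ⟨a, rfl⟩
  refine ⟨χ a, ?_⟩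
  have : AdicCompletion.of I A (a - algebraMap ℂ A (χ a)) ∈ idealOfDefinition I :=
    of_mem_idealOfDefinition ((hχ _).1 (by simp))
  rwa [← AdicCompletion.ofAlgHom'_apply, map_sub, AlgHom.commutes] at this

lemma mem_idealOfDefinition_iff (χ' : AdicCompletion I A →ₐ[ℂ] ℂ)
    (x : AdicCompletion I A) :
    x ∈ idealOfDefinition I ↔ χ' x = 0 := by
  have := isAdicComplete_idealOfDefinition hI
  refine ⟨fun h => character_eq_zero_of_mem χ' h, fun h => ?_⟩
  simpa [h] using sub_character_mem_idealOfDefinition hI hχ χ' x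

/-- It is the kernel of the extended character, which is onto `ℂ`. -/
lemma isMaximal_idealOfDefinition : (idealOfDefinition I).IsMaximal := by
  obtain ⟨χ', -⟩ := exists_character_completion (fun a ha => (hχ a).2 ha)
  have : idealOfDefinition I = RingHom.ker χ' :=
    Ideal.ext fun x => mem_idealOfDefinition_iff hI hχ χ' x
  rw [this]
  exact RingHom.ker_isMaximal_of_surjective χ' fun r => ⟨algebraMap ℂ _ r, by simp⟩

lemma isLocalRing_completion : IsLocalRing (AdicCompletion I A) :=
  have := isAdicComplete_idealOfDefinition hI
  have := isMaximal_idealOfDefinition hI hχ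
  isLocalRing_of_isAdicComplete_maximal (idealOfDefinition I)

lemma maximalIdeal_completion [IsLocalRing (AdicCompletion I A)] :
    IsLocalRing.maximalIdeal (AdicCompletion I A) = idealOfDefinition I :=
  have := isMaximal_idealOfDefinition hI hχ
  (IsLocalRing.eq_maximalIdeal this).symm

end LocalCompletion

/-- Restriction to a smaller formal neighbourhood. -/
lemma exists_restriction {A : Type u} [CommRing A] [Algebra ℂ A] {J I : Ideal A} (hJ : J.FG)
    (hI : I.FG) (h : J ≤ I) (π : Bivector A) :
    ∃ γ : AdicCompletion J A →ₐ[ℂ] AdicCompletion I A,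
      (∀ a, γ (AdicCompletion.of J A a) = AdicCompletion.of I A a) ∧
      (∀ x ∈ idealOfDefinition J, γ x ∈ idealOfDefinition I) ∧
      ∀ x y, γ ((π.completion J).br x y) = (π.completion I).br (γ x) (γ y) := by
  have := isAdicComplete_idealOfDefinition hI
  have hmem (a) (ha : a ∈ J) : AdicCompletion.ofAlgHom' I a ∈ idealOfDefinition I :=
    of_mem_idealOfDefinition (h ha)
  obtain ⟨γ, hγ⟩ := exists_lift_completion (J := J) (AdicCompletion.ofAlgHom' I) hmem
  have hγI : ∀ x ∈ idealOfDefinition J, γ x ∈ idealOfDefinition I :=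
    map_idealOfDefinition_mem γ fun a ha => by rw [hγ]; exact hmem a ha
  refine ⟨γ, hγ, hγI, Bivector.map_br_of_topGenerates (topGenerates_range_of hJ) _ _ γ hγI ?_⟩
  rintro _ ⟨a, rfl⟩ _ ⟨b, rfl⟩
  rw [Bivector.completion_br_of, hγ, hγ, hγ]
  exact (Bivector.completion_br_of I π a b).symm

open CompletedTensor

/-- Slices from completed products. -/
lemma IsSlice.of_completedTensor {O : Type u} [CommRing O] [Algebra ℂ O] {𝔞 : Ideal O}
    {πO : Bivector O} {S : FormalPoissonGerm.{v}} {P : Type*} [CommRing P] [Algebra ℂ P]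
    [IsLocalRing P] {π : Bivector P} (G : CompletedTensor 𝔞 S.maxIdeal →ₐ[ℂ] P)
    (hG : ∀ x y, G (((πO.prod S.bivector).completion (tensorIdeal 𝔞 S.maxIdeal)).br x y)
      = π.br (G x) (G y)) {n : ℕ} {p q : Fin n → O} (hpp : ∀ i j, πO.br (p i) (p j) = 0)
    (hqq : ∀ i j, πO.br (q i) (q j) = 0) (hpq : ∀ i j, πO.br (p i) (q j) = if i = j then 1 else 0)
    (r : P →ₐ[ℂ] S.carrier) (hrs : ∀ f, r (G (sndHom 𝔞 _ f)) = f)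
    (hrp : ∀ i, r (G (fstHom 𝔞 _ (p i))) = 0) (hrq : ∀ i, r (G (fstHom 𝔞 _ (q i))) = 0)
    (hres : ∀ x, ∃ c : ℂ, x - algebraMap ℂ P c ∈ IsLocalRing.maximalIdeal P)
    (hmax : IsLocalRing.maximalIdeal P ≤
      ((Ideal.span (Set.range p ∪ Set.range q)).map (fstHom 𝔞 S.maxIdeal) ⊔
        S.maxIdeal.map (sndHom 𝔞 S.maxIdeal)).map G) :
    IsSlice π S (fun i => G (fstHom 𝔞 _ (p i))) (fun i => G (fstHom 𝔞 _ (q i)))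
      (G.comp (sndHom 𝔞 S.maxIdeal)) r where
  br_p_p i j := by rw [← hG, br_fst_fst, hpp, map_zero, map_zero]
  br_q_q i j := by rw [← hG, br_fst_fst, hqq, map_zero, map_zero]
  br_p_q i j := by rw [← hG, br_fst_fst, hpq]; split_ifs <;> simp
  br_p_s i f := by rw [AlgHom.comp_apply, ← hG, br_fst_snd, map_zero]
  br_q_s i f := by rw [AlgHom.comp_apply, ← hG, br_fst_snd, map_zero]
  br_s_s f g := by rw [AlgHom.comp_apply, AlgHom.comp_apply, ← hG, br_snd_snd]; rfl
  r_s := hrs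
  r_p := hrp
  r_q := hrq
  residue := hres
  maximalIdeal_le := by
    refine hmax.trans ?_
    rw [Ideal.map_le_iff_le_comap, sup_le_iff, Ideal.map_le_iff_le_comap,
      Ideal.map_le_iff_le_comap, Ideal.span_le]
    refine ⟨?_, fun f hf => Ideal.mem_sup_right
      (Ideal.mem_map_of_mem (G.comp (sndHom 𝔞 S.maxIdeal)) hf)⟩
    rintro _ (⟨i, rfl⟩ | ⟨i, rfl⟩)
    · exact Ideal.mem_sup_left (Ideal.subset_span (Or.inl ⟨i, rfl⟩))
    · exact Ideal.mem_sup_left (Ideal.subset_span (Or.inr ⟨i, rfl⟩))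

/-! ### Slices from the two kinds of decomposition -/

section Slices

variable {A : Type u} [CommRing A] [Algebra ℂ A] {J I : Ideal A} {χ : A →ₐ[ℂ] ℂ}
  {B : Type u} [CommRing B] [Algebra ℂ B] {JB IB : Ideal B} {χB : B →ₐ[ℂ] ℂ}
  {S : FormalPoissonGerm.{v}} {m : ℕ} {k : ℤ}

/-- The slice at a complex point given by a decomposition along a closed subscheme containing this
point. -/
theorem exists_isSlice (hJ : J.FG) (hI : I.FG) (hJI : J ≤ I) (hχ : ∀ a, χ a = 0 ↔ a ∈ I)
    (hJB : JB.FG) (πA : Bivector A) {πB : Bivector (AdicCompletion JB B)}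
    {W : ℤ → Set (AdicCompletion JB B)} (c : StandardCoordinates πB W m k)
    [IsLocalRing (AdicCompletion I A)]
    (Φ : AdicCompletion J A ≃ₐ[ℂ] CompletedTensor (idealOfDefinition JB) S.maxIdeal)
    (hΦ : IsPoissonIso (πA.completion J)
      ((πB.prod S.bivector).completion (tensorIdeal (idealOfDefinition JB) S.maxIdeal)) Φ) :
    ∃ (p q : Fin (m + 1) → AdicCompletion I A) (s : S.carrier →ₐ[ℂ] AdicCompletion I A)
      (r : AdicCompletion I A →ₐ[ℂ] S.carrier), IsSlice (πA.completion I) S p q s r := by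
  have := isAdicComplete_idealOfDefinition hJB
  have := isAdicComplete_idealOfDefinition hI
  have := isAdicComplete_idealOfDefinition hJ
  have hmax := maximalIdeal_completion hI hχ
  obtain ⟨χI, -⟩ := exists_character_completion (I := I) (fun a ha => (hχ a).2 ha)
  obtain ⟨γ, hγ, -, hγbr⟩ := exists_restriction hJ hI hJI πA
  obtain ⟨χJ, hχJ⟩ := exists_character_completion (I := J) (fun a ha => (hχ a).2 (hJI ha))
  -- The point is carried to the product and then to its first factor; the value of `t` there is the
  -- constant `l` in the position `t - l`.
  set χT : CompletedTensor (idealOfDefinition JB) S.maxIdeal →ₐ[ℂ] ℂ :=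
    χJ.comp (Φ.symm : _ →ₐ[ℂ] _) with hχT
  set χO : AdicCompletion JB B →ₐ[ℂ] ℂ := χT.comp (fstHom _ _) with hχO
  set l := χO c.t
  -- The retraction evaluates the first factor at the point and keeps functions on `S`.
  obtain ⟨rT, hrT₁, hrT₂, -⟩ := exists_lift (𝔞 := idealOfDefinition JB) (𝔪 := S.maxIdeal)
    (K := S.maxIdeal) ((Algebra.ofId ℂ S.carrier).comp χO) (AlgHom.id ℂ S.carrier)
    (fun a ha => by
      rw [AlgHom.comp_apply, character_eq_zero_of_mem χO ha, map_zero]; exact zero_mem _)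
    (fun f hf => hf)
  set M : Ideal (CompletedTensor (idealOfDefinition JB) S.maxIdeal) :=
    (RingHom.ker χO).map (fstHom _ S.maxIdeal) ⊔ S.maxIdeal.map (sndHom _ S.maxIdeal) with hM
  have hMr : M ≤ S.maxIdeal.comap rT := by
    rw [hM, sup_le_iff, Ideal.map_le_iff_le_comap, Ideal.map_le_iff_le_comap]
    refine ⟨fun a ha => ?_, fun f hf => ?_⟩
    · change rT (fstHom _ _ a) ∈ S.maxIdeal
      rw [hrT₁, AlgHom.comp_apply, (RingHom.mem_ker).1 ha, map_zero]; exact zero_mem _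
    · change rT (sndHom _ _ f) ∈ S.maxIdeal
      rw [hrT₂]; exact hf
  have hΦM {a : A} (ha : a ∈ I) : Φ (AdicCompletion.of J A a) ∈ M := by
    refine CompletedTensor.mem_of_character_eq_zero (hJB.map _) χT ?_
    change χJ (Φ.symm (Φ _)) = 0
    rw [AlgEquiv.symm_apply_apply, hχJ, hχ]
    exact ha
  -- The retraction extends to the completion at the point because it sends functions vanishing
  -- there into the maximal ideal of `S`. This avoids describing that completion as a product.
  obtain ⟨r, hr⟩ := exists_lift_completion (J := I) (K := S.maxIdeal)
    (rT.comp (Φ.toAlgHom.comp (AdicCompletion.ofAlgHom' J)))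
    (fun a ha => hMr (x := Φ (AdicCompletion.of J A a)) (hΦM ha))
  have hrI : ∀ a ∈ J, rT (Φ (AdicCompletion.of J A a)) ∈ S.maxIdeal := fun a ha =>
    hMr (hΦM (hJI ha))
  have hrγ (x : AdicCompletion J A) : r (γ x) = rT (Φ x) := by
    refine (topGenerates_range_of hJ).algHom_ext (K := S.maxIdeal) (r.comp γ)
      (rT.comp (Φ : AdicCompletion J A →ₐ[ℂ] _)) ?_ ?_ ?_ x
    · refine map_idealOfDefinition_mem _ fun a ha => ?_
      rw [AlgHom.comp_apply, hγ, hr]; exact hrI a ha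
    · exact map_idealOfDefinition_mem _ hrI
    · rintro _ ⟨a, rfl⟩
      rw [AlgHom.comp_apply, hγ, hr]; rfl
  set G : CompletedTensor (idealOfDefinition JB) S.maxIdeal →ₐ[ℂ] AdicCompletion I A :=
    γ.comp Φ.symm.toAlgHom with hG
  have hGΦ (x) : G (Φ x) = γ x := congrArg γ (Φ.symm_apply_apply x)
  have hr' (z) : r (G z) = rT z :=
    (hrγ (Φ.symm z)).trans (congrArg rT (Φ.apply_symm_apply z))
  have hGbr (x y) : G (((πB.prod S.bivector).completion
      (tensorIdeal (idealOfDefinition JB) S.maxIdeal)).br x y)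
        = (πA.completion I).br (G x) (G y) := by
    obtain ⟨x, rfl⟩ := Φ.surjective x
    obtain ⟨y, rfl⟩ := Φ.surjective y
    rw [← hΦ, hGΦ, hGΦ, hGΦ, hγbr]
  have hGmax : IsLocalRing.maximalIdeal (AdicCompletion I A) ≤
      ((c.darbouxIdeal l).map (fstHom (idealOfDefinition JB) S.maxIdeal) ⊔
        S.maxIdeal.map (sndHom (idealOfDefinition JB) S.maxIdeal)).map G := by
    rw [hmax, idealOfDefinition, Ideal.map_le_iff_le_comap]
    intro a ha
    have h1 : M ≤ (c.darbouxIdeal l).map (fstHom _ S.maxIdeal) ⊔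
        S.maxIdeal.map (sndHom _ S.maxIdeal) :=
      sup_le_sup_right (Ideal.map_mono fun x hx => c.mem_darbouxIdeal hJB χO hx) _
    have h2 := Ideal.mem_map_of_mem G (h1 (hΦM ha))
    rwa [hGΦ, hγ] at h2
  refine ⟨_, _, _, r, IsSlice.of_completedTensor G hGbr
    c.br_momenta_momenta (c.br_positions_positions l) (c.br_momenta_positions l) r
    (fun f => ?_) (fun i => ?_) (fun i => ?_) (fun x => ⟨χI x, ?_⟩) hGmax⟩
  · rw [hr', hrT₂]; rfl
  · rw [hr', hrT₁, AlgHom.comp_apply, c.character_darbouxIdeal hJB χO _ (c.momenta_mem l i),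
      map_zero]
  · rw [hr', hrT₁, AlgHom.comp_apply, c.character_darbouxIdeal hJB χO _ (c.positions_mem l i),
      map_zero]
  · rw [hmax]; exact sub_character_mem_idealOfDefinition hI hχ χI x

/-- The slice at a complex point given by a decomposition of the formal neighbourhood of this
point. -/
theorem exists_isSlice_of_pointwise (hI : I.FG) (hχ : ∀ a, χ a = 0 ↔ a ∈ I)
    (hJB : JB.FG) (hIB : IB.FG) (hJIB : JB ≤ IB) (hχB : ∀ b, χB b = 0 ↔ b ∈ IB)
    (πA : Bivector A) {πB : Bivector B}
    {W : ℤ → Set (AdicCompletion JB B)} (c : StandardCoordinates (πB.completion JB) W m k)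
    [IsLocalRing (AdicCompletion I A)]
    (Ψ : AdicCompletion I A ≃ₐ[ℂ] CompletedTensor (idealOfDefinition IB) S.maxIdeal)
    (hΨ : IsPoissonIso (πA.completion I) (((πB.completion IB).prod S.bivector).completion
      (tensorIdeal (idealOfDefinition IB) S.maxIdeal)) Ψ) :
    ∃ (p q : Fin (m + 1) → AdicCompletion I A) (s : S.carrier →ₐ[ℂ] AdicCompletion I A)
      (r : AdicCompletion I A →ₐ[ℂ] S.carrier), IsSlice (πA.completion I) S p q s r := by
  have := isAdicComplete_idealOfDefinition hIB
  have := isAdicComplete_idealOfDefinition hJB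
  have := isAdicComplete_idealOfDefinition hI
  have hmax := maximalIdeal_completion hI hχ
  obtain ⟨χI, -⟩ := exists_character_completion (I := I) (fun a ha => (hχ a).2 ha)
  obtain ⟨χIB, hχIB⟩ := exists_character_completion (I := IB) (fun a ha => (hχB a).2 ha)
  obtain ⟨γ, hγ, -, hγbr⟩ := exists_restriction hJB hIB hJIB πB
  set χO : AdicCompletion JB B →ₐ[ℂ] ℂ := χIB.comp γ with hχO
  set l := χO c.t
  obtain ⟨rT, hrT₁, hrT₂, -⟩ := exists_lift (𝔞 := idealOfDefinition IB) (𝔪 := S.maxIdeal)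
    (K := S.maxIdeal) ((Algebra.ofId ℂ S.carrier).comp χIB) (AlgHom.id ℂ S.carrier)
    (fun a ha => by
      rw [AlgHom.comp_apply, character_eq_zero_of_mem χIB ha, map_zero]; exact zero_mem _)
    (fun f hf => hf)
  set G : CompletedTensor (idealOfDefinition IB) S.maxIdeal →ₐ[ℂ] AdicCompletion I A :=
    Ψ.symm.toAlgHom with hG
  have hGΨ (x) : G (Ψ x) = x := Ψ.symm_apply_apply x
  set r : AdicCompletion I A →ₐ[ℂ] S.carrier := rT.comp Ψ.toAlgHom with hr
  have hrG (z) : r (G z) = rT z := congrArg rT (Ψ.apply_symm_apply z)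
  have hGbr (x y) : G ((((πB.completion IB).prod S.bivector).completion
      (tensorIdeal (idealOfDefinition IB) S.maxIdeal)).br x y)
        = (πA.completion I).br (G x) (G y) := by
    obtain ⟨x, rfl⟩ := Ψ.surjective x
    obtain ⟨y, rfl⟩ := Ψ.surjective y
    rw [← hΨ, hGΨ, hGΨ, hGΨ]
  -- The coordinates are given along the larger closed subscheme and are restricted to the
  -- neighbourhood of the point.
  set p : Fin (m + 1) → AdicCompletion IB B := fun i => γ (c.momenta i) with hp
  set q : Fin (m + 1) → AdicCompletion IB B := fun i => γ (c.positions l i) with hq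
  have hp0 (i) : χIB (p i) = 0 := c.character_darbouxIdeal hJB χO _ (c.momenta_mem l i)
  have hq0 (i) : χIB (q i) = 0 := c.character_darbouxIdeal hJB χO _ (c.positions_mem l i)
  set χT : CompletedTensor (idealOfDefinition IB) S.maxIdeal →ₐ[ℂ] ℂ := χI.comp G with hχT
  have hker : RingHom.ker (χT.comp (fstHom (idealOfDefinition IB) S.maxIdeal))
      ≤ Ideal.span (Set.range p ∪ Set.range q) := by
    have hmaxB := isMaximal_idealOfDefinition hIB hχB
    have h3 : idealOfDefinition IB ≤
        RingHom.ker (χT.comp (fstHom (idealOfDefinition IB) S.maxIdeal)) :=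
      fun b hb => character_eq_zero_of_mem (J := idealOfDefinition IB) (χT.comp _) hb
    -- The ideal of definition is maximal and contained in this kernel, hence equal to it; the point
    -- induced by `Ψ` need not be compared with the given one.
    rw [← hmaxB.eq_of_le (RingHom.ker_ne_top _) h3, idealOfDefinition, Ideal.map_le_iff_le_comap]
    intro b hb
    have h4 := c.mem_darbouxIdeal hJB χO (x := AdicCompletion.of JB B b) (by
      rw [hχO, AlgHom.comp_apply, hγ, hχIB, hχB]; exact hb)
    have h5 := Ideal.mem_map_of_mem γ h4
    rw [hγ, StandardCoordinates.darbouxIdeal, Ideal.map_span, Set.image_union, ← Set.range_comp,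
      ← Set.range_comp] at h5
    exact h5
  have hGmax : IsLocalRing.maximalIdeal (AdicCompletion I A) ≤
      ((Ideal.span (Set.range p ∪ Set.range q)).map (fstHom (idealOfDefinition IB) S.maxIdeal) ⊔
        S.maxIdeal.map (sndHom (idealOfDefinition IB) S.maxIdeal)).map G := by
    rw [hmax]
    intro x hx
    have h1 := CompletedTensor.mem_of_character_eq_zero (hIB.map _) χT (x := Ψ x) (by
      rw [hχT, AlgHom.comp_apply, hGΨ]
      exact character_eq_zero_of_mem χI hx)
    have hle : (RingHom.ker (χT.comp (fstHom (idealOfDefinition IB) S.maxIdeal))).map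
        (fstHom (idealOfDefinition IB) S.maxIdeal) ⊔
          S.maxIdeal.map (sndHom (idealOfDefinition IB) S.maxIdeal) ≤ _ :=
      sup_le_sup_right (Ideal.map_mono hker) _
    have h2 := Ideal.mem_map_of_mem G (hle h1)
    rwa [hGΨ] at h2
  refine ⟨_, _, _, r, IsSlice.of_completedTensor G hGbr
    (fun i j => ?_) (fun i j => ?_) (fun i j => ?_) r (fun f => ?_) (fun i => ?_) (fun i => ?_)
    (fun x => ⟨χI x, ?_⟩) hGmax⟩
  · rw [hp, ← hγbr, c.br_momenta_momenta, map_zero]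
  · rw [hq, ← hγbr, c.br_positions_positions, map_zero]
  · rw [hp, hq, ← hγbr, c.br_momenta_positions]; split_ifs <;> simp
  · rw [hrG, hrT₂]; rfl
  · rw [hrG, hrT₁, AlgHom.comp_apply, hp0, map_zero]
  · rw [hrG, hrT₁, AlgHom.comp_apply, hq0, map_zero]
  · rw [hmax]; exact sub_character_mem_idealOfDefinition hI hχ χI x

end Slices

/-! ### Conclusion -/

namespace ComplexVariety

variable {X : ComplexVariety} {U : X.toScheme.Opens}

lemma Point.exists_character_quotient (hU : IsAffineOpen U) (y : X.Point) (hy : y.support ⊆ U)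
    {K : Ideal Γ(X.toScheme, U)} (hK : K ≤ vanishingIdeal hU y.support) :
    ∃ χ : (Γ(X.toScheme, U) ⧸ K) →ₐ[ℂ] ℂ,
      ∀ a, χ a = 0 ↔ a ∈ (vanishingIdeal hU y.support).map (Ideal.Quotient.mk K) := by
  refine ⟨Ideal.Quotient.liftₐ K (y.eval hy) fun a ha => (y.eval_eq_zero_iff hU hy a).2 (hK ha),
    fun a => ?_⟩
  obtain ⟨a, rfl⟩ := Ideal.Quotient.mk_surjective a
  rw [Ideal.mem_quotient_iff_mem hK, ← y.eval_eq_zero_iff hU hy]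
  rfl

end ComplexVariety

theorem corollary3p8
    -- the Poisson variety `X` with its `ℂˣ`-action, the Poisson structure of degree `-k`
    (X : ComplexVariety) (α : GmAction X) (π : PoissonStructure X) (k : ℤ)
    (hk : π.HomogeneousOfDegree α (-k))
    -- the `ℂˣ`-stable symplectic leaf `Y` and the point `y` with trivial stabilizer
    (Y : Set X.toScheme) (hY : π.IsSymplecticLeaf Y) (hYα : α.IsStable Y)
    (y : X.Point) (hy : y.support ⊆ Y) (hyα : α.TrivialStabilizer y)
    -- an affine open `U` in which the orbit is closed, used to define completions
    (U : X.toScheme.Opens) (hU : IsAffineOpen U) (hLU : α.orbit y ⊆ U)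
    (hLc : ∃ Z : Set X.toScheme, IsClosed Z ∧ α.orbit y = Z ∩ U)
    -- a slice `S` of a `ℂˣ`-equivariant decomposition along the orbit
    (S : FormalPoissonGerm.{u})
    (decomp : EquivariantDecomposition (π.hat hU (α.orbit y)) (α.hatWeight hU (α.orbit y))
      (hY.hat hU (α.orbit y)) (α.hatWeightIn hU Y (α.orbit y)) k S)
    -- an action of `ℂˣ` on `S` for which the Poisson structure has degree `-k`
    (ρ : S.CxAction) (hρ : ρ.HomogeneousOfDegree (-k))
    (hS : S.PoissonFieldsHamiltonian) :
    -- `X̂` is `ℂˣ`-equivariantly Poisson isomorphic to the product of `Ŷ` and `S`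
    (∃ Φ : FormalNbhd hU (α.orbit y) ≃ₐ[ℂ] FormalProduct hU Y (α.orbit y) S,
      IsBicontinuous Φ ∧
      (∀ d f, f ∈ α.hatWeight hU (α.orbit y) d ↔ Φ f ∈ CompletedTensor.weight
        (nbhdIdeal hU Y (α.orbit y)) S.maxIdeal (α.hatWeightIn hU Y (α.orbit y)) ρ.weight d) ∧
      IsPoissonIso (π.hat hU (α.orbit y)) (hY.hatProd hU (α.orbit y) S) Φ) ∧
    -- every slice `S'` of an ordinary decomposition at `y` is isomorphic to `S`
    (∀ (S' : FormalPoissonGerm.{v})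
      (Ψ : FormalNbhd hU y.support ≃ₐ[ℂ] FormalProduct hU Y y.support S'),
      IsBicontinuous Ψ →
      IsPoissonIso (π.hat hU y.support) (hY.hatProd hU y.support S') Ψ →
      ∃ θ : S.carrier ≃ₐ[ℂ] S'.carrier, IsPoissonIso S.bivector S'.bivector θ) := by
  have hyU : y.support ⊆ U := (α.support_subset_orbit y).trans hLU
  have hFG (K I : Ideal Γ(X.toScheme, U)) := ComplexVariety.map_mk_fg hU K I
  obtain ⟨Φ, hΦc, hΦw, hΦ⟩ := EquivariantDecomposition.exists_poissonIso (D := decomp) (hFG _ _)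
    (α.weightsAreStandard hU _ hLc (hFG _ _) decomp.coords) hρ hS
  refine ⟨⟨Φ, hΦc, hΦw, hΦ⟩, fun S' Ψ _ hΨ => ?_⟩
  have horbit : ComplexVariety.vanishingIdeal hU (α.orbit y)
      ≤ ComplexVariety.vanishingIdeal hU y.support :=
    ComplexVariety.vanishingIdeal_anti hU (α.support_subset_orbit y)
  obtain ⟨χ, hχ⟩ := y.exists_character_quotient hU hyU (K := ⊥) bot_le
  obtain ⟨χY, hχY⟩ := y.exists_character_quotient hU hyU (ComplexVariety.vanishingIdeal_anti hU hy)
  have := isLocalRing_completion (hFG _ _) hχ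
  have : IsAdicComplete (IsLocalRing.maximalIdeal (FormalNbhd hU y.support))
      (FormalNbhd hU y.support) := by
    rw [maximalIdeal_completion (hFG _ _) hχ]
    exact isAdicComplete_idealOfDefinition (hFG _ _)
  obtain ⟨_, _, _, _, h⟩ := exists_isSlice (hFG _ _) (hFG _ _) (Ideal.map_mono horbit) hχ (hFG _ _)
    ((π.bivector U).quotient ⊥ π.br_mem_bot) decomp.coords Φ hΦ
  -- The Darboux coordinates of both slices come from the same `decomp.coords`, so there are equally
  -- many pairs, as the comparison requires.
  obtain ⟨_, _, _, _, h'⟩ := exists_isSlice_of_pointwise (hFG _ _) hχ (hFG _ _) (hFG _ _)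
    (Ideal.map_mono horbit) hχY ((π.bivector U).quotient ⊥ π.br_mem_bot) decomp.coords Ψ hΨ
  exact h.exists_poissonIso
    (((π.isPoisson U).quotient ⊥ π.br_mem_bot).completion (hFG _ _)) h'
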